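/- **Corollary (the augmented energy is monotonically decreasing).** Let $X$ be a separable reflexive real Banach space, compactly, densely and injectively embedded in a separable real Hilbert space $H$ (so $X\hookrightarrow H\hookrightarrow X'$ is a Gelfand triple), let $\alpha\in(0,1)$, $T>0$, $p>1$, $p'=p/(p-1)$, $g_\beta(t)=t^{\beta-1}/\Gamma(\beta)$. Let $\mathcal E\in C^1(X;\mathbb R)$ with derivative $\mathrm{grad}_H\mathcal E:X\to X'$, $\langle \mathrm{grad}_H\mathcal E(x),v\rangle=\delta\mathcal E(x,v)$, satisfy for all $x\in X$ $$\|\mathrm{grad}_H\mathcal E(x)\|_{X'}\le C_0\|x\|_X^{p-1}+C_0,\qquad \delta\mathcal E(x,x)\ge C_1\|x\|_X^p-C_2\|x\|_H^2,\qquad C_1>0 .$$ Assume moreover that the realization $\mathrm{grad}_H\mathcal E:L^p(0,T;X)\to L^{p'}(0,T;X')$ is weak-to-weak (sequentially) continuous, or that $\mathcal E$ is $\lambda$-convex with respect to $H$ for some $\lambda\in\mathbb R$ (i.e. $x\mapsto\mathcal E(x)-\frac\lambda2\|x\|_H^2$ is convex). Let $u_0\in X$ and let $u$ be a variational solution of the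 time-fractional gradient flow $\partial_t^\alpha u=-\mathrm{grad}_H\mathcal E(u)$ with initial value $u_0$: $u\in L^p(0,T;X)\cap L^\infty(0,T;H)$; $g_{1-\alpha}*(u-u_0)\in C([0,T];H)$ tends to $0$ in $H$ as $t\to0$; the distributional derivative $\partial_t^\alpha u:=\frac{d}{dt}\big(g_{1-\alpha}*(u-u_0)\big)$ lies in $L^{p'}(0,T;X')$; and $\langle\partial_t^\alpha u,v\rangle+\delta\mathcal E(u,v)=0$ a.e. in $(0,T)$ for all $v\in X$. For $\theta\in(0,1)$ put $w_\alpha(\theta)=g_{1-\alpha}(\theta)g_\alpha(1-\theta)$, $c_0(\theta)=\frac1{1-\theta}$, $c_1(\theta)=\frac\theta{1-\theta}$, let $\widetilde H=L^2\big(0,1;H;(1-\theta)w_\alpha(\theta)\,d\theta\big)$, and define $$\widetilde u(t,\theta)=(\mathcal Gu)(t,\theta)=-c_0(\theta)\int_0^te^{-c_1(\theta)(t-s)}\,\mathrm{grad}_H\mathcal E(u(s))\,ds\in X',$$ $$\mathcal C\widetilde v=u_0+\int_0^1w_\alpha(\theta)\widetilde v(\theta)\,d\theta,\qquad \mathcal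 H(\widetilde v)=\frac12\int_0^1\theta\,w_\alpha(\theta)\|\widetilde v(\theta)\|_H^2\,d\theta,\qquad \widetilde{\mathcal E}=\mathcal E\circ\mathcal C+\mathcal H .$$ Then $\widetilde u$ takes values in $H$ and $\widetilde u\in H^1(0,T;\widetilde H)$ with $\widetilde u(0)=0$; for a.e. $t\in(0,T)$ one has $\widetilde u(t)\in L^2(0,1;H;w_\alpha\,d\theta)$ and $\mathcal C\widetilde u(t)=u(t)$, so that the augmented energy $$\mathcal E^{\mathrm{aug}}(u)(t)=\mathcal E(u(t))+\mathcal H(\mathcal Gu(t))=\widetilde{\mathcal E}(\widetilde u(t))$$ is well defined and finite for a.e. $t$. It coincides a.e. on $(0,T)$ with a non-increasing, absolutely continuous function $\Phi$ on $[0,T]$ with $\Phi(0)=\mathcal E(u_0)$, and $$\Phi(t)=\Phi(s)-\int_s^t\|\partial_t\widetilde u(r)\|_{\widetilde H}^2\,dr\quad(0\le s\le t\le T),\qquad \frac{d}{dt}\widetilde{\mathcal E}(\widetilde u)=\Phi'(t)=-\|\partial_t\widetilde u(t)\|_{\widetilde H}^2\quad\text{for a.e. }t\in(0,T).$$ -/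

import Mathlib

open Set Filter Topology MeasureTheory
open scoped ENNReal ContDiff

noncomputable section

/-! ### Fractional integrals and weak Caputo derivatives -/

/-- The kernel `g_β(t) = t^(β-1) / Γ(β)`, used for `t > 0`. -/
def gKer (β t : ℝ) : ℝ := t ^ (β - 1) / Real.Gamma β

/-- The Riemann--Liouville integral `(g_β * f)(t) = ∫₀ᵗ g_β(t-s) f(s) ds`. -/
def rlIntegral {H : Type*} [NormedAddCommGroup H] [NormedSpace ℝ H]
    (β : ℝ) (f : ℝ → H) (t : ℝ) : H :=
  ∫ s in (0 : ℝ)..t, gKer β (t - s) • f s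

/-- Lebesgue measure on the time interval `(0,T)`; `MemLp f q (timeMeasure T)` says
`f ∈ L^q(0,T; ·)`. -/
def timeMeasure (T : ℝ) : Measure ℝ := volume.restrict (Ioo 0 T)

/-- The embedding `H ↪ X'` of a Gelfand triple, `h ↦ (h, ι ·)_H`. -/
def toDualX {X H : Type*} [NormedAddCommGroup X] [NormedSpace ℝ X]
    [NormedAddCommGroup H] [InnerProductSpace ℝ H] (ι : X →L[ℝ] H) (h : H) : X →L[ℝ] ℝ :=
  (innerSL ℝ h).comp ι

/-- `w : (0,T) → X'` is the (generalised) Caputo derivative of order `α` of `f : (0,T) → H` with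
initial value `f₀`: `w = d/dt (g_{1-α} * (f - f₀))` as `X'`-valued distributions on `(0,T)`. -/
def IsWeakCaputoDeriv {X H : Type*} [NormedAddCommGroup X] [NormedSpace ℝ X]
    [NormedAddCommGroup H] [InnerProductSpace ℝ H] (ι : X →L[ℝ] H)
    (α T : ℝ) (f : ℝ → H) (f₀ : H) (w : ℝ → X →L[ℝ] ℝ) : Prop :=
  ∀ (v : X) (η : ℝ → ℝ), ContDiff ℝ ∞ η → HasCompactSupport η → tsupport η ⊆ Ioo 0 T →
    ∫ t, toDualX ι (rlIntegral (1 - α) (fun s => f s - f₀) t) v * deriv η t ∂(timeMeasure T) =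
      - ∫ t, w t v * η t ∂(timeMeasure T)

/-! ### Energies and the time-fractional gradient flow -/

/-- `grad_H E : X → X'`, `⟨grad_H E(u), v⟩ = δE(u, v)`, for a Fréchet differentiable energy. -/
def gradE {X : Type*} [NormedAddCommGroup X] [NormedSpace ℝ X] (E : X → ℝ) (x : X) : X →L[ℝ] ℝ :=
  fderiv ℝ E x

/-- `E` is `lam`-convex with respect to the norm of `H`. -/
def IsSemiconvex {X H : Type*} [NormedAddCommGroup X] [NormedSpace ℝ X]
    [NormedAddCommGroup H] [InnerProductSpace ℝ H] (ι : X →L[ℝ] H) (E : X → ℝ) (lam : ℝ) : Prop :=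
  ConvexOn ℝ univ (fun x => E x - lam / 2 * ‖ι x‖ ^ 2)

/-- The realization `L^p(0,T;X) → L^{p'}(0,T;X')`, `u ↦ grad_H E(u(·))`, is weak-to-weak
(sequentially) continuous. For `1 < p` and reflexive `X` the dual of `L^p(0,T;X)` is
`L^{p'}(0,T;X')` and conversely, so that weak convergence is tested as below. -/
def GradWeakToWeak {X : Type*} [NormedAddCommGroup X] [NormedSpace ℝ X]
    (E : X → ℝ) (p T : ℝ) : Prop :=
  ∀ (U : ℕ → ℝ → X) (u : ℝ → X),
    (∀ k, MemLp (U k) (ENNReal.ofReal p) (timeMeasure T)) →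
    MemLp u (ENNReal.ofReal p) (timeMeasure T) →
    (∀ φ : ℝ → X →L[ℝ] ℝ, MemLp φ (ENNReal.ofReal p.conjExponent) (timeMeasure T) →
      Tendsto (fun k => ∫ t, φ t (U k t) ∂(timeMeasure T)) atTop
        (𝓝 (∫ t, φ t (u t) ∂(timeMeasure T)))) →
    ∀ ζ : ℝ → X, MemLp ζ (ENNReal.ofReal p) (timeMeasure T) →
      Tendsto (fun k => ∫ t, gradE E (U k t) (ζ t) ∂(timeMeasure T)) atTop
        (𝓝 (∫ t, gradE E (u t) (ζ t) ∂(timeMeasure T)))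

/-- `u` is a variational solution on `(0,T)` of `∂_t^α u = - grad_H E(u)` with initial value `u₀`:
`u ∈ L^p(0,T;X) ∩ L^∞(0,T;H) ∩ W^{α,p'}(0,T;X')`, the initial value is attained in the sense that
`g_{1-α} * (u - u₀) ∈ C([0,T];H)` tends to `0` in `H` as `t → 0`, and
`⟨∂_t^α u, v⟩ + δE(u, v) = 0` for all `v ∈ X`. -/
structure IsVariationalSolution {X H : Type*} [NormedAddCommGroup X] [NormedSpace ℝ X]
    [NormedAddCommGroup H] [InnerProductSpace ℝ H] (ι : X →L[ℝ] H) (E : X → ℝ)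
    (p α T : ℝ) (u₀ : H) (u : ℝ → X) : Prop where
  memLp_X : MemLp u (ENNReal.ofReal p) (timeMeasure T)
  memLp_H : MemLp (fun t => ι (u t)) ∞ (timeMeasure T)
  continuousOn : ContinuousOn (rlIntegral (1 - α) (fun s => ι (u s) - u₀)) (Icc 0 T)
  initial : Tendsto (rlIntegral (1 - α) (fun s => ι (u s) - u₀)) (𝓝[>] 0) (𝓝 0)
  equation : ∃ w : ℝ → X →L[ℝ] ℝ,
    MemLp w (ENNReal.ofReal p.conjExponent) (timeMeasure T) ∧
    IsWeakCaputoDeriv ι α T (fun t => ι (u t)) u₀ w ∧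
    ∀ v : X, ∀ᵐ t ∂(timeMeasure T), w t v + gradE E (u t) v = 0

/-! ### The extended variable, the weights and the augmented energy -/

/-- `w_α(θ) = g_{1-α}(θ) g_α(1-θ)`. -/
def wgt (α θ : ℝ) : ℝ := gKer (1 - α) θ * gKer α (1 - θ)

/-- `w_{α,0}(θ) = w_α(θ) (1-θ)`. -/
def wgt0 (α θ : ℝ) : ℝ := wgt α θ * (1 - θ)

/-- `w_{α,1}(θ) = w_α(θ) θ`. -/
def wgt1 (α θ : ℝ) : ℝ := wgt α θ * θ

/-- The measure `w(θ) dθ` on `(0,1)`. -/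
def wgtMeasure (w : ℝ → ℝ) : Measure ℝ :=
  (volume.restrict (Ioo (0 : ℝ) 1)).withDensity (fun θ => ENNReal.ofReal (w θ))

/-- `H̃ = L²(0,1; H; w_{α,0})`. -/
abbrev HTilde (H : Type*) [NormedAddCommGroup H] (α : ℝ) : Type _ :=
  Lp H 2 (wgtMeasure (wgt0 α))

/-- `c₀(θ) = 1 / (1-θ)`. -/
def cZero (θ : ℝ) : ℝ := 1 / (1 - θ)

/-- `c₁(θ) = θ / (1-θ)`. -/
def cOne (θ : ℝ) : ℝ := θ / (1 - θ)

/-- `(G u)(t,θ) = - c₀(θ) ∫₀ᵗ exp(-c₁(θ)(t-s)) grad_H E(u(s)) ds`, an element of `X'`. -/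
def extState {X : Type*} [NormedAddCommGroup X] [NormedSpace ℝ X]
    (E : X → ℝ) (u : ℝ → X) (t θ : ℝ) : X →L[ℝ] ℝ :=
  -(cZero θ • ∫ s in (0 : ℝ)..t, Real.exp (-(cOne θ * (t - s))) • gradE E (u s))

/-- `C v = u₀ + ∫₀¹ w_α(θ) v(θ) dθ`. -/
def reconstruct {H : Type*} [NormedAddCommGroup H] [NormedSpace ℝ H]
    (α : ℝ) (u₀ : H) (v : ℝ → H) : H :=
  u₀ + ∫ θ in Ioo (0 : ℝ) 1, wgt α θ • v θ

/-- The history energy `½ ∫₀¹ w_{α,1}(θ) ‖v(θ)‖² dθ`. -/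
def historyEnergy {H : Type*} [NormedAddCommGroup H] (α : ℝ) (v : ℝ → H) : ℝ :=
  1 / 2 * ∫ θ in Ioo (0 : ℝ) 1, wgt1 α θ * ‖v θ‖ ^ 2

/-- `Ẽ = E ∘ C + historyEnergy`. Here `E` is regarded as a function on the subspace `ι(X)` of `H`
(with the junk value `0` outside of it). -/
def extEnergy {X H : Type*} [NormedAddCommGroup X] [NormedSpace ℝ X]
    [NormedAddCommGroup H] [InnerProductSpace ℝ H] (ι : X →L[ℝ] H) (E : X → ℝ)
    (α : ℝ) (u₀ : H) (v : ℝ → H) : ℝ :=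
  Function.extend ι E (fun _ => 0) (reconstruct α u₀ v) + historyEnergy α v

end

/-!
The kernel is a superposition of exponentials: `g_α(r) = ∫ exp(-c₁(θ) r) dν(θ)` with the measure
`ν = w_α c₀ dθ` on `(0,1)` (`integral_exp_cOne`). With `f = -grad E(u)` and
`K_c z (t) = ∫₀ᵗ exp(-c(t-s)) z(s) ds`, the inverted equation `u - u₀ = g_α * f` says that
`u - u₀ = ∫ U dν`, where `U(·,θ) = K_{c(θ)} f` solves the relaxation equation `∂ₜU + c U = f`.
The extended state of the theorem is `c₀ U`, and multiplication by `c₀` is an isometry of `L²(ν;H)`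
into `H̃` (`extIso`). Formally, pairing the relaxation equation with `∂ₜU` and integrating over `θ`
gives the identity `d/dt (E(u) + ½ ∫ c ‖U‖² dν) = -∫ ‖∂ₜU‖² dν`. The proof makes this rigorous for
any kernel of this kind; `IsSuperposedFlow` collects what it needs. Three points are at issue.

*Semiconvexity.* Only the gradient inequality of a semiconvex energy is used. It is available under
the first alternative, too: testing the weak continuity of the realization with functions that
oscillate rapidly between two values shows that `grad E` is affine (`GradWeakToWeak.map_midpoint`),
so that `E` is quadratic, and the coercivity then bounds its quadratic part from below.

*Existence of `∂ₜU` in `L²(0,T;L²(ν;H))`.* A priori `f` takes values in `X'` only, but its primitive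
`F = g_{1-α} * (u - u₀)` is a continuous function in `H`. The regularization `a K_a b K_b` of the
force is a primitive of `H`-valued functions `ψ`, for which an energy inequality bounds
`∫∫ ‖K_c ψ‖² dν dt` by the pairing of the regularized force with the derivative of the regularized
state `u` (`integral_integral_norm_sq_expConv_le`). The averages `a K_a` are compatible with
convexity: by the gradient inequality `⟨-grad E(u), a (y - a K_a y)⟩`, with `y = u - u₀`, is bounded
by an expression in the energy, whose time integral is the loss of energy
(`exists_integral_convexForce_le`); the quadratic error of a semiconvex energy is absorbed, because
`∫ (b + c)⁻¹ dν → 0` as `b → ∞`. The resulting bound, `exists_bound_regForce`, is uniform, and a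
weak limit is the derivative of `U` (`exists_derivative`).

*The energy identity.* At almost every time the difference quotients show that
`∂ₜU + c U = f` with `f ∈ H` (`ae_force_eq`). Then `-∂ₜU` is a subgradient, up to a quadratic error,
of the augmented energy at `U` (`IsSuperposedFlow.subgradient`). The energy is only known to be
integrable along the curve, and no chain rule applies directly. The subgradient inequality between
pairs of times, integrated over one of them with a fixed difference, bounds the increments of the
energy by those of `∫ ‖∂ₜU‖²`; so the energy has an absolutely continuous representative, whose
derivative is found by minimization (`exists_ae_eq_const_sub_of_subgradient`). Its initial value is
at most `E(u₀)` by the subgradient inequality against the initial state, and at least `E(u₀)`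
because `u(t)` tends to `u₀` weakly in `X`, by coercivity and reflexivity (`energy_balance`).
-/

/-! ### Causal convolution with an exponential -/

/-- The causal convolution `(K_c z)(t) = ∫₀ᵗ exp(-c(t-s)) z(s) ds`; it solves `q' + c q = z`,
`q(0) = 0`. -/
noncomputable def expConv {B : Type*} [NormedAddCommGroup B] [NormedSpace ℝ B]
    (c : ℝ) (z : ℝ → B) (t : ℝ) : B :=
  ∫ s in (0 : ℝ)..t, Real.exp (-(c * (t - s))) • z s

section ExpConv

variable {B : Type*} [NormedAddCommGroup B] [NormedSpace ℝ B]

lemma MeasureTheory.LocallyIntegrable.intervalIntegrable {B : Type*} [NormedAddCommGroup B]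
    {z : ℝ → B} (hz : LocallyIntegrable z volume) (a b : ℝ) : IntervalIntegrable z volume a b :=
  (hz.integrableOn_isCompact isCompact_uIcc).intervalIntegrable

lemma MeasureTheory.LocallyIntegrable.norm_fun {B : Type*} [NormedAddCommGroup B] {z : ℝ → B}
    (hz : LocallyIntegrable z volume) : LocallyIntegrable (fun s => ‖z s‖) volume :=
  fun x => (hz x).norm

lemma MeasureTheory.LocallyIntegrable.exp_smul {z : ℝ → B} (hz : LocallyIntegrable z volume)
    (c t : ℝ) : LocallyIntegrable (fun s => Real.exp (-(c * (t - s))) • z s) volume :=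
  hz.continuous_smul (by fun_prop)

lemma expConv_zero_left (z : ℝ → B) (t : ℝ) : expConv 0 z t = ∫ s in (0 : ℝ)..t, z s := by
  simp [expConv]

lemma expConv_zero_right (c : ℝ) (z : ℝ → B) : expConv c z 0 = 0 := by
  simp [expConv]

lemma expConv_eq_exp_smul (c : ℝ) (z : ℝ → B) (t : ℝ) :
    expConv c z t = Real.exp (-(c * t)) • ∫ s in (0 : ℝ)..t, Real.exp (c * s) • z s := by
  rw [expConv, ← intervalIntegral.integral_smul]
  refine intervalIntegral.integral_congr fun s _ => ?_
  simp only [smul_smul, ← Real.exp_add]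
  congr 2; ring

lemma continuous_expConv {z : ℝ → B} (hz : LocallyIntegrable z volume) (c : ℝ) :
    Continuous (expConv c z) := by
  have h : expConv c z = fun t => Real.exp (-(c * t)) •
      ∫ s in (0 : ℝ)..t, Real.exp (c * s) • z s := by
    ext t; exact expConv_eq_exp_smul c z t
  rw [h]
  refine Continuous.smul (by fun_prop) ?_
  have h2 : LocallyIntegrable (fun s => Real.exp (c * s) • z s) volume :=
    hz.continuous_smul (by fun_prop)
  exact intervalIntegral.continuous_primitive (fun a b => h2.intervalIntegrable a b) 0

lemma locallyIntegrable_expConv {z : ℝ → B} (hz : LocallyIntegrable z volume) (c : ℝ) :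
    LocallyIntegrable (expConv c z) volume :=
  (continuous_expConv hz c).locallyIntegrable

lemma expConv_add {z₁ z₂ : ℝ → B} (h₁ : LocallyIntegrable z₁ volume)
    (h₂ : LocallyIntegrable z₂ volume) (c t : ℝ) :
    expConv c (fun s => z₁ s + z₂ s) t = expConv c z₁ t + expConv c z₂ t := by
  simp only [expConv, smul_add]
  exact intervalIntegral.integral_add ((h₁.exp_smul c t).intervalIntegrable _ _)
    ((h₂.exp_smul c t).intervalIntegrable _ _)

lemma expConv_sub {z₁ z₂ : ℝ → B} (h₁ : LocallyIntegrable z₁ volume)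
    (h₂ : LocallyIntegrable z₂ volume) (c t : ℝ) :
    expConv c (fun s => z₁ s - z₂ s) t = expConv c z₁ t - expConv c z₂ t := by
  simp only [expConv, smul_sub]
  exact intervalIntegral.integral_sub ((h₁.exp_smul c t).intervalIntegrable _ _)
    ((h₂.exp_smul c t).intervalIntegrable _ _)

lemma expConv_smul (a : ℝ) (z : ℝ → B) (c t : ℝ) :
    expConv c (fun s => a • z s) t = a • expConv c z t := by
  simp only [expConv, ← intervalIntegral.integral_smul]
  exact intervalIntegral.integral_congr fun s _ => smul_comm _ _ _

lemma expConv_congr {z₁ z₂ : ℝ → B} {t : ℝ} (ht : 0 ≤ t) (h : ∀ᵐ s, s ∈ Ioo 0 t → z₁ s = z₂ s)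
    (c : ℝ) : expConv c z₁ t = expConv c z₂ t := by
  simp only [expConv]
  rw [intervalIntegral.integral_of_le ht, intervalIntegral.integral_of_le ht,
    integral_Ioc_eq_integral_Ioo, integral_Ioc_eq_integral_Ioo]
  refine integral_congr_ae ((ae_restrict_iff' measurableSet_Ioo).2 ?_)
  filter_upwards [h] with s hs hst
  rw [hs hst]

lemma ContinuousLinearMap.map_expConv [CompleteSpace B] {B' : Type*} [NormedAddCommGroup B']
    [NormedSpace ℝ B'] [CompleteSpace B'] (L : B →L[ℝ] B') {z : ℝ → B}
    (hz : LocallyIntegrable z volume) (c t : ℝ) :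
    L (expConv c z t) = expConv c (fun s => L (z s)) t := by
  rw [expConv, expConv, ← L.intervalIntegral_comp_comm ((hz.exp_smul c t).intervalIntegrable _ _)]
  simp

lemma norm_expConv_le_expConv_norm (c : ℝ) (z : ℝ → B) {t : ℝ} (ht : 0 ≤ t) :
    ‖expConv c z t‖ ≤ expConv c (fun s => ‖z s‖) t := by
  rw [expConv, expConv]
  refine (intervalIntegral.norm_integral_le_integral_norm ht).trans (le_of_eq ?_)
  refine intervalIntegral.integral_congr fun s _ => ?_
  simp [norm_smul, Real.abs_exp]

lemma expConv_mono {z₁ z₂ : ℝ → ℝ} (h₁ : LocallyIntegrable z₁ volume)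
    (h₂ : LocallyIntegrable z₂ volume) {t : ℝ} (ht : 0 ≤ t)
    (h : ∀ᵐ s, s ∈ Ioo 0 t → z₁ s ≤ z₂ s) (c : ℝ) :
    expConv c z₁ t ≤ expConv c z₂ t := by
  rw [expConv, expConv]
  refine intervalIntegral.integral_mono_ae_restrict ht
    ((h₁.exp_smul c t).intervalIntegrable _ _) ((h₂.exp_smul c t).intervalIntegrable _ _) ?_
  rw [← restrict_Ioo_eq_restrict_Icc]
  refine (ae_restrict_iff' measurableSet_Ioo).2 ?_
  filter_upwards [h] with s hs hst
  exact mul_le_mul_of_nonneg_left (hs hst) (Real.exp_nonneg _)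

lemma expConv_const_mul (c t : ℝ) (a : ℝ) :
    c * expConv c (fun _ => a) t = (1 - Real.exp (-(c * t))) * a := by
  rcases eq_or_ne c 0 with rfl | hc
  · simp
  have h : ∀ s ∈ uIcc 0 t, HasDerivAt (fun s => Real.exp (-(c * (t - s))) * a)
      (c * (Real.exp (-(c * (t - s))) • a)) s := by
    intro s _
    have h1 : HasDerivAt (fun s : ℝ => -(c * (t - s))) c s := by
      simpa using (((hasDerivAt_id' s).const_sub t).const_mul c).fun_neg
    exact (h1.exp.mul_const a).congr_deriv (by rw [smul_eq_mul]; ring)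
  have h2 := intervalIntegral.integral_eq_sub_of_hasDerivAt h
    ((by fun_prop : Continuous fun s => c * (Real.exp (-(c * (t - s))) • a)).intervalIntegrable _ _)
  rw [intervalIntegral.integral_const_mul] at h2
  rw [expConv, h2]; simp; ring

/-- Exchange of the order of integration over the triangle `0 < r < s < t`. -/
lemma intervalIntegral_triangle_swap {h : ℝ → ℝ → B} {t : ℝ} (ht : 0 ≤ t)
    (hint : IntegrableOn (fun p : ℝ × ℝ => h p.1 p.2) {p | 0 < p.2 ∧ p.2 ≤ p.1 ∧ p.1 ≤ t}) :
    ∫ s in (0 : ℝ)..t, ∫ r in (0 : ℝ)..s, h s r = ∫ r in (0 : ℝ)..t, ∫ s in r..t, h s r := by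
  set S : Set (ℝ × ℝ) := {p | 0 < p.2 ∧ p.2 ≤ p.1 ∧ p.1 ≤ t}
  have hS : MeasurableSet S :=
    (measurableSet_lt measurable_const measurable_snd).inter
      ((measurableSet_le measurable_snd measurable_fst).inter
        (measurableSet_le measurable_fst measurable_const))
  have key := intervalIntegral_intervalIntegral_swap (a := 0) (b := t) (c := 0) (d := t)
    (F := fun s r => S.indicator (fun p : ℝ × ℝ => h p.1 p.2) (s, r))
    (((integrable_indicator_iff hS).2 hint).integrableOn)
  convert key using 1
  · rw [intervalIntegral.integral_of_le ht, intervalIntegral.integral_of_le ht]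
    refine setIntegral_congr_fun measurableSet_Ioc fun s hs => ?_
    rw [intervalIntegral.integral_of_le hs.1.le, intervalIntegral.integral_of_le ht,
      ← integral_indicator measurableSet_Ioc, ← integral_indicator measurableSet_Ioc]
    refine integral_congr_ae (Eventually.of_forall fun r => ?_)
    have := hs.2
    by_cases h1 : 0 < r <;> by_cases h2 : r ≤ s <;>
      (simp [indicator_apply, S, h1, h2, this]; try (intros; linarith))
  · rw [intervalIntegral.integral_of_le ht, intervalIntegral.integral_of_le ht]
    refine setIntegral_congr_fun measurableSet_Ioc fun r hr => ?_
    rw [intervalIntegral.integral_of_le hr.2, intervalIntegral.integral_of_le ht,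
      ← integral_Icc_eq_integral_Ioc, ← integral_indicator measurableSet_Ioc,
      ← integral_indicator measurableSet_Icc]
    refine integral_congr_ae (Eventually.of_forall fun s => ?_)
    have := hr.1
    by_cases h1 : r ≤ s <;> by_cases h2 : s ≤ t <;>
      (simp [indicator_apply, S, h1, h2, this]; try (intros; linarith))

/-- The resolvent identity. -/
lemma expConv_resolvent {z : ℝ → B} (hz : LocallyIntegrable z volume) [CompleteSpace B]
    (a b : ℝ) {t : ℝ} (ht : 0 ≤ t) :
    (b - a) • expConv a (expConv b z) t = expConv a z t - expConv b z t := by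
  have hint : IntegrableOn (fun p : ℝ × ℝ => Real.exp (-(a * (t - p.1))) •
      Real.exp (-(b * (p.1 - p.2))) • z p.2) {p | 0 < p.2 ∧ p.2 ≤ p.1 ∧ p.1 ≤ t} := by
    have h1 : IntegrableOn (fun p : ℝ × ℝ => z p.2) (Icc 0 t ×ˢ Icc 0 t) := by
      rw [IntegrableOn, Measure.volume_eq_prod, ← Measure.prod_restrict]
      exact (hz.integrableOn_isCompact isCompact_Icc).integrable.comp_snd _
    have h2 : IntegrableOn (fun p : ℝ × ℝ => (Real.exp (-(a * (t - p.1))) *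
      Real.exp (-(b * (p.1 - p.2)))) • z p.2) (Icc 0 t ×ˢ Icc 0 t) :=
      h1.continuousOn_smul (by fun_prop) (isCompact_Icc.prod isCompact_Icc)
    refine (h2.mono_set fun p hp => ?_).congr_fun (fun p _ => ?_) ?_
    · obtain ⟨h3, h4, h5⟩ := hp
      exact ⟨⟨by linarith, h5⟩, ⟨h3.le, by linarith⟩⟩
    · simp [mul_smul]
    · exact (measurableSet_lt measurable_const measurable_snd).inter
        ((measurableSet_le measurable_snd measurable_fst).inter
          (measurableSet_le measurable_fst measurable_const))
  have h1 : expConv a (expConv b z) t = ∫ s in (0 : ℝ)..t, ∫ r in (0 : ℝ)..s,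
      Real.exp (-(a * (t - s))) • Real.exp (-(b * (s - r))) • z r := by
    simp only [expConv, intervalIntegral.integral_smul]
  rw [h1, intervalIntegral_triangle_swap ht hint, ← intervalIntegral.integral_smul, expConv,
    expConv, ← intervalIntegral.integral_sub ((hz.exp_smul a t).intervalIntegrable _ _)
    ((hz.exp_smul b t).intervalIntegrable _ _)]
  refine intervalIntegral.integral_congr fun r _ => ?_
  simp only [smul_smul]
  rw [intervalIntegral.integral_smul_const, smul_smul, ← sub_smul]
  congr 1
  have h : ∀ s ∈ uIcc r t, HasDerivAt
      (fun s => -(Real.exp (-(a * (t - s))) * Real.exp (-(b * (s - r)))))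
      ((b - a) * (Real.exp (-(a * (t - s))) * Real.exp (-(b * (s - r))))) s := by
    intro s _
    have h1 : HasDerivAt (fun s : ℝ => -(a * (t - s))) a s := by
      simpa using (((hasDerivAt_id' s).const_sub t).const_mul a).fun_neg
    have h2 : HasDerivAt (fun s : ℝ => -(b * (s - r))) (-b) s := by
      simpa using (((hasDerivAt_id' s).sub_const r).const_mul b).fun_neg
    exact (h1.exp.fun_mul h2.exp).fun_neg.congr_deriv (by ring)
  have h2 := intervalIntegral.integral_eq_sub_of_hasDerivAt h
    ((by fun_prop : Continuous fun s => (b - a) * (Real.exp (-(a * (t - s))) *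
      Real.exp (-(b * (s - r))))).intervalIntegrable _ _)
  rw [intervalIntegral.integral_const_mul] at h2
  rw [h2]; simp; ring

lemma expConv_comm {z : ℝ → B} (hz : LocallyIntegrable z volume) [CompleteSpace B]
    (a b : ℝ) {t : ℝ} (ht : 0 ≤ t) :
    expConv a (expConv b z) t = expConv b (expConv a z) t := by
  rcases eq_or_ne a b with rfl | hab
  · rfl
  have h1 := expConv_resolvent hz a b ht
  have h2 := expConv_resolvent hz b a ht
  have h3 : (b - a) • expConv a (expConv b z) t = (b - a) • expConv b (expConv a z) t := by
    rw [h1, ← neg_sub a b, neg_smul, h2]; abel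
  exact smul_right_injective _ (sub_ne_zero.2 hab.symm) h3

/-- `∫₀ᵗ (z - c K_c z) = K_c z (t)`. -/
lemma integral_sub_smul_expConv {z : ℝ → B} (hz : LocallyIntegrable z volume) [CompleteSpace B]
    (c : ℝ) {t : ℝ} (ht : 0 ≤ t) :
    ∫ s in (0 : ℝ)..t, (z s - c • expConv c z s) = expConv c z t := by
  have h := expConv_resolvent hz 0 c ht
  rw [sub_zero, expConv_zero_left, expConv_zero_left] at h
  have h1 := intervalIntegral.integral_sub (hz.intervalIntegrable 0 t)
    (g := fun s => c • expConv c z s)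
    (((locallyIntegrable_expConv hz c).intervalIntegrable 0 t).smul c)
  rw [h1, intervalIntegral.integral_smul, h]
  abel

/-- Integration by parts: `K_c z = Z - c K_c Z` for the primitive `Z` of `z`. -/
lemma expConv_eq_primitive_sub {z : ℝ → B} (hz : LocallyIntegrable z volume) [CompleteSpace B]
    (c : ℝ) {t : ℝ} (ht : 0 ≤ t) :
    expConv c z t = (∫ s in (0 : ℝ)..t, z s) - c • expConv c (expConv 0 z) t := by
  have h := expConv_resolvent hz c 0 ht
  rw [expConv_zero_left] at h
  rw [zero_sub, neg_smul] at h
  rw [sub_eq_add_neg, h]; abel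

lemma hasDerivAt_expConv {z : ℝ → B} (c : ℝ) {t : ℝ}
    (h : HasDerivAt (fun τ => ∫ s in (0 : ℝ)..τ, Real.exp (c * s) • z s)
      (Real.exp (c * t) • z t) t) :
    HasDerivAt (expConv c z) (z t - c • expConv c z t) t := by
  have h1 : HasDerivAt (fun t => Real.exp (-(c * t))) (Real.exp (-(c * t)) * (-c)) t := by
    have : HasDerivAt (fun t : ℝ => -(c * t)) (-c) t := by
      simpa using ((hasDerivAt_id' t).const_mul c).fun_neg
    exact this.exp
  have h2 := h1.fun_smul h
  have h3 : expConv c z = fun t => Real.exp (-(c * t)) •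
      ∫ s in (0 : ℝ)..t, Real.exp (c * s) • z s := by
    ext t; exact expConv_eq_exp_smul c z t
  rw [h3]
  refine h2.congr_deriv ?_
  rw [smul_smul, smul_smul, ← Real.exp_add, neg_add_cancel, Real.exp_zero, one_smul, mul_neg,
    neg_smul, mul_comm (Real.exp _) c]
  abel

lemma hasDerivAt_expConv_of_continuous {z : ℝ → B} [CompleteSpace B] (hz : Continuous z)
    (c t : ℝ) : HasDerivAt (expConv c z) (z t - c • expConv c z t) t := by
  refine hasDerivAt_expConv c ?_
  have : Continuous fun s => Real.exp (c * s) • z s := by fun_prop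
  exact intervalIntegral.integral_hasDerivAt_right (this.intervalIntegrable _ _)
    this.stronglyMeasurable.stronglyMeasurableAtFilter this.continuousAt

lemma norm_smul_expConv_le {z : ℝ → B} (hz : LocallyIntegrable z volume) {C c t : ℝ} (hc : 0 ≤ c)
    (hC : 0 ≤ C) (ht : 0 ≤ t) (h : ∀ᵐ s, s ∈ Ioo 0 t → ‖z s‖ ≤ C) :
    c * ‖expConv c z t‖ ≤ C := by
  have h1 : ‖expConv c z t‖ ≤ expConv c (fun _ => C) t :=
    (norm_expConv_le_expConv_norm c z ht).trans
      (expConv_mono hz.norm_fun (locallyIntegrable_const C) ht h c)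
  calc c * ‖expConv c z t‖ ≤ c * expConv c (fun _ => C) t := by gcongr
    _ = (1 - Real.exp (-(c * t))) * C := expConv_const_mul c t C
    _ ≤ 1 * C := by
        gcongr; linarith [Real.exp_nonneg (-(c * t))]
    _ = C := one_mul C

lemma norm_expConv_le {z : ℝ → B} (hz : LocallyIntegrable z volume) {C c t : ℝ} (hc : 0 ≤ c)
    (hC : 0 ≤ C) (ht : 0 ≤ t) (h : ∀ᵐ s, s ∈ Ioo 0 t → ‖z s‖ ≤ C) :
    ‖expConv c z t‖ ≤ C * t := by
  have h1 : ‖expConv c z t‖ ≤ expConv c (fun _ => C) t :=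
    (norm_expConv_le_expConv_norm c z ht).trans
      (expConv_mono hz.norm_fun (locallyIntegrable_const C) ht h c)
  refine h1.trans ?_
  rw [expConv]
  calc ∫ s in (0 : ℝ)..t, Real.exp (-(c * (t - s))) • C
      ≤ ∫ s in (0 : ℝ)..t, C := by
        refine intervalIntegral.integral_mono_on ht
          ((by fun_prop : Continuous fun s => Real.exp (-(c * (t - s))) • C).intervalIntegrable _ _)
          (by simp) fun s hs => ?_
        have : Real.exp (-(c * (t - s))) ≤ 1 :=
          Real.exp_le_one_iff.2 (by nlinarith [hs.2])
        simpa using mul_le_mul_of_nonneg_right this hC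
    _ = C * t := by simp [mul_comm]

/-- A bounded function is mapped by `K_c` into a ball of radius `O(1/(1+c))`. -/
lemma norm_expConv_le_div {z : ℝ → B} (hz : LocallyIntegrable z volume) {C c t T : ℝ} (hc : 0 ≤ c)
    (hC : 0 ≤ C) (ht : t ∈ Icc 0 T) (h : ∀ᵐ s, s ∈ Ioo 0 t → ‖z s‖ ≤ C) :
    ‖expConv c z t‖ ≤ C * (1 + T) / (1 + c) := by
  rw [le_div_iff₀ (by linarith)]
  have h1 := norm_smul_expConv_le hz hc hC ht.1 h
  have h2 := norm_expConv_le hz hc hC ht.1 h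
  have : C * t ≤ C * T := by gcongr; exact ht.2
  nlinarith

end ExpConv

/-! ### `c K_c` as an approximate identity -/

section ApproxIdentity

variable {B : Type*} [NormedAddCommGroup B] [NormedSpace ℝ B]

lemma smul_expConv_const [CompleteSpace B] (c t : ℝ) (v : B) :
    c • expConv c (fun _ => v) t = (1 - Real.exp (-(c * t))) • v := by
  have h := expConv_const_mul c t 1
  simp only [expConv, smul_eq_mul, mul_one] at h ⊢
  rw [intervalIntegral.integral_smul_const, smul_smul, h]

lemma mul_expConv_sub_self_le {c t : ℝ} (hc : 0 < c) (ht : 0 ≤ t) :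
    c * expConv c (fun s => t - s) t ≤ 4 / c := by
  have h1 : expConv c (fun s => t - s) t ≤ (2 / c) * expConv (c / 2) (fun _ => 1) t := by
    rw [expConv, expConv, ← intervalIntegral.integral_const_mul]
    refine intervalIntegral.integral_mono_on ht
      ((by fun_prop : Continuous fun s => Real.exp (-(c * (t - s))) • (t - s)).intervalIntegrable
        _ _)
      ((by fun_prop : Continuous fun s => 2 / c *
        (Real.exp (-(c / 2 * (t - s))) • (1 : ℝ))).intervalIntegrable _ _) fun s hs => ?_
    simp only [smul_eq_mul, mul_one]
    have h2 : c / 2 * (t - s) ≤ Real.exp (c / 2 * (t - s)) := by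
      linarith [Real.add_one_le_exp (c / 2 * (t - s))]
    have h3 : Real.exp (-(c * (t - s))) = Real.exp (-(c / 2 * (t - s))) *
        Real.exp (-(c / 2 * (t - s))) := by
      rw [← Real.exp_add]; congr 1; ring
    rw [h3, mul_assoc, mul_comm (2 / c)]
    refine mul_le_mul_of_nonneg_left ?_ (Real.exp_nonneg _)
    rw [Real.exp_neg, ← div_eq_inv_mul, div_le_div_iff₀ (Real.exp_pos _) hc]
    linarith
  have h4 := expConv_const_mul (c / 2) t 1
  have h5 : (c / 2) * expConv (c / 2) (fun _ => (1 : ℝ)) t ≤ 1 := by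
    rw [h4]; linarith [Real.exp_nonneg (-(c / 2 * t))]
  calc c * expConv c (fun s => t - s) t ≤ c * ((2 / c) * expConv (c / 2) (fun _ => 1) t) := by
        gcongr
    _ = (4 / c) * ((c / 2) * expConv (c / 2) (fun _ => (1 : ℝ)) t) := by field_simp; ring
    _ ≤ (4 / c) * 1 := by gcongr
    _ = 4 / c := mul_one _

/-- Pointwise convergence of `c K_c g`; the term `exp(-c t) g(t)` accounts for the missing past, and
is not small near `t = 0` unless `g 0 = 0`. -/
lemma tendsto_smul_expConv_sub [CompleteSpace B] {g : ℝ → B} (hg : Continuous g) {t : ℝ}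
    (ht : 0 ≤ t) :
    Tendsto (fun c => c • expConv c g t - (1 - Real.exp (-(c * t))) • g t) atTop (𝓝 0) := by
  obtain ⟨M, hM⟩ := (isCompact_Icc (a := 0) (b := t)).exists_bound_of_continuousOn
    (f := fun s => g s - g t) (by fun_prop)
  have hM0 : 0 ≤ M := (norm_nonneg _).trans (hM 0 ⟨le_rfl, ht⟩)
  rw [Metric.tendsto_atTop]
  intro ε hε
  obtain ⟨δ, hδ, hδg⟩ := Metric.continuous_iff.1 hg t (ε / 2) (by positivity)
  refine ⟨max 1 (8 * (M / δ) / ε + 1), fun c hc => ?_⟩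
  have hc1 : 0 < c := lt_of_lt_of_le one_pos ((le_max_left _ _).trans hc)
  have hc2 : 8 * (M / δ) / ε < c := lt_of_lt_of_le (by linarith) ((le_max_right _ _).trans hc)
  rw [dist_zero_right, ← smul_expConv_const, ← smul_sub,
    ← expConv_sub hg.locallyIntegrable continuous_const.locallyIntegrable, norm_smul,
    Real.norm_of_nonneg hc1.le]
  -- small near `t` by continuity, and bounded by a linear function elsewhere
  have hb : ∀ s ∈ Ioo 0 t, ‖g s - g t‖ ≤ ε / 2 + (M / δ) * (t - s) := by
    intro s hs
    have hMδ : 0 ≤ M / δ := by positivity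
    by_cases h : t - s < δ
    · have := hδg s (by rw [dist_comm, Real.dist_eq, abs_of_pos (by linarith [hs.2])]; exact h)
      rw [dist_eq_norm] at this
      have h3 : 0 ≤ (M / δ) * (t - s) := mul_nonneg hMδ (by linarith [hs.2])
      linarith
    · have h3 : M ≤ (M / δ) * (t - s) := by
        rw [div_mul_eq_mul_div, le_div_iff₀ hδ]
        exact mul_le_mul_of_nonneg_left (not_lt.1 h) hM0
      have := hM s ⟨hs.1.le, hs.2.le⟩
      linarith
  have h1 : ‖expConv c (fun s => g s - g t) t‖ ≤
      expConv c (fun s => ε / 2 + (M / δ) • (t - s)) t :=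
    (norm_expConv_le_expConv_norm _ _ ht).trans
      (expConv_mono (by fun_prop : Continuous fun s => ‖g s - g t‖).locallyIntegrable
        (by fun_prop : Continuous fun s => ε / 2 + (M / δ) • (t - s)).locallyIntegrable ht
        (Eventually.of_forall hb) c)
  rw [expConv_add continuous_const.locallyIntegrable
    (by fun_prop : Continuous fun s => (M / δ) • (t - s)).locallyIntegrable, expConv_smul] at h1
  have h2 := expConv_const_mul c t (ε / 2)
  have h3 := mul_expConv_sub_self_le hc1 ht
  have h4 : c * ‖expConv c (fun s => g s - g t) t‖ ≤ ε / 2 + (M / δ) * (4 / c) := by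
    calc c * ‖expConv c (fun s => g s - g t) t‖ ≤ c * (expConv c (fun _ => ε / 2) t +
          (M / δ) • expConv c (fun s => t - s) t) := by gcongr
      _ = (1 - Real.exp (-(c * t))) * (ε / 2) + (M / δ) * (c * expConv c (fun s => t - s) t) := by
          rw [mul_add, h2, smul_eq_mul]; ring
      _ ≤ 1 * (ε / 2) + (M / δ) * (4 / c) := by
          gcongr; linarith [Real.exp_nonneg (-(c * t))]
      _ = _ := by ring
  have h5 : (M / δ) * (4 / c) < ε / 2 := by
    rw [mul_div_assoc', div_lt_iff₀ hc1]
    rw [div_lt_iff₀ hε] at hc2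
    linarith
  linarith

lemma tendsto_smul_expConv_of_pos [CompleteSpace B] {g : ℝ → B} (hg : Continuous g) {t : ℝ}
    (ht : 0 < t) : Tendsto (fun c => c • expConv c g t) atTop (𝓝 (g t)) := by
  have h1 := tendsto_smul_expConv_sub hg ht.le
  have h2 : Tendsto (fun c : ℝ => (1 - Real.exp (-(c * t))) • g t) atTop (𝓝 ((1 - 0 : ℝ) • g t)) :=
    ((Real.tendsto_exp_neg_atTop_nhds_zero.comp
      (tendsto_id.atTop_mul_const ht)).const_sub 1).smul_const _
  simpa using h1.add h2

lemma tendsto_smul_expConv_of_zero [CompleteSpace B] {g : ℝ → B} (hg : Continuous g)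
    (h0 : g 0 = 0) {t : ℝ} (ht : 0 ≤ t) :
    Tendsto (fun c => c • expConv c g t) atTop (𝓝 (g t)) := by
  rcases ht.eq_or_lt with rfl | ht
  · simp [expConv_zero_right, h0]
  · exact tendsto_smul_expConv_of_pos hg ht

/-- Jensen's inequality for the sub-probability kernel `c exp(-c r)`. -/
lemma rpow_mul_expConv_le {h : ℝ → ℝ} {r c t : ℝ} (hr : 1 ≤ r) (hc : 0 ≤ c) (ht : 0 ≤ t)
    (h0 : ∀ s, 0 ≤ h s) (hh : LocallyIntegrable h volume)
    (hhr : LocallyIntegrable (fun s => h s ^ r) volume) :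
    (c * expConv c h t) ^ r ≤ c * expConv c (fun s => h s ^ r) t := by
  set a := c * expConv c h t with ha
  have hpos : ∀ {k : ℝ → ℝ}, (∀ s, 0 ≤ k s) → 0 ≤ expConv c k t := fun hk =>
    intervalIntegral.integral_nonneg ht fun s _ => mul_nonneg (Real.exp_nonneg _) (hk s)
  have ha0 : 0 ≤ a := mul_nonneg hc (hpos h0)
  rcases ha0.eq_or_lt with ha1 | ha1
  · rw [← ha1, Real.zero_rpow (by linarith)]
    exact mul_nonneg hc (hpos fun s => Real.rpow_nonneg (h0 s) _)
  -- the tangent line of `x ↦ x ^ r` at `a`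
  have tang : ∀ s, a ^ r * (1 - r) + (a ^ r * r / a) • h s ≤ h s ^ r := by
    intro s
    have h1 := one_add_mul_self_le_rpow_one_add (s := h s / a - 1)
      (by linarith [div_nonneg (h0 s) ha0]) hr
    rw [add_sub_cancel, Real.div_rpow (h0 s) ha0, le_div_iff₀ (by positivity)] at h1
    calc a ^ r * (1 - r) + (a ^ r * r / a) • h s = (1 + r * (h s / a - 1)) * a ^ r := by
          rw [smul_eq_mul]; field_simp; ring
      _ ≤ _ := h1
  have h2 := expConv_mono (c := c)
    (continuous_const.locallyIntegrable.add (hh.smul (a ^ r * r / a)))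
    hhr ht (Eventually.of_forall fun s _ => tang s)
  have h3 : expConv c ((fun _ => a ^ r * (1 - r)) + (a ^ r * r / a) • h) t =
    expConv c (fun _ => a ^ r * (1 - r)) t + (a ^ r * r / a) • expConv c h t := by
    rw [← expConv_smul]
    exact expConv_add continuous_const.locallyIntegrable (hh.smul (a ^ r * r / a)) c t
  rw [h3] at h2
  have h4 := mul_le_mul_of_nonneg_left h2 hc
  rw [mul_add, expConv_const_mul, smul_eq_mul, mul_left_comm c _ (expConv c h t), ← ha] at h4
  refine le_trans ?_ h4
  have h5 : a ^ r * r / a * a = a ^ r * r := by field_simp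
  rw [h5]
  have h6 : 0 ≤ a ^ r := by positivity
  have h7 := Real.exp_nonneg (-(c * t))
  nlinarith [mul_nonneg (mul_nonneg h6 h7) (sub_nonneg.2 hr)]

lemma integral_smul_expConv_le {h : ℝ → ℝ} {c T : ℝ} (hT : 0 ≤ T)
    (h0 : ∀ s, 0 ≤ h s) (hh : LocallyIntegrable h volume) :
    ∫ t in (0 : ℝ)..T, c * expConv c h t ≤ ∫ t in (0 : ℝ)..T, h t := by
  have h1 := integral_sub_smul_expConv hh c hT
  rw [intervalIntegral.integral_sub (hh.intervalIntegrable 0 T)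
    (g := fun s => c • expConv c h s)
    (((locallyIntegrable_expConv hh c).intervalIntegrable 0 T).smul c)] at h1
  have h2 : 0 ≤ expConv c h T :=
    intervalIntegral.integral_nonneg hT fun s _ => mul_nonneg (Real.exp_nonneg _) (h0 s)
  simp only [smul_eq_mul] at h1
  linarith

lemma eLpNorm_smul_expConv_le_of_memLp {z : ℝ → B} {q : ℝ≥0∞} (hq : 1 ≤ q) (hq' : q ≠ ⊤)
    {c T : ℝ} (hc : 0 ≤ c) (hT : 0 ≤ T) (hz : MemLp z q volume) :
    eLpNorm (fun t => c • expConv c z t) q (timeMeasure T) ≤ eLpNorm z q (timeMeasure T) := by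
  have hz1 : LocallyIntegrable z volume := hz.locallyIntegrable hq
  have hq0 : q ≠ 0 := (one_pos.trans_le hq).ne'
  have hr : 1 ≤ q.toReal := by
    rw [← ENNReal.toReal_one]; exact ENNReal.toReal_mono hq' hq
  set r := q.toReal
  have hr0 : 0 < r := one_pos.trans_le hr
  have hzr : LocallyIntegrable (fun s => ‖z s‖ ^ r) volume :=
    (hz.integrable_norm_rpow hq0 hq').locallyIntegrable
  rw [eLpNorm_eq_lintegral_rpow_enorm_toReal hq0 hq',
    eLpNorm_eq_lintegral_rpow_enorm_toReal hq0 hq']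
  refine ENNReal.rpow_le_rpow ?_ (by positivity)
  have e1 : ∀ x : B, ‖x‖ₑ ^ r = ENNReal.ofReal (‖x‖ ^ r) := fun x => by
    rw [← ofReal_norm, ENNReal.ofReal_rpow_of_nonneg (norm_nonneg _) hr0.le]
  change ∫⁻ t, ‖c • expConv c z t‖ₑ ^ r ∂_ ≤ ∫⁻ t, ‖z t‖ₑ ^ r ∂_
  simp only [e1]
  have hle : ∀ t ∈ Ioo 0 T, ‖c • expConv c z t‖ ^ r ≤ c * expConv c (fun s => ‖z s‖ ^ r) t := by
    intro t ht
    refine le_trans ?_ (rpow_mul_expConv_le hr hc ht.1.le (fun s => norm_nonneg _) hz1.norm_fun hzr)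
    rw [norm_smul, Real.norm_of_nonneg hc]
    exact Real.rpow_le_rpow (by positivity) (mul_le_mul_of_nonneg_left
      (norm_expConv_le_expConv_norm c z ht.1.le) hc) hr0.le
  have hnn : ∀ t ∈ Ioo 0 T, 0 ≤ c * expConv c (fun s => ‖z s‖ ^ r) t := fun t ht =>
    (Real.rpow_nonneg (norm_nonneg _) _).trans (hle t ht)
  have hint : IntegrableOn (fun t => c * expConv c (fun s => ‖z s‖ ^ r) t) (Ioo 0 T) volume :=
    (((continuous_expConv hzr c).const_mul c).locallyIntegrable.integrableOn_isCompact
      isCompact_Icc).mono_set Ioo_subset_Icc_self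
  have hint2 : IntegrableOn (fun t => ‖z t‖ ^ r) (Ioo 0 T) volume :=
    (hz.integrable_norm_rpow hq0 hq').integrableOn
  calc ∫⁻ t, ENNReal.ofReal (‖c • expConv c z t‖ ^ r) ∂(timeMeasure T)
      ≤ ∫⁻ t, ENNReal.ofReal (c * expConv c (fun s => ‖z s‖ ^ r) t) ∂(timeMeasure T) :=
        setLIntegral_mono_ae' measurableSet_Ioo (Eventually.of_forall fun t ht =>
          ENNReal.ofReal_le_ofReal (hle t ht))
    _ = ENNReal.ofReal (∫ t in Ioo 0 T, c * expConv c (fun s => ‖z s‖ ^ r) t) :=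
        (ofReal_integral_eq_lintegral_ofReal hint
          ((ae_restrict_iff' measurableSet_Ioo).2 (Eventually.of_forall hnn))).symm
    _ ≤ ENNReal.ofReal (∫ t in Ioo 0 T, ‖z t‖ ^ r) := by
        refine ENNReal.ofReal_le_ofReal ?_
        rw [← integral_Ioc_eq_integral_Ioo, ← integral_Ioc_eq_integral_Ioo,
          ← intervalIntegral.integral_of_le hT, ← intervalIntegral.integral_of_le hT]
        exact integral_smul_expConv_le hT (fun s => by positivity) hzr
    _ = ∫⁻ t, ENNReal.ofReal (‖z t‖ ^ r) ∂(timeMeasure T) :=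
        ofReal_integral_eq_lintegral_ofReal hint2 (Eventually.of_forall fun t => by positivity)

lemma expConv_indicator (z : ℝ → B) (c : ℝ) {t T : ℝ} (ht : t ∈ Icc 0 T) :
    expConv c ((Ioo 0 T).indicator z) t = expConv c z t :=
  expConv_congr ht.1 (Eventually.of_forall fun s hs =>
    indicator_of_mem (show s ∈ Ioo 0 T from ⟨hs.1, hs.2.trans_le ht.2⟩) z) c

lemma memLp_indicator_timeMeasure {B : Type*} [NormedAddCommGroup B] {z : ℝ → B} {q : ℝ≥0∞}
    {T : ℝ} (hz : MemLp z q (timeMeasure T)) :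
    MemLp ((Ioo 0 T).indicator z) q volume :=
  (memLp_indicator_iff_restrict measurableSet_Ioo).2 hz

instance isFiniteMeasure_timeMeasure (T : ℝ) : IsFiniteMeasure (timeMeasure T) := by
  unfold timeMeasure; infer_instance

lemma eLpNorm_smul_expConv_le {z : ℝ → B} {q : ℝ≥0∞} (hq : 1 ≤ q) (hq' : q ≠ ⊤)
    {c T : ℝ} (hc : 0 ≤ c) (hT : 0 ≤ T) (hz : MemLp z q (timeMeasure T)) :
    eLpNorm (fun t => c • expConv c z t) q (timeMeasure T) ≤ eLpNorm z q (timeMeasure T) := by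
  have h1 := eLpNorm_smul_expConv_le_of_memLp hq hq' hc hT (memLp_indicator_timeMeasure hz)
  have e1 : (Ioo 0 T).indicator z =ᵐ[timeMeasure T] z := ((ae_restrict_iff' measurableSet_Ioo).2
    (Eventually.of_forall
    fun t ht => indicator_of_mem ht z))
  have e2 : (fun t => c • expConv c ((Ioo 0 T).indicator z) t) =ᵐ[timeMeasure T]
      fun t => c • expConv c z t :=
    (ae_restrict_iff' measurableSet_Ioo).2 (Eventually.of_forall fun t ht => by
      simp only [expConv_indicator z c (Ioo_subset_Icc_self ht)])
  rwa [eLpNorm_congr_ae e1, eLpNorm_congr_ae e2] at h1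

lemma tendsto_eLpNorm_smul_expConv_sub_of_continuous [CompleteSpace B] {g : ℝ → B} {q : ℝ≥0∞}
    (hq : 1 ≤ q) (hq' : q ≠ ⊤) (T : ℝ) (hg : Continuous g) :
    Tendsto (fun c => eLpNorm (fun t => c • expConv c g t - g t) q (timeMeasure T))
      atTop (𝓝 0) := by
  have hq0 : q ≠ 0 := (one_pos.trans_le hq).ne'
  have hr0 : 0 < q.toReal := ENNReal.toReal_pos hq0 hq'
  simp only [eLpNorm_eq_lintegral_rpow_enorm_toReal hq0 hq']
  have h0 : (0 : ℝ≥0∞) = 0 ^ (1 / q.toReal) := (ENNReal.zero_rpow_of_pos (by positivity)).symm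
  rw [h0]
  refine (ENNReal.continuous_rpow_const.tendsto _).comp ?_
  obtain ⟨M, hM⟩ := (isCompact_Icc (a := 0) (b := T)).exists_bound_of_continuousOn hg.continuousOn
  have h1 : (0 : ℝ≥0∞) = ∫⁻ _, 0 ∂(timeMeasure T) := by simp
  rw [h1]
  refine tendsto_lintegral_filter_of_dominated_convergence
    (fun _ => ENNReal.ofReal (2 * M) ^ q.toReal) ?_ ?_ ?_ ?_
  · refine Eventually.of_forall fun c => ?_
    have : Continuous fun t => c • expConv c g t - g t :=
      ((continuous_expConv hg.locallyIntegrable c).const_smul c).sub hg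
    exact ((this.enorm).measurable.pow_const _)
  · filter_upwards [eventually_ge_atTop 0] with c hc
    refine (ae_restrict_iff' measurableSet_Ioo).2 (Eventually.of_forall fun t ht => ?_)
    refine ENNReal.rpow_le_rpow ?_ hr0.le
    rw [← ofReal_norm]
    refine ENNReal.ofReal_le_ofReal ?_
    have hM0 : 0 ≤ M := (norm_nonneg _).trans (hM t ⟨ht.1.le, ht.2.le⟩)
    have h2 := norm_smul_expConv_le hg.locallyIntegrable hc hM0 ht.1.le
      (Eventually.of_forall fun s hs => hM s ⟨hs.1.le, hs.2.le.trans ht.2.le⟩)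
    calc ‖c • expConv c g t - g t‖ ≤ ‖c • expConv c g t‖ + ‖g t‖ := norm_sub_le _ _
      _ ≤ M + M := by
        rw [norm_smul, Real.norm_of_nonneg hc]
        exact add_le_add h2 (hM t ⟨ht.1.le, ht.2.le⟩)
      _ = 2 * M := by ring
  · simp only [lintegral_const]
    exact ENNReal.mul_ne_top (ENNReal.rpow_ne_top_of_nonneg hr0.le ENNReal.ofReal_ne_top)
      (measure_ne_top _ _)
  · refine (ae_restrict_iff' measurableSet_Ioo).2 (Eventually.of_forall fun t ht => ?_)
    have h2 : Tendsto (fun c => c • expConv c g t - g t) atTop (𝓝 0) := by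
      simpa using (tendsto_smul_expConv_of_pos hg ht.1).sub_const (g t)
    have h3 := (ENNReal.continuous_rpow_const (y := q.toReal)).tendsto 0 |>.comp
      (continuous_enorm.tendsto' _ _ (enorm_zero (E := B)) |>.comp h2)
    rwa [ENNReal.zero_rpow_of_pos hr0] at h3

/-- `c K_c z → z` in `L^q(0,T;B)` as `c → ∞`: this holds for continuous functions, and the
operators `c K_c` are contractions. -/
lemma tendsto_eLpNorm_smul_expConv_sub [CompleteSpace B] {z : ℝ → B} {q : ℝ≥0∞}
    (hq : 1 ≤ q) (hq' : q ≠ ⊤) {T : ℝ} (hT : 0 ≤ T) (hz : MemLp z q (timeMeasure T))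
    (hz1 : LocallyIntegrable z volume) :
    Tendsto (fun c => eLpNorm (fun t => c • expConv c z t - z t) q (timeMeasure T))
      atTop (𝓝 0) := by
  rw [ENNReal.tendsto_nhds_zero]
  intro ε hε
  rcases eq_or_ne ε ⊤ with rfl | hε'
  · simp
  have hε3 : ε / 3 ≠ 0 := by simp [hε.ne']
  have : (timeMeasure T).Regular := by unfold timeMeasure; infer_instance
  obtain ⟨g, -, hgz, hg, hgq⟩ := hz.exists_hasCompactSupport_eLpNorm_sub_le hq' hε3
  filter_upwards [(ENNReal.tendsto_nhds_zero.1
    (tendsto_eLpNorm_smul_expConv_sub_of_continuous hq hq' T hg)) (ε / 3)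
    (pos_iff_ne_zero.2 hε3), eventually_ge_atTop 0] with c hc hc0
  have hdec : (fun t => c • expConv c z t - z t) = (fun t => c • expConv c (z - g) t) +
      (fun t => c • expConv c g t - g t) + (g - z) := by
    ext t
    have := expConv_sub hz1 hg.locallyIntegrable c t
    simp only [Pi.add_apply, Pi.sub_apply]
    change _ = c • expConv c (fun s => z s - g s) t + _ + _
    rw [this, smul_sub]; abel
  have m2 : AEStronglyMeasurable (fun t => c • expConv c g t - g t) (timeMeasure T) :=
    (((continuous_expConv hg.locallyIntegrable c).const_smul c).sub hg).aestronglyMeasurable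
  have m1 : AEStronglyMeasurable (fun t => c • expConv c (z - g) t) (timeMeasure T) :=
    ((continuous_expConv (hz1.sub hg.locallyIntegrable) c).const_smul c).aestronglyMeasurable
  rw [hdec]
  calc _ ≤ eLpNorm (fun t => c • expConv c (z - g) t) q (timeMeasure T) +
        eLpNorm (fun t => c • expConv c g t - g t) q (timeMeasure T) +
        eLpNorm (g - z) q (timeMeasure T) :=
        (eLpNorm_add_le (m1.add m2) (hgq.1.sub hz.1) hq).trans (by
          gcongr; exact eLpNorm_add_le m1 m2 hq)
    _ ≤ ε / 3 + ε / 3 + ε / 3 := by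
        gcongr
        · exact (eLpNorm_smul_expConv_le hq hq' hc0 hT (hz.sub hgq)).trans hgz
        · rw [eLpNorm_sub_comm]; exact hgz
    _ = ε := ENNReal.add_thirds ε

end ApproxIdentity

/-! ### Integration over a time interval -/

lemma intervalIntegral_eq_timeMeasure {B : Type*} [NormedAddCommGroup B] [NormedSpace ℝ B]
    {T : ℝ} (hT : 0 ≤ T) (f : ℝ → B) : ∫ t in (0 : ℝ)..T, f t = ∫ t, f t ∂(timeMeasure T) := by
  rw [intervalIntegral.integral_of_le hT, integral_Ioc_eq_integral_Ioo, timeMeasure]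

lemma expConv_eq_timeMeasure {B : Type*} [NormedAddCommGroup B] [NormedSpace ℝ B]
    {t : ℝ} (ht : 0 ≤ t) (c : ℝ) (z : ℝ → B) :
    expConv c z t = ∫ s, Real.exp (-(c * (t - s))) • z s ∂(timeMeasure t) :=
  intervalIntegral_eq_timeMeasure ht _

lemma ae_timeMeasure_iff {T : ℝ} {P : ℝ → Prop} :
    (∀ᵐ t ∂(timeMeasure T), P t) ↔ ∀ᵐ t, t ∈ Ioo 0 T → P t :=
  ae_restrict_iff' measurableSet_Ioo

lemma MeasureTheory.LocallyIntegrable.integrable_timeMeasure {B : Type*} [NormedAddCommGroup B]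
    {z : ℝ → B} (hz : LocallyIntegrable z volume) (T : ℝ) : Integrable z (timeMeasure T) :=
  (hz.integrableOn_isCompact isCompact_Icc).mono_set Ioo_subset_Icc_self

lemma Continuous.memLp_timeMeasure {B : Type*} [NormedAddCommGroup B]
    {z : ℝ → B} (hz : Continuous z) (q : ℝ≥0∞) (T : ℝ) : MemLp z q (timeMeasure T) := by
  obtain ⟨M, hM⟩ := (isCompact_Icc (a := 0) (b := T)).exists_bound_of_continuousOn hz.continuousOn
  exact MemLp.of_bound hz.aestronglyMeasurable M (ae_timeMeasure_iff.2
    (Eventually.of_forall fun t ht => hM t (Ioo_subset_Icc_self ht)))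

lemma integrable_pairing {X : Type*} [NormedAddCommGroup X] [NormedSpace ℝ X] {p : ℝ} (hp : 1 < p)
    {α : Type*} [MeasurableSpace α] {m : Measure α} {f : α → X →L[ℝ] ℝ} {y : α → X}
    (hf : MemLp f (ENNReal.ofReal p.conjExponent) m) (hy : MemLp y (ENNReal.ofReal p) m) :
    Integrable (fun t => f t (y t)) m := by
  have hpq : p.HolderConjugate p.conjExponent := Real.HolderConjugate.conjExponent hp
  have hpq' : ENNReal.HolderConjugate (ENNReal.ofReal p.conjExponent) (ENNReal.ofReal p) :=
    hpq.symm.ennrealOfReal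
  refine memLp_one_iff_integrable.1 ⟨(ContinuousLinearMap.id ℝ
    (X →L[ℝ] ℝ)).aestronglyMeasurable_comp₂ hf.1 hy.1, ?_⟩
  have := eLpNorm_le_eLpNorm_mul_eLpNorm_of_nnnorm (p := ENNReal.ofReal p.conjExponent)
    (q := ENNReal.ofReal p) (r := 1) hf.1 hy.1 (fun L x => L x) 1
    (Eventually.of_forall fun t => by simpa using (f t).le_opNNNorm (y t))
  refine this.trans_lt ?_
  simpa using ENNReal.mul_lt_top hf.2 hy.2

/-- Duality pairings of functions in `L^{p'}(0,T;X')` and `L^p(0,T;X)` are limits of the pairings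
of their regularizations. -/
lemma tendsto_integral_pairing_smul_expConv {X : Type*} [NormedAddCommGroup X] [NormedSpace ℝ X]
    [CompleteSpace X] {p T : ℝ} (hp : 1 < p) (hT : 0 ≤ T) {f : ℝ → X →L[ℝ] ℝ} {y : ℝ → X}
    (hf : MemLp f (ENNReal.ofReal p.conjExponent) (timeMeasure T))
    (hy : MemLp y (ENNReal.ofReal p) (timeMeasure T))
    (hf1 : LocallyIntegrable f volume) (hy1 : LocallyIntegrable y volume) :
    Tendsto (fun c : ℝ => ∫ t, (c • expConv c f t) (c • expConv c y t) ∂(timeMeasure T)) atTop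
      (𝓝 (∫ t, f t (y t) ∂(timeMeasure T))) := by
  have hpq : p.HolderConjugate p.conjExponent := Real.HolderConjugate.conjExponent hp
  have hpq' : ENNReal.HolderConjugate (ENNReal.ofReal p.conjExponent) (ENNReal.ofReal p) :=
    hpq.symm.ennrealOfReal
  have hp1 : (1 : ℝ≥0∞) ≤ ENNReal.ofReal p := by
    rw [← ENNReal.ofReal_one]; exact ENNReal.ofReal_le_ofReal hp.le
  have hq1 : (1 : ℝ≥0∞) ≤ ENNReal.ofReal p.conjExponent := by
    rw [← ENNReal.ofReal_one]; exact ENNReal.ofReal_le_ofReal hpq.symm.lt.le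
  have mf : ∀ c : ℝ, AEStronglyMeasurable (fun t => c • expConv c f t) (timeMeasure T) := fun c =>
    ((continuous_expConv hf1 c).const_smul c).aestronglyMeasurable
  have my : ∀ c : ℝ, AEStronglyMeasurable (fun t => c • expConv c y t) (timeMeasure T) := fun c =>
    ((continuous_expConv hy1 c).const_smul c).aestronglyMeasurable
  have mp : ∀ {a : ℝ → X →L[ℝ] ℝ} {b : ℝ → X}, AEStronglyMeasurable a (timeMeasure T) →
      AEStronglyMeasurable b (timeMeasure T) →
      AEStronglyMeasurable (fun t => a t (b t)) (timeMeasure T) := fun ha hb =>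
    (ContinuousLinearMap.id ℝ (X →L[ℝ] ℝ)).aestronglyMeasurable_comp₂ ha hb
  have holder : ∀ {a : ℝ → X →L[ℝ] ℝ} {b : ℝ → X}, AEStronglyMeasurable a (timeMeasure T) →
      AEStronglyMeasurable b (timeMeasure T) →
      eLpNorm (fun t => a t (b t)) 1 (timeMeasure T) ≤
        eLpNorm a (ENNReal.ofReal p.conjExponent) (timeMeasure T) *
        eLpNorm b (ENNReal.ofReal p) (timeMeasure T) := by
    intro a b ha hb
    have := eLpNorm_le_eLpNorm_mul_eLpNorm_of_nnnorm (p := ENNReal.ofReal p.conjExponent)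
      (q := ENNReal.ofReal p) (r := 1) ha hb (fun L x => L x) 1
      (Eventually.of_forall fun t => by simpa using (a t).le_opNNNorm (b t))
    simpa using this
  refine tendsto_integral_of_L1' _ ?_ ?_ ?_
  · exact mp hf.1 hy.1
  · exact Eventually.of_forall fun c => integrable_pairing hp
      (((continuous_expConv hf1 c).const_smul c).memLp_timeMeasure _ T)
      (((continuous_expConv hy1 c).const_smul c).memLp_timeMeasure _ T)
  · have t1 := tendsto_eLpNorm_smul_expConv_sub hq1 ENNReal.ofReal_ne_top hT hf hf1
    have t2 := tendsto_eLpNorm_smul_expConv_sub hp1 ENNReal.ofReal_ne_top hT hy hy1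
    have t3 := (ENNReal.Tendsto.mul_const (b := eLpNorm y (ENNReal.ofReal p) (timeMeasure T)) t1
      (Or.inr hy.2.ne)).add (ENNReal.Tendsto.const_mul
      (a := eLpNorm f (ENNReal.ofReal p.conjExponent) (timeMeasure T)) t2 (Or.inr hf.2.ne))
    rw [zero_mul, mul_zero, add_zero] at t3
    refine tendsto_of_tendsto_of_tendsto_of_le_of_le' tendsto_const_nhds t3
      (Eventually.of_forall fun _ => zero_le) ?_
    filter_upwards [eventually_ge_atTop 0] with c hc
    have hdec : (fun t => (c • expConv c f t) (c • expConv c y t)) - (fun t => f t (y t)) =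
        (fun t => (c • expConv c f t - f t) (c • expConv c y t)) +
        fun t => f t (c • expConv c y t - y t) := by
      ext t; simp only [Pi.sub_apply, Pi.add_apply, map_sub, sub_apply]; ring
    rw [hdec]
    refine (eLpNorm_add_le (mp ((mf c).sub hf.1) (my c)) (mp hf.1 ((my c).sub hy.1))
      le_rfl).trans ?_
    gcongr
    · refine (holder ((mf c).sub hf.1) (my c)).trans
        (mul_le_mul' le_rfl (eLpNorm_smul_expConv_le hp1 ENNReal.ofReal_ne_top hc hT hy))
    · exact holder hf.1 ((my c).sub hy.1)

/-! ### The energy inequality for superpositions of exponential kernels -/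

section Superposition

variable {Θ : Type*} [MeasurableSpace Θ] {ν : Measure Θ} {c : Θ → ℝ}
  {H : Type*} [NormedAddCommGroup H] [InnerProductSpace ℝ H]

lemma continuous_uncurry_expConv {B : Type*} [NormedAddCommGroup B] [NormedSpace ℝ B]
    {z : ℝ → B} (hz : Continuous z) : Continuous fun p : ℝ × ℝ => expConv p.1 z p.2 := by
  have : (fun p : ℝ × ℝ => expConv p.1 z p.2) = fun p => Real.exp (-(p.1 * p.2)) •
      ∫ s in (0 : ℝ)..p.2, Real.exp (p.1 * s) • z s := by
    ext p; exact expConv_eq_exp_smul _ _ _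
  rw [this]
  refine Continuous.smul (by fun_prop) ?_
  exact intervalIntegral.continuous_parametric_intervalIntegral_of_continuous
    (f := fun (p : ℝ × ℝ) s => Real.exp (p.1 * s) • z s) (by fun_prop) continuous_snd

lemma stronglyMeasurable_expConv {B : Type*} [NormedAddCommGroup B] [NormedSpace ℝ B]
    {z : ℝ → B} (hz : Continuous z) (hc : Measurable c) :
    StronglyMeasurable fun p : ℝ × Θ => expConv (c p.2) z p.1 :=
  (continuous_uncurry_expConv hz).stronglyMeasurable.comp_measurable
    ((hc.comp measurable_snd).prodMk measurable_fst)

lemma integrable_prod_of_norm_le {E : Type*} [NormedAddCommGroup E] [SFinite ν]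
    {g : ℝ × Θ → E} {b : Θ → ℝ} {T : ℝ} (hI : Integrable b ν)
    (hg : AEStronglyMeasurable g ((timeMeasure T).prod ν))
    (hb : ∀ t ∈ Ioo 0 T, ∀ θ, ‖g (t, θ)‖ ≤ b θ) :
    Integrable g ((timeMeasure T).prod ν) := by
  refine (hI.comp_snd (timeMeasure T)).mono' hg ?_
  have h2 : ∀ᵐ p ∂((timeMeasure T).prod ν), p.1 ∈ Ioo 0 T :=
    Measure.quasiMeasurePreserving_fst.ae (ae_restrict_mem measurableSet_Ioo)
  filter_upwards [h2] with p hp using hb p.1 hp p.2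

lemma integrable_prod_of_norm_le_inv {E : Type*} [NormedAddCommGroup E] [SFinite ν]
    (hI : Integrable (fun θ => (1 + c θ)⁻¹) ν) {g : ℝ × Θ → E} {T C : ℝ}
    (hg : AEStronglyMeasurable g ((timeMeasure T).prod ν))
    (hb : ∀ t ∈ Ioo 0 T, ∀ θ, ‖g (t, θ)‖ ≤ C * (1 + c θ)⁻¹) :
    Integrable g ((timeMeasure T).prod ν) :=
  integrable_prod_of_norm_le (hI.const_mul C) hg hb

/-- The energy inequality for one exponential kernel: with `q = K_c φ`, `φ = ∫ ψ` and
`p = q' = K_c ψ`, the integrands differ by the derivative of `c/2 ‖q‖² + ε/2 ‖p‖²`. -/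
lemma integral_norm_sq_expConv_le [CompleteSpace H] {ψ : ℝ → H} (hψ : Continuous ψ) {a ε T : ℝ}
    (ha : 0 ≤ a) (hε : 0 ≤ ε) (hT : 0 ≤ T) :
    ∫ t in (0 : ℝ)..T, (1 + ε * a) * ‖expConv a ψ t‖ ^ 2 ≤
      ∫ t in (0 : ℝ)..T, inner ℝ (expConv 0 ψ t + ε • ψ t) (expConv a ψ t) := by
  have hφ : Continuous (expConv 0 ψ) := continuous_expConv hψ.locallyIntegrable 0
  have hp : Continuous (expConv a ψ) := continuous_expConv hψ.locallyIntegrable a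
  have hq : Continuous (expConv a (expConv 0 ψ)) := continuous_expConv hφ.locallyIntegrable a
  have hrel : ∀ t, 0 ≤ t → expConv 0 ψ t = expConv a ψ t + a • expConv a (expConv 0 ψ) t := by
    intro t ht
    rw [expConv_eq_primitive_sub hψ.locallyIntegrable a ht, expConv_zero_left]; abel
  have hder : ∀ t ∈ uIcc 0 T, HasDerivAt
      (fun t => a / 2 * ‖expConv a (expConv 0 ψ) t‖ ^ 2 + ε / 2 * ‖expConv a ψ t‖ ^ 2)
      (inner ℝ (expConv 0 ψ t + ε • ψ t) (expConv a ψ t) -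
        (1 + ε * a) * ‖expConv a ψ t‖ ^ 2) t := by
    intro t ht
    rw [uIcc_of_le hT] at ht
    have h1 := (hasDerivAt_expConv_of_continuous hφ a t).norm_sq
    have h2 := (hasDerivAt_expConv_of_continuous hψ a t).norm_sq
    refine ((h1.const_mul (a / 2)).fun_add (h2.const_mul (ε / 2))).congr_deriv ?_
    rw [hrel t ht.1]
    simp only [add_sub_cancel_right, inner_add_left, inner_sub_right, inner_smul_left,
      inner_smul_right, real_inner_self_eq_norm_sq, RCLike.conj_to_real,
      real_inner_comm (expConv a ψ t) (ψ t)]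
    ring
  have hc1 : Continuous fun t => inner ℝ (expConv 0 ψ t + ε • ψ t) (expConv a ψ t) := by fun_prop
  have hc2 : Continuous fun t => (1 + ε * a) * ‖expConv a ψ t‖ ^ 2 := by fun_prop
  have h3 := intervalIntegral.integral_eq_sub_of_hasDerivAt hder
    ((hc1.sub hc2).intervalIntegrable _ _)
  rw [intervalIntegral.integral_sub (hc1.intervalIntegrable _ _) (hc2.intervalIntegrable _ _)] at h3
  simp only [expConv_zero_right, norm_zero] at h3
  have h4 : 0 ≤ a / 2 * ‖expConv a (expConv 0 ψ) T‖ ^ 2 + ε / 2 * ‖expConv a ψ T‖ ^ 2 := by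
    positivity
  linarith

lemma exists_norm_expConv_le {B : Type*} [NormedAddCommGroup B] [NormedSpace ℝ B]
    {ψ : ℝ → B} (hψ : Continuous ψ) {T : ℝ} (hT : 0 ≤ T) :
    ∃ C, 0 ≤ C ∧ ∀ a, 0 ≤ a → ∀ t ∈ Icc 0 T, ‖expConv a ψ t‖ ≤ C * (1 + a)⁻¹ := by
  obtain ⟨M, hM⟩ := (isCompact_Icc (a := 0) (b := T)).exists_bound_of_continuousOn hψ.continuousOn
  have hM0 : 0 ≤ M := (norm_nonneg _).trans (hM 0 ⟨le_rfl, hT⟩)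
  refine ⟨M * (1 + T), by positivity, fun a ha t ht => ?_⟩
  rw [← div_eq_mul_inv]
  exact norm_expConv_le_div hψ.locallyIntegrable ha hM0 ht
    (Eventually.of_forall fun s hs => hM s ⟨hs.1.le, hs.2.le.trans ht.2⟩)

lemma integrable_expConv_superposition {B : Type*} [NormedAddCommGroup B] [NormedSpace ℝ B]
    (hc : Measurable c) (hc0 : ∀ θ, 0 ≤ c θ) (hI : Integrable (fun θ => (1 + c θ)⁻¹) ν)
    {ψ : ℝ → B} (hψ : Continuous ψ) {t : ℝ} (ht : 0 ≤ t) :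
    Integrable (fun θ => expConv (c θ) ψ t) ν := by
  obtain ⟨C, -, hC⟩ := exists_norm_expConv_le hψ ht
  refine (hI.const_mul C).mono' ?_ (Eventually.of_forall fun θ => hC _ (hc0 θ) t ⟨ht, le_rfl⟩)
  exact ((stronglyMeasurable_expConv hψ hc).comp_measurable
    (measurable_const.prodMk measurable_id)).aestronglyMeasurable

lemma integrable_prod_weight_norm_sq_expConv [SFinite ν]
    (hc : Measurable c) (hc0 : ∀ θ, 0 ≤ c θ) (hI : Integrable (fun θ => (1 + c θ)⁻¹) ν)
    {B : Type*} [NormedAddCommGroup B] [NormedSpace ℝ B]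
    {ψ : ℝ → B} (hψ : Continuous ψ) {ε T : ℝ} (hε : 0 ≤ ε) (hT : 0 ≤ T) :
    Integrable (fun p : ℝ × Θ => (1 + ε * c p.2) * ‖expConv (c p.2) ψ p.1‖ ^ 2)
      ((timeMeasure T).prod ν) := by
  obtain ⟨C, hC0, hC⟩ := exists_norm_expConv_le hψ hT
  refine integrable_prod_of_norm_le_inv hI (C := (1 + ε) * C ^ 2) ?_ fun t ht θ => ?_
  · exact ((((hc.comp measurable_snd).const_mul ε).const_add 1).mul
      ((stronglyMeasurable_expConv hψ hc).norm.measurable.pow_const 2)).aestronglyMeasurable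
  · have h1 := hC _ (hc0 θ) t (Ioo_subset_Icc_self ht)
    have h0 := hc0 θ
    rw [Real.norm_of_nonneg (by positivity)]
    calc (1 + ε * c θ) * ‖expConv (c θ) ψ t‖ ^ 2 ≤ ((1 + ε) * (1 + c θ)) *
          (C * (1 + c θ)⁻¹) ^ 2 := by
          gcongr; nlinarith
      _ = (1 + ε) * C ^ 2 * (1 + c θ)⁻¹ := by field_simp

/-- The energy inequality for the superposition `∫ K_c ψ dν(c)`. -/
lemma integral_integral_norm_sq_expConv_le [CompleteSpace H] [SFinite ν]
    (hc : Measurable c) (hc0 : ∀ θ, 0 ≤ c θ) (hI : Integrable (fun θ => (1 + c θ)⁻¹) ν)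
    {ψ : ℝ → H} (hψ : Continuous ψ) {ε T : ℝ} (hε : 0 ≤ ε) (hT : 0 ≤ T) :
    ∫ t, ∫ θ, (1 + ε * c θ) * ‖expConv (c θ) ψ t‖ ^ 2 ∂ν ∂(timeMeasure T) ≤
      ∫ t, inner ℝ (expConv 0 ψ t + ε • ψ t) (∫ θ, expConv (c θ) ψ t ∂ν) ∂(timeMeasure T) := by
  have i1 := integrable_prod_weight_norm_sq_expConv hc hc0 hI hψ hε hT
  have hφ : Continuous (fun t => expConv 0 ψ t + ε • ψ t) :=
    (continuous_expConv hψ.locallyIntegrable 0).add (hψ.const_smul ε)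
  have i2 : Integrable (fun p : ℝ × Θ => inner ℝ (expConv 0 ψ p.1 + ε • ψ p.1)
      (expConv (c p.2) ψ p.1)) ((timeMeasure T).prod ν) := by
    obtain ⟨C, hC0, hC⟩ := exists_norm_expConv_le hψ hT
    obtain ⟨M, hM⟩ := (isCompact_Icc (a := 0) (b := T)).exists_bound_of_continuousOn hφ.continuousOn
    refine integrable_prod_of_norm_le_inv hI (C := M * C) ?_ fun t ht θ => ?_
    · exact ((hφ.stronglyMeasurable.comp_measurable measurable_fst).inner
        (stronglyMeasurable_expConv hψ hc)).aestronglyMeasurable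
    · have h1 := hC _ (hc0 θ) t (Ioo_subset_Icc_self ht)
      have h2 := hM t (Ioo_subset_Icc_self ht)
      calc _ ≤ ‖expConv 0 ψ t + ε • ψ t‖ * ‖expConv (c θ) ψ t‖ := norm_inner_le_norm _ _
        _ ≤ M * (C * (1 + c θ)⁻¹) := mul_le_mul h2 h1 (norm_nonneg _) ((norm_nonneg _).trans h2)
        _ = _ := by ring
  refine (integral_integral_swap i1).trans_le ?_
  have e : ∫ t, inner ℝ (expConv 0 ψ t + ε • ψ t) (∫ θ, expConv (c θ) ψ t ∂ν) ∂(timeMeasure T) =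
      ∫ t, ∫ θ, inner ℝ (expConv 0 ψ t + ε • ψ t) (expConv (c θ) ψ t) ∂ν ∂(timeMeasure T) := by
    refine integral_congr_ae (ae_timeMeasure_iff.2 (Eventually.of_forall fun t ht => ?_))
    exact (integral_inner (integrable_expConv_superposition hc hc0 hI hψ ht.1.le) _).symm
  rw [e]
  refine le_of_le_of_eq ?_ (integral_integral_swap i2).symm
  refine integral_mono i1.integral_prod_right i2.integral_prod_right fun θ => ?_
  have := integral_norm_sq_expConv_le hψ (hc0 θ) hε hT
  rwa [intervalIntegral_eq_timeMeasure hT, intervalIntegral_eq_timeMeasure hT] at this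

/-- Cauchy--Schwarz with the weight `b + c`. -/
lemma norm_integral_sq_le_weight [CompleteSpace H] {b : ℝ} (hb : 0 < b)
    (hc0 : ∀ θ, 0 ≤ c θ) (hN : Integrable (fun θ => (b + c θ)⁻¹) ν) {Q : Θ → H}
    (hQ2 : Integrable (fun θ => (b + c θ) * ‖Q θ‖ ^ 2) ν) :
    ‖∫ θ, Q θ ∂ν‖ ^ 2 ≤ (∫ θ, (b + c θ)⁻¹ ∂ν) * ∫ θ, (b + c θ) * ‖Q θ‖ ^ 2 ∂ν := by
  set N := ∫ θ, (b + c θ)⁻¹ ∂ν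
  set A := ∫ θ, (b + c θ) * ‖Q θ‖ ^ 2 ∂ν
  have hpos : ∀ θ, 0 < b + c θ := fun θ => by linarith [hc0 θ]
  have hN0 : 0 ≤ N := integral_nonneg fun θ => (inv_pos.2 (hpos θ)).le
  have hA0 : 0 ≤ A := integral_nonneg fun θ => by have := hpos θ; positivity
  -- the bound by the arithmetic mean, for every ratio of the two sides
  have key : ∀ x : ℝ, 2 * x * ‖∫ θ, Q θ ∂ν‖ ≤ x ^ 2 * N + A := by
    intro x
    rcases le_total x 0 with hx | hx
    · have : 2 * x * ‖∫ θ, Q θ ∂ν‖ ≤ 0 := by nlinarith [norm_nonneg (∫ θ, Q θ ∂ν)]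
      have := mul_nonneg (sq_nonneg x) hN0
      linarith
    have hpt : ∀ θ, 2 * x * ‖Q θ‖ ≤ x ^ 2 * (b + c θ)⁻¹ + (b + c θ) * ‖Q θ‖ ^ 2 := by
      intro θ
      have h := hpos θ
      have h1 : 0 ≤ (b + c θ)⁻¹ * (x - (b + c θ) * ‖Q θ‖) ^ 2 := by positivity
      have h2 : (b + c θ)⁻¹ * (x - (b + c θ) * ‖Q θ‖) ^ 2 =
        x ^ 2 * (b + c θ)⁻¹ + (b + c θ) * ‖Q θ‖ ^ 2 - 2 * x * ‖Q θ‖ := by field_simp; ring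
      linarith
    have hint := (hN.const_mul (x ^ 2)).add hQ2
    calc 2 * x * ‖∫ θ, Q θ ∂ν‖ ≤ 2 * x * ∫ θ, ‖Q θ‖ ∂ν := by
          gcongr; exact norm_integral_le_integral_norm _
      _ = ∫ θ, 2 * x * ‖Q θ‖ ∂ν := (integral_const_mul _ _).symm
      _ ≤ ∫ θ, (x ^ 2 * (b + c θ)⁻¹ + (b + c θ) * ‖Q θ‖ ^ 2) ∂ν :=
          integral_mono_of_nonneg (Eventually.of_forall fun θ => by positivity) hint
            (Eventually.of_forall hpt)
      _ = x ^ 2 * N + A := by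
          rw [integral_add (hN.const_mul _) hQ2, integral_const_mul]
  have hd := discrim_le_zero (a := N) (b := -(2 * ‖∫ θ, Q θ ∂ν‖)) (c := A) fun x => by
    have := key x; nlinarith
  rw [discrim] at hd
  nlinarith

lemma integrable_inv_weight (hc : Measurable c) (hc0 : ∀ θ, 0 ≤ c θ)
    (hI : Integrable (fun θ => (1 + c θ)⁻¹) ν) {b : ℝ} (hb : 1 ≤ b) :
    Integrable (fun θ => (b + c θ)⁻¹) ν := by
  refine hI.mono' (hc.const_add b).inv.aestronglyMeasurable (Eventually.of_forall fun θ => ?_)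
  have := hc0 θ
  rw [Real.norm_of_nonneg (by positivity)]
  gcongr

lemma tendsto_integral_inv_weight (hc : Measurable c) (hc0 : ∀ θ, 0 ≤ c θ)
    (hI : Integrable (fun θ => (1 + c θ)⁻¹) ν) :
    Tendsto (fun b : ℝ => ∫ θ, (b + c θ)⁻¹ ∂ν) atTop (𝓝 0) := by
  have h0 : (0 : ℝ) = ∫ _, 0 ∂ν := by simp
  rw [h0]
  refine tendsto_integral_filter_of_dominated_convergence (fun θ => (1 + c θ)⁻¹)
    (Eventually.of_forall fun b => (hc.const_add b).inv.aestronglyMeasurable) ?_ hI ?_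
  · filter_upwards [eventually_ge_atTop 1] with b hb
    refine Eventually.of_forall fun θ => ?_
    have := hc0 θ
    rw [Real.norm_of_nonneg (by positivity)]
    gcongr
  · exact Eventually.of_forall fun θ => tendsto_inv_atTop_zero.comp
      (tendsto_atTop_add_const_right _ _ tendsto_id)

end Superposition

/-! ### The flow as a superposition of exponential relaxations -/

section Flow

variable {X H : Type*} [NormedAddCommGroup X] [NormedSpace ℝ X]
  [NormedAddCommGroup H] [InnerProductSpace ℝ H]

/-- The embedding `H ↪ X'` as a continuous linear map. -/
noncomputable def toDualXL (ι : X →L[ℝ] H) : H →L[ℝ] X →L[ℝ] ℝ :=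
  LinearMap.mkContinuous
    { toFun := toDualX ι
      map_add' := fun a b => by ext v; simp [toDualX]
      map_smul' := fun a b => by ext v; simp [toDualX] } ‖ι‖
    fun h => by
      refine ContinuousLinearMap.opNorm_le_bound _ (by positivity) fun v => ?_
      calc ‖inner ℝ h (ι v)‖ ≤ ‖h‖ * ‖ι v‖ := norm_inner_le_norm _ _
        _ ≤ ‖h‖ * (‖ι‖ * ‖v‖) := by gcongr; exact ι.le_opNorm v
        _ = ‖ι‖ * ‖h‖ * ‖v‖ := by ring

lemma toDualXL_eq (ι : X →L[ℝ] H) (h : H) : toDualXL ι h = toDualX ι h := rfl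

lemma toDualXL_apply (ι : X →L[ℝ] H) (h : H) (v : X) : toDualXL ι h v = inner ℝ h (ι v) := rfl

lemma toDualXL_injective {ι : X →L[ℝ] H} (hdense : DenseRange ι) :
    Function.Injective (toDualXL ι) := by
  refine (injective_iff_map_eq_zero _).2 fun h hh => ?_
  have h1 : (fun w : H => inner ℝ h w) = fun _ => 0 :=
    hdense.equalizer (by fun_prop) continuous_const (funext fun x =>
      congrArg (fun L : X →L[ℝ] ℝ => L x) hh)
  exact inner_self_eq_zero.1 (congrFun h1 h)

/-- The increment `u - u₀` on `(0,T)`, extended by zero. -/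
noncomputable def flowIncr {X : Type*} [NormedAddCommGroup X] (T : ℝ) (u₀ : X) (u : ℝ → X) :
    ℝ → X :=
  (Ioo 0 T).indicator fun t => u t - u₀

/-- The force `-grad E(u)` on `(0,T)`, extended by zero. -/
noncomputable def flowForce (E : X → ℝ) (T : ℝ) (u : ℝ → X) : ℝ → X →L[ℝ] ℝ :=
  (Ioo 0 T).indicator fun t => -gradE E (u t)

lemma flowIncr_of_mem {X : Type*} [NormedAddCommGroup X] {T : ℝ} {u₀ : X} {u : ℝ → X} {t : ℝ}
    (ht : t ∈ Ioo 0 T) :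
    flowIncr T u₀ u t = u t - u₀ := indicator_of_mem ht _

lemma flowForce_of_mem {E : X → ℝ} {T : ℝ} {u : ℝ → X} {t : ℝ} (ht : t ∈ Ioo 0 T) :
    flowForce E T u t = -gradE E (u t) := indicator_of_mem ht _

/-- The properties of a solution `u` of the fractional gradient flow on which the energy balance
rests, for a general completely monotone kernel `g(r) = ∫ exp(-c(θ) r) dν(θ)` in place of `g_α`.
The function `F` is the `H`-valued primitive of the force, and the equation reads
`u - u₀ = g * force`; it is stated in the time-integrated form `1 * (u - u₀) = g * F`, where both
sides are defined in `H`. -/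
structure IsSuperposedFlow {Θ : Type*} [MeasurableSpace Θ] (ν : Measure Θ) (c : Θ → ℝ)
    (ι : X →L[ℝ] H) (E : X → ℝ) (p T κ : ℝ) (u₀ : X) (u : ℝ → X) (F : ℝ → H) : Prop where
  measurable_rate : Measurable c
  rate_nonneg : ∀ θ, 0 ≤ c θ
  integrable_rate : Integrable (fun θ => (1 + c θ)⁻¹) ν
  one_lt : 1 < p
  pos : 0 < T
  denseRange : DenseRange ι
  semiconvex_nonneg : 0 ≤ κ
  semiconvex : ∀ x₁ x₂ : X, E x₁ + gradE E x₁ (x₂ - x₁) - κ * ‖ι (x₂ - x₁)‖ ^ 2 ≤ E x₂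
  memLp_incr : MemLp (flowIncr T u₀ u) (ENNReal.ofReal p) volume
  bounded_incr : ∃ Y, 0 ≤ Y ∧ ∀ᵐ t, ‖ι (flowIncr T u₀ u t)‖ ≤ Y
  memLp_force : MemLp (flowForce E T u) (ENNReal.ofReal p.conjExponent) volume
  integrable_energy : Integrable (fun t => E (u t)) (timeMeasure T)
  energy_bounded_below : ∃ C, ∀ᵐ t ∂(timeMeasure T), -C ≤ E (u t)
  continuous_primitive : Continuous F
  primitive : ∀ t ∈ Icc 0 T, toDualXL ι (F t) = ∫ s in (0 : ℝ)..t, flowForce E T u s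
  representation : ∀ t ∈ Icc 0 T,
    expConv 0 (fun s => ι (flowIncr T u₀ u s)) t = ∫ θ, expConv (c θ) F t ∂ν

/-- `K_a` applied to the derivative of `F`, for `F 0 = 0`. -/
noncomputable def relax (F : ℝ → H) (a t : ℝ) : H := F t - a • expConv a F t

lemma continuous_relax {F : ℝ → H} (hF : Continuous F) (a : ℝ) : Continuous (relax F a) :=
  hF.sub ((continuous_expConv hF.locallyIntegrable a).const_smul a)

lemma expConv_zero_relax [CompleteSpace H] {F : ℝ → H} (hF : Continuous F) (a : ℝ) {t : ℝ}
    (ht : 0 ≤ t) :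
    expConv 0 (relax F a) t = expConv a F t := by
  rw [expConv_zero_left]
  exact integral_sub_smul_expConv hF.locallyIntegrable a ht

lemma expConv_relax [CompleteSpace H] {F : ℝ → H} (hF : Continuous F) (a b : ℝ) {t : ℝ}
    (ht : 0 ≤ t) :
    expConv b (relax F a) t = expConv b F t - a • expConv a (expConv b F) t := by
  rw [expConv_comm hF.locallyIntegrable a b ht, ← expConv_smul]
  exact expConv_sub hF.locallyIntegrable
    ((continuous_expConv hF.locallyIntegrable a).const_smul a).locallyIntegrable b t

/-- `K_b K_a F'` is symmetric in `a` and `b`. -/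
lemma expConv_relax_comm [CompleteSpace H] {F : ℝ → H} (hF : Continuous F) (a b : ℝ) {t : ℝ}
    (ht : 0 ≤ t) : expConv b (relax F a) t = expConv a (relax F b) t := by
  rw [expConv_relax hF a b ht, expConv_relax hF b a ht,
    expConv_comm hF.locallyIntegrable b a ht, sub_eq_sub_iff_sub_eq_sub, ← sub_smul]
  rw [← expConv_resolvent hF.locallyIntegrable b a ht, expConv_comm hF.locallyIntegrable b a ht]

/-- The derivative of the doubly regularized force `a K_a b K_b F'`. -/
noncomputable def regForce (F : ℝ → H) (a b t : ℝ) : H :=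
  (a * b / (b - a)) • (b • relax F b t - a • relax F a t)

lemma continuous_regForce {F : ℝ → H} (hF : Continuous F) (a b : ℝ) :
    Continuous (regForce F a b) :=
  (((continuous_relax hF b).const_smul b).sub ((continuous_relax hF a).const_smul a)).const_smul _

lemma expConv_regForce [CompleteSpace H] {F : ℝ → H} (hF : Continuous F) (a b d : ℝ) {t : ℝ} :
    expConv d (regForce F a b) t = (a * b / (b - a)) •
      (b • expConv d (relax F b) t - a • expConv d (relax F a) t) := by
  have h1 : regForce F a b = fun s => (a * b / (b - a)) • (b • relax F b s - a • relax F a s) := rfl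
  have h2 := expConv_sub (z₁ := fun s => b • relax F b s) (z₂ := fun s => a • relax F a s)
    ((continuous_relax hF b).const_smul b).locallyIntegrable
    ((continuous_relax hF a).const_smul a).locallyIntegrable d t
  rw [h1, expConv_smul, h2, expConv_smul, expConv_smul]

lemma expConv_zero_regForce [CompleteSpace H] {F : ℝ → H} (hF : Continuous F) (a b : ℝ) {t : ℝ}
    (ht : 0 ≤ t) :
    expConv 0 (regForce F a b) t = (a * b / (b - a)) • (relax F a t - relax F b t) := by
  rw [expConv_regForce hF, expConv_zero_relax hF b ht, expConv_zero_relax hF a ht]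
  simp only [relax]; congr 1; abel

/-- The combination of the force and its derivative that enters the energy inequality, with
`ε = 1 / a`, is the force smoothed at the rate `b` alone. -/
lemma expConv_zero_regForce_add [CompleteSpace H] {F : ℝ → H} (hF : Continuous F) {a b : ℝ}
    (ha : 0 < a) (hab : a < b) {t : ℝ} (ht : 0 ≤ t) :
    expConv 0 (regForce F a b) t + a⁻¹ • regForce F a b t = b • relax F b t := by
  rw [expConv_zero_regForce hF a b ht, regForce, smul_comm a⁻¹, ← smul_add, smul_sub a⁻¹,
    smul_smul, smul_smul, inv_mul_cancel₀ ha.ne', one_smul]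
  have : relax F a t - relax F b t + ((a⁻¹ * b) • relax F b t - relax F a t) =
      (a⁻¹ * b - 1) • relax F b t := by rw [sub_smul, one_smul]; abel
  rw [this, smul_smul]
  congr 1
  have : b - a ≠ 0 := (sub_pos.2 hab).ne'
  field_simp

namespace IsSuperposedFlow

variable {Θ : Type*} [MeasurableSpace Θ] {ν : Measure Θ} {c : Θ → ℝ}
  {ι : X →L[ℝ] H} {E : X → ℝ} {p T κ : ℝ} {u₀ : X} {u : ℝ → X} {F : ℝ → H}

lemma locallyIntegrable_incr (h : IsSuperposedFlow ν c ι E p T κ u₀ u F) :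
    LocallyIntegrable (flowIncr T u₀ u) volume :=
  h.memLp_incr.locallyIntegrable (by
    rw [← ENNReal.ofReal_one]; exact ENNReal.ofReal_le_ofReal h.one_lt.le)

lemma locallyIntegrable_force (h : IsSuperposedFlow ν c ι E p T κ u₀ u F) :
    LocallyIntegrable (flowForce E T u) volume :=
  h.memLp_force.locallyIntegrable (by
    rw [← ENNReal.ofReal_one]; exact ENNReal.ofReal_le_ofReal
      (Real.HolderConjugate.conjExponent h.one_lt).symm.lt.le)

lemma locallyIntegrable_map_incr (h : IsSuperposedFlow ν c ι E p T κ u₀ u F) :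
    LocallyIntegrable (fun t => ι (flowIncr T u₀ u t)) volume :=
  fun x => by
    obtain ⟨s, hs, hs'⟩ := h.locallyIntegrable_incr x
    exact ⟨s, hs, ι.integrable_comp hs'⟩

lemma primitive_zero (h : IsSuperposedFlow ν c ι E p T κ u₀ u F) : F 0 = 0 := by
  refine toDualXL_injective h.denseRange ?_
  rw [h.primitive 0 ⟨le_rfl, h.pos.le⟩]; simp

lemma toDualXL_relax [CompleteSpace H] (h : IsSuperposedFlow ν c ι E p T κ u₀ u F) (a : ℝ) {t : ℝ}
    (ht : t ∈ Icc 0 T) :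
    toDualXL ι (relax F a t) = expConv a (flowForce E T u) t := by
  rw [expConv_eq_primitive_sub h.locallyIntegrable_force a ht.1, relax, map_sub, map_smul,
    h.primitive t ht, (toDualXL ι).map_expConv h.continuous_primitive.locallyIntegrable]
  congr 2
  refine expConv_congr ht.1 (Eventually.of_forall fun s hs => ?_) a
  rw [h.primitive s ⟨hs.1.le, hs.2.le.trans ht.2⟩, expConv_zero_left]

variable [CompleteSpace H] [SFinite ν]

/-- The smoothed equation `K_a (u - u₀) = g * K_a force`. -/
lemma expConv_incr (h : IsSuperposedFlow ν c ι E p T κ u₀ u F) (a : ℝ) {t : ℝ}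
    (ht : t ∈ Icc 0 T) :
    expConv a (fun s => ι (flowIncr T u₀ u s)) t = ∫ θ, expConv (c θ) (relax F a) t ∂ν := by
  have hF := h.continuous_primitive
  have hc := h.measurable_rate
  obtain ⟨C, hC0, hC⟩ := exists_norm_expConv_le hF h.pos.le
  have i0 : ∀ {s}, 0 ≤ s → Integrable (fun θ => expConv (c θ) F s) ν := fun hs =>
    integrable_expConv_superposition hc h.rate_nonneg h.integrable_rate hF hs
  have i1 : Integrable (fun q : ℝ × Θ => Real.exp (-(a * (t - q.1))) • expConv (c q.2) F q.1)
      ((timeMeasure t).prod ν) := by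
    obtain ⟨M, hM⟩ := (isCompact_Icc (a := 0) (b := t)).exists_bound_of_continuousOn
      (f := fun s => Real.exp (-(a * (t - s)))) (by fun_prop)
    refine integrable_prod_of_norm_le_inv h.integrable_rate (C := M * C) ?_ fun s hs θ => ?_
    · have : Measurable fun q : ℝ × Θ => Real.exp (-(a * (t - q.1))) := by fun_prop
      exact (this.stronglyMeasurable.smul (stronglyMeasurable_expConv hF hc)).aestronglyMeasurable
    · have h1 := hC _ (h.rate_nonneg θ) s ⟨hs.1.le, hs.2.le.trans ht.2⟩
      have h2 := hM s (Ioo_subset_Icc_self hs)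
      rw [norm_smul, mul_assoc]
      exact mul_le_mul h2 h1 (norm_nonneg _) ((norm_nonneg _).trans h2)
  have e1 : expConv a (expConv 0 fun s => ι (flowIncr T u₀ u s)) t =
      ∫ θ, expConv a (expConv (c θ) F) t ∂ν := by
    have h1 : expConv a (expConv 0 fun s => ι (flowIncr T u₀ u s)) t =
        expConv a (fun s => ∫ θ, expConv (c θ) F s ∂ν) t :=
      expConv_congr ht.1 (Eventually.of_forall fun s hs =>
        h.representation s ⟨hs.1.le, hs.2.le.trans ht.2⟩) a
    rw [h1]
    simp only [expConv_eq_timeMeasure ht.1, ← integral_smul]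
    exact integral_integral_swap i1
  have i2 : Integrable (fun θ => expConv a (expConv (c θ) F) t) ν := by
    have := i1.integral_prod_right
    refine this.congr (Eventually.of_forall fun θ => ?_)
    simp only [expConv_eq_timeMeasure ht.1 a]
  rw [expConv_eq_primitive_sub h.locallyIntegrable_map_incr a ht.1, e1, ← expConv_zero_left,
    h.representation t ht]
  have e2 : ∀ θ, expConv (c θ) (relax F a) t =
      expConv (c θ) F t - a • expConv a (expConv (c θ) F) t := fun θ => expConv_relax hF a _ ht.1
  simp only [e2]
  have e3 := integral_sub (i0 ht.1) (g := fun θ => a • expConv a (expConv (c θ) F) t) (i2.smul a)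
  rw [e3, integral_smul]

end IsSuperposedFlow

end Flow

/-! ### The a priori bound -/

section APriori

variable {X H : Type*} [NormedAddCommGroup X] [NormedSpace ℝ X]
  [NormedAddCommGroup H] [InnerProductSpace ℝ H]

/-- The excess `G(u) - G(u₀)` on `(0,T)` of the convex function `G(x) = E(x) + κ ‖x - u₀‖²_H`,
extended by zero. -/
noncomputable def excessEnergy (ι : X →L[ℝ] H) (E : X → ℝ) (T κ : ℝ) (u₀ : X) (u : ℝ → X) : ℝ → ℝ :=
  (Ioo 0 T).indicator fun t => E (u t) + κ * ‖ι (u t - u₀)‖ ^ 2 - E u₀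

/-- The force `-G'(u)` belonging to the convex function `G(x) = E(x) + κ ‖x - u₀‖²_H`. -/
noncomputable def convexForce (ι : X →L[ℝ] H) (E : X → ℝ) (T κ : ℝ) (u₀ : X) (u : ℝ → X) (t : ℝ) :
    X →L[ℝ] ℝ :=
  flowForce E T u t - (2 * κ) • toDualXL ι (ι (flowIncr T u₀ u t))

namespace IsSuperposedFlow

variable {Θ : Type*} [MeasurableSpace Θ] {ν : Measure Θ} {c : Θ → ℝ}
  {ι : X →L[ℝ] H} {E : X → ℝ} {p T κ : ℝ} {u₀ : X} {u : ℝ → X} {F : ℝ → H}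

lemma integrable_norm_sq_incr (h : IsSuperposedFlow ν c ι E p T κ u₀ u F) :
    Integrable (fun t => ‖ι (flowIncr T u₀ u t)‖ ^ 2) (timeMeasure T) := by
  obtain ⟨Y, hY0, hY⟩ := h.bounded_incr
  refine Integrable.of_bound (C := Y ^ 2) ?_ ?_
  · exact ((ι.continuous.comp_aestronglyMeasurable h.memLp_incr.1).norm.pow 2).restrict
  · filter_upwards [ae_restrict_of_ae hY] with t ht
    rw [Real.norm_of_nonneg (by positivity)]
    gcongr

lemma locallyIntegrable_excess (h : IsSuperposedFlow ν c ι E p T κ u₀ u F) :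
    LocallyIntegrable (excessEnergy ι E T κ u₀ u) volume := by
  refine Integrable.locallyIntegrable ?_
  refine (integrable_indicator_iff measurableSet_Ioo).2 ?_
  refine (h.integrable_energy.add ?_).sub (integrable_const _)
  refine Integrable.const_mul ?_ κ
  refine h.integrable_norm_sq_incr.congr
    (ae_timeMeasure_iff.2 (Eventually.of_forall fun t ht => ?_))
  simp only [flowIncr_of_mem ht]

/-- The subgradient inequality for `G`. -/
lemma convexForce_apply_le (h : IsSuperposedFlow ν c ι E p T κ u₀ u F) {t : ℝ} (ht : t ∈ Ioo 0 T)
    (x : X) :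
    convexForce ι E T κ u₀ u t (flowIncr T u₀ u t - (x - u₀)) ≤
      E x + κ * ‖ι (x - u₀)‖ ^ 2 - E u₀ - excessEnergy ι E T κ u₀ u t := by
  have h1 := h.semiconvex (u t) x
  rw [convexForce, excessEnergy, indicator_of_mem ht, flowForce_of_mem ht, flowIncr_of_mem ht]
  have e1 : u t - u₀ - (x - u₀) = -(x - u t) := by abel
  have e2 : ‖ι (x - u₀)‖ ^ 2 = ‖ι (u t - u₀)‖ ^ 2 + 2 * inner ℝ (ι (u t - u₀)) (ι (x - u t)) +
      ‖ι (x - u t)‖ ^ 2 := by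
    rw [← norm_add_sq_real, ← map_add]; congr 3; abel
  rw [e1, map_neg, sub_apply, smul_apply, toDualXL_apply, neg_apply, smul_eq_mul, e2]
  linarith

/-- The energy inequality for backward exponential averages, pointwise in time. -/
lemma convexForce_incr_le [CompleteSpace X] (h : IsSuperposedFlow ν c ι E p T κ u₀ u F) {a : ℝ}
    (ha : 0 ≤ a) {t : ℝ} (ht : t ∈ Ioo 0 T) :
    convexForce ι E T κ u₀ u t (flowIncr T u₀ u t - a • expConv a (flowIncr T u₀ u) t) ≤
      a * expConv a (excessEnergy ι E T κ u₀ u) t - excessEnergy ι E T κ u₀ u t := by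
  set L := convexForce ι E T κ u₀ u t
  set y := flowIncr T u₀ u
  set z := excessEnergy ι E T κ u₀ u
  have hLy : LocallyIntegrable (fun s => L (y s)) volume := fun x => by
    obtain ⟨s, hs, hs'⟩ := h.locallyIntegrable_incr x
    exact ⟨s, hs, L.integrable_comp hs'⟩
  -- the part of the average over `(0, t)`
  have h1 := expConv_mono (c := a) (z₁ := fun s => L (y t) - L (y s)) (z₂ := fun s => z s - z t)
    (continuous_const.locallyIntegrable.sub hLy)
    (h.locallyIntegrable_excess.sub continuous_const.locallyIntegrable) ht.1.le
    (Eventually.of_forall fun s hs => by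
      have hs' : s ∈ Ioo 0 T := ⟨hs.1, hs.2.trans ht.2⟩
      have := h.convexForce_apply_le ht (u s)
      rw [← map_sub]
      simpa only [y, z, flowIncr_of_mem hs', excessEnergy, indicator_of_mem hs'] using this)
  rw [expConv_sub continuous_const.locallyIntegrable hLy,
    expConv_sub h.locallyIntegrable_excess continuous_const.locallyIntegrable,
    ← L.map_expConv h.locallyIntegrable_incr] at h1
  have h2 := mul_le_mul_of_nonneg_left h1 ha
  rw [mul_sub, mul_sub, expConv_const_mul, expConv_const_mul] at h2
  -- the part of the average over the past, where the state is `u₀`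
  have h3 : L (y t) ≤ - z t := by
    have := h.convexForce_apply_le ht u₀
    simpa using this
  have h4 := mul_le_mul_of_nonneg_left h3 (Real.exp_nonneg (-(a * t)))
  rw [map_sub, map_smul, smul_eq_mul]
  linarith

lemma memLp_convexForce (h : IsSuperposedFlow ν c ι E p T κ u₀ u F) :
    MemLp (convexForce ι E T κ u₀ u) (ENNReal.ofReal p.conjExponent) (timeMeasure T) := by
  obtain ⟨Y, hY0, hY⟩ := h.bounded_incr
  refine h.memLp_force.restrict _ |>.sub ?_
  refine MemLp.const_smul ?_ (2 * κ)
  refine MemLp.of_bound (C := ‖toDualXL ι‖ * Y) ?_ ?_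
  · exact ((toDualXL ι).continuous.comp_aestronglyMeasurable
      (ι.continuous.comp_aestronglyMeasurable h.memLp_incr.1)).restrict
  · filter_upwards [ae_restrict_of_ae hY] with t ht
    exact (ContinuousLinearMap.le_opNorm _ _).trans (by gcongr)

lemma locallyIntegrable_convexForce (h : IsSuperposedFlow ν c ι E p T κ u₀ u F) :
    LocallyIntegrable (convexForce ι E T κ u₀ u) volume := by
  refine h.locallyIntegrable_force.sub (LocallyIntegrable.smul ?_ (2 * κ))
  intro x
  obtain ⟨s, hs, hs'⟩ := h.locallyIntegrable_map_incr x
  exact ⟨s, hs, (toDualXL ι).integrable_comp hs'⟩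

/-- The pairing of `-G'(u)` with the discrete derivative `a (y - a K_a y)` of `y = u - u₀`,
integrated in time, is bounded by the loss of energy. -/
lemma exists_integral_convexForce_le [CompleteSpace X]
    (h : IsSuperposedFlow ν c ι E p T κ u₀ u F) :
    ∃ C, 0 ≤ C ∧ ∀ a : ℝ, 0 ≤ a → ∫ t, convexForce ι E T κ u₀ u t
      (a • (flowIncr T u₀ u t - a • expConv a (flowIncr T u₀ u) t)) ∂(timeMeasure T) ≤ C := by
  obtain ⟨C, hC⟩ := h.energy_bounded_below
  set z := excessEnergy ι E T κ u₀ u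
  set y := flowIncr T u₀ u
  have hz := h.locallyIntegrable_excess
  have hy := h.locallyIntegrable_incr
  have hC' : ∀ᵐ s, s ∈ Ioo 0 T → -z s ≤ |C| + |E u₀| := by
    filter_upwards [ae_timeMeasure_iff.1 hC] with s hs hsT
    have h1 := hs hsT
    have h2 : 0 ≤ κ * ‖ι (u s - u₀)‖ ^ 2 := mul_nonneg h.semiconvex_nonneg (by positivity)
    simp only [z, excessEnergy, indicator_of_mem hsT]
    linarith [le_abs_self C, le_abs_self (E u₀)]
  have hC0 : 0 ≤ |C| + |E u₀| := by positivity
  refine ⟨|C| + |E u₀|, hC0, fun a ha => ?_⟩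
  have hdisc : MemLp (fun t => a • (y t - a • expConv a y t)) (ENNReal.ofReal p) (timeMeasure T) :=
    ((h.memLp_incr.restrict _).sub
      (((continuous_expConv hy a).const_smul a).memLp_timeMeasure _ T)).const_smul a
  have hKz : LocallyIntegrable (fun t => a * expConv a z t) volume :=
    ((continuous_expConv hz a).const_mul a).locallyIntegrable
  calc ∫ t, convexForce ι E T κ u₀ u t (a • (y t - a • expConv a y t)) ∂(timeMeasure T)
      ≤ ∫ t, a * (a * expConv a z t - z t) ∂(timeMeasure T) := by
        refine integral_mono_ae (integrable_pairing h.one_lt h.memLp_convexForce hdisc)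
          (((hKz.sub hz).integrable_timeMeasure T).const_mul a) ?_
        refine ae_timeMeasure_iff.2 (Eventually.of_forall fun t ht => ?_)
        simp only [map_smul, smul_eq_mul]
        exact mul_le_mul_of_nonneg_left (h.convexForce_incr_le ha ht) ha
    _ = a * expConv a (fun s => -z s) T := by
        have h1 := integral_sub_smul_expConv hz a h.pos.le
        rw [intervalIntegral_eq_timeMeasure h.pos.le] at h1
        have h2 := expConv_smul (-1) z a T
        simp only [neg_smul, one_smul] at h2
        rw [h2]
        change _ = a * -expConv a (excessEnergy ι E T κ u₀ u) T
        rw [← h1, integral_const_mul, ← integral_neg]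
        simp [z]
    _ ≤ a * expConv a (fun _ => |C| + |E u₀|) T := by
        refine mul_le_mul_of_nonneg_left (expConv_mono hz.neg
          continuous_const.locallyIntegrable h.pos.le hC' a) ha
    _ = (1 - Real.exp (-(a * T))) * (|C| + |E u₀|) := expConv_const_mul _ _ _
    _ ≤ 1 * (|C| + |E u₀|) := by
        gcongr; linarith [Real.exp_nonneg (-(a * T))]
    _ = |C| + |E u₀| := one_mul _

variable [CompleteSpace H]

/-- The smoothed force `-G'(u)` is an element of `H`. -/
lemma smul_expConv_convexForce (h : IsSuperposedFlow ν c ι E p T κ u₀ u F) (b : ℝ) {t : ℝ}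
    (ht : t ∈ Icc 0 T) :
    b • expConv b (convexForce ι E T κ u₀ u) t = toDualXL ι (b • relax F b t -
      (2 * κ) • (b • expConv b (fun s => ι (flowIncr T u₀ u s)) t)) := by
  have h1 : LocallyIntegrable (fun s => (2 * κ) • toDualXL ι (ι (flowIncr T u₀ u s))) volume :=
    LocallyIntegrable.smul (fun x => by
      obtain ⟨s, hs, hs'⟩ := h.locallyIntegrable_map_incr x
      exact ⟨s, hs, (toDualXL ι).integrable_comp hs'⟩) (2 * κ)
  have h2 := expConv_sub h.locallyIntegrable_force h1 b t
  have h3 : convexForce ι E T κ u₀ u =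
    fun s => flowForce E T u s - (2 * κ) • toDualXL ι (ι (flowIncr T u₀ u s)) := rfl
  rw [h3, h2, expConv_smul, ← h.toDualXL_relax b ht,
    ← (toDualXL ι).map_expConv h.locallyIntegrable_map_incr, map_sub, map_smul, map_smul, map_smul,
    smul_sub, smul_comm b]

variable [SFinite ν]

/-- The superposition of the relaxations driven by the derivative of the regularized force is the
derivative of the regularized state. -/
lemma integral_expConv_regForce (h : IsSuperposedFlow ν c ι E p T κ u₀ u F) (a b : ℝ) {t : ℝ}
    (ht : t ∈ Icc 0 T) :
    ∫ θ, expConv (c θ) (regForce F a b) t ∂ν = (a * b / (b - a)) •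
      (b • expConv b (fun s => ι (flowIncr T u₀ u s)) t -
        a • expConv a (fun s => ι (flowIncr T u₀ u s)) t) := by
  have hF := h.continuous_primitive
  have i : ∀ d, Integrable (fun θ => expConv (c θ) (relax F d) t) ν := fun d =>
    integrable_expConv_superposition h.measurable_rate h.rate_nonneg h.integrable_rate
      (continuous_relax hF d) ht.1
  simp only [expConv_regForce hF]
  rw [integral_smul, h.expConv_incr a ht, h.expConv_incr b ht, ← integral_smul b,
    ← integral_smul a]
  congr 1
  exact integral_sub (f := fun θ => b • expConv (c θ) (relax F b) t)
    (g := fun θ => a • expConv (c θ) (relax F a) t) ((i b).smul b) ((i a).smul a)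

variable [CompleteSpace X]

/-- The discrete derivative `a (y - a K_a y)` of `y = u - u₀`, smoothed at the rate `b`, is the
derivative of the regularized state. -/
lemma map_smul_expConv_discrepancy (h : IsSuperposedFlow ν c ι E p T κ u₀ u F) {a b : ℝ}
    (hab : a < b) {t : ℝ} (ht : t ∈ Icc 0 T) :
    ι (b • expConv b (fun s => a • (flowIncr T u₀ u s - a • expConv a (flowIncr T u₀ u) s)) t) =
      ∫ θ, expConv (c θ) (regForce F a b) t ∂ν := by
  set y := flowIncr T u₀ u
  have hy := h.locallyIntegrable_incr
  have hKy : LocallyIntegrable (fun s => a • expConv a y s) volume :=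
    ((continuous_expConv hy a).const_smul a).locallyIntegrable
  rw [h.integral_expConv_regForce a b ht, expConv_smul, expConv_sub hy hKy, expConv_smul,
    ← ι.map_expConv hy, ← ι.map_expConv hy, ← map_smul, ← map_smul, ← map_sub, ← map_smul]
  congr 1
  have h1 := expConv_resolvent hy b a ht.1
  have hne : b - a ≠ 0 := (sub_pos.2 hab).ne'
  have h2 : expConv b (expConv a y) t = (b - a)⁻¹ • (expConv a y t - expConv b y t) := by
    rw [eq_inv_smul_iff₀ hne, ← neg_sub a b, neg_smul, h1]; abel
  rw [h2]
  match_scalars <;> field_simp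
  ring

lemma integral_inner_primitive {D : ℝ → H} (hD : Continuous D) (hT : 0 ≤ T) :
    ∫ t, inner ℝ (expConv 0 D t) (D t) ∂(timeMeasure T) = 1 / 2 * ‖expConv 0 D T‖ ^ 2 := by
  rw [← intervalIntegral_eq_timeMeasure hT]
  have hder : ∀ t ∈ uIcc 0 T, HasDerivAt (fun t => 1 / 2 * ‖expConv 0 D t‖ ^ 2)
      (inner ℝ (expConv 0 D t) (D t)) t := fun t _ =>
    ((hasDerivAt_expConv_of_continuous hD 0 t).norm_sq.const_mul (1 / 2)).congr_deriv (by
      rw [zero_smul, sub_zero]; ring)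
  have hc := continuous_expConv hD.locallyIntegrable 0
  rw [intervalIntegral.integral_eq_sub_of_hasDerivAt hder
    ((by fun_prop : Continuous fun t => inner ℝ (expConv 0 D t) (D t)).intervalIntegrable _ _)]
  simp [expConv_zero_right]

/-- The a priori bound: the derivatives `K_c ψ`, `ψ = regForce F a b`, of the regularized extended
states are bounded in `L²(0,T;L²(ν;H))`. The rate `b` is chosen for given `a` so large that the
pairing of the force `-G'(u)` with the discrete derivative of `u` is nearly unchanged when both are
smoothed at the rate `b`. -/
theorem exists_bound_regForce (h : IsSuperposedFlow ν c ι E p T κ u₀ u F) :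
    ∃ C, ∀ᶠ a : ℝ in atTop, ∃ b, 2 * a ≤ b ∧
      ∫ t, ∫ θ, ‖expConv (c θ) (regForce F a b) t‖ ^ 2 ∂ν ∂(timeMeasure T) ≤ C := by
  obtain ⟨C, hC0, hC⟩ := h.exists_integral_convexForce_le
  obtain ⟨Y, hY0, hY⟩ := h.bounded_incr
  have hF := h.continuous_primitive
  have hy := h.locallyIntegrable_map_incr
  have hκ := h.semiconvex_nonneg
  refine ⟨2 * (C + 1 + 16 * κ * Y ^ 2), ?_⟩
  have hN : Tendsto (fun b : ℝ => 2 * κ * ∫ θ, (b + c θ)⁻¹ ∂ν) atTop (𝓝 0) := by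
    simpa using (tendsto_integral_inv_weight h.measurable_rate h.rate_nonneg
      h.integrable_rate).const_mul (2 * κ)
  filter_upwards [hN.eventually (ge_mem_nhds (show (0 : ℝ) < 1 / 2 by norm_num)),
    eventually_ge_atTop 1] with a haN ha1
  have ha : 0 < a := one_pos.trans_le ha1
  set y' : ℝ → X := fun s => a • (flowIncr T u₀ u s - a • expConv a (flowIncr T u₀ u) s) with hy'
  have hy'1 : LocallyIntegrable y' volume :=
    (h.locallyIntegrable_incr.sub ((continuous_expConv h.locallyIntegrable_incr a).const_smul
      a).locallyIntegrable).smul a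
  have hy'p : MemLp y' (ENNReal.ofReal p) (timeMeasure T) :=
    ((h.memLp_incr.restrict _).sub (((continuous_expConv h.locallyIntegrable_incr a).const_smul
      a).memLp_timeMeasure _ T)).const_smul a
  have hlim := tendsto_integral_pairing_smul_expConv h.one_lt h.pos.le h.memLp_convexForce hy'p
    h.locallyIntegrable_convexForce hy'1
  obtain ⟨b, hb1, hb2⟩ := ((hlim.eventually (gt_mem_nhds (lt_of_le_of_lt (hC a ha.le)
    (lt_add_one C)))).and (eventually_ge_atTop (2 * a))).exists
  refine ⟨b, hb2, ?_⟩
  have hab : a < b := by linarith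
  have hba : 0 < b - a := sub_pos.2 hab
  have hb : 0 < b := ha.trans hab
  -- the derivative `D` of the regularized state `η`
  set k := a * b / (b - a) with hk
  have hk0 : 0 ≤ k := by positivity
  set D : ℝ → H := fun t => k • (b • expConv b (fun s => ι (flowIncr T u₀ u s)) t -
        a • expConv a (fun s => ι (flowIncr T u₀ u s)) t) with hD
  have hDc : Continuous D :=
    (((continuous_expConv hy b).const_smul b).sub
      ((continuous_expConv hy a).const_smul a)).const_smul k
  have hDint : ∀ t ∈ Icc 0 T, ∫ θ, expConv (c θ) (regForce F a b) t ∂ν = D t := fun t ht =>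
    h.integral_expConv_regForce a b ht
  have hη : ∀ t, 0 ≤ t → expConv 0 D t = k • (expConv a (fun s => ι (flowIncr T u₀ u s)) t -
      expConv b (fun s => ι (flowIncr T u₀ u s)) t) := by
    intro t ht
    have h1 := expConv_sub (z₁ := fun s => b • expConv b (fun s => ι (flowIncr T u₀ u s)) s)
      (z₂ := fun s => a • expConv a (fun s => ι (flowIncr T u₀ u s)) s)
      ((continuous_expConv hy b).const_smul b).locallyIntegrable
      ((continuous_expConv hy a).const_smul a).locallyIntegrable 0 t
    have h2 := expConv_resolvent hy 0 a ht
    have h3 := expConv_resolvent hy 0 b ht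
    rw [sub_zero] at h2 h3
    rw [hD, expConv_smul, h1, expConv_smul, expConv_smul, h2, h3]
    congr 1; abel
  -- `k ≤ 2 a` because `b ≥ 2 a`, and `a K_a`, `b K_b` are contractions
  have hηT : ‖expConv 0 D T‖ ≤ 4 * Y := by
    rw [hη T h.pos.le, norm_smul, Real.norm_of_nonneg hk0]
    have hk2 : k ≤ 2 * a := by
      rw [hk, div_le_iff₀ hba]; nlinarith
    have hY' : ∀ᵐ s, s ∈ Ioo 0 T → ‖ι (flowIncr T u₀ u s)‖ ≤ Y := hY.mono fun s hs _ => hs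
    have n1 := norm_smul_expConv_le hy ha.le hY0 h.pos.le hY'
    have n2 := norm_smul_expConv_le hy (by linarith : 0 ≤ b) hY0 h.pos.le hY'
    set A := ‖expConv a (fun s => ι (flowIncr T u₀ u s)) T‖
    set A' := ‖expConv b (fun s => ι (flowIncr T u₀ u s)) T‖
    have hA' : 0 ≤ A' := norm_nonneg _
    calc k * _ ≤ 2 * a * (A + A') := by
          refine mul_le_mul hk2 (norm_sub_le _ _) (norm_nonneg _) (by positivity)
      _ ≤ 4 * Y := by nlinarith
  set S := ∫ t, ∫ θ, (1 + a⁻¹ * c θ) * ‖expConv (c θ) (regForce F a b) t‖ ^ 2 ∂ν ∂(timeMeasure T)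
  have hψ := continuous_regForce hF a b
  have hai : 0 ≤ a⁻¹ := by positivity
  have i1 := integrable_prod_weight_norm_sq_expConv h.measurable_rate h.rate_nonneg
    h.integrable_rate hψ hai h.pos.le
  have i0 := integrable_prod_weight_norm_sq_expConv h.measurable_rate h.rate_nonneg
    h.integrable_rate hψ le_rfl h.pos.le
  simp only [zero_mul, add_zero, one_mul] at i0
  -- the weighted dissipation controls the derivative of the state
  have hDS : a⁻¹ * ∫ t, ‖D t‖ ^ 2 ∂(timeMeasure T) ≤ (∫ θ, (a + c θ)⁻¹ ∂ν) * S := by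
    rw [← integral_const_mul, ← integral_const_mul]
    refine integral_mono_ae (((hDc.norm.pow 2).const_mul _).locallyIntegrable.integrable_timeMeasure
      T) (i1.integral_prod_left.const_mul _) ?_
    filter_upwards [i1.prod_right_ae, ae_restrict_mem measurableSet_Ioo] with t ht htT
    have e : ∀ θ, (a + c θ) * ‖expConv (c θ) (regForce F a b) t‖ ^ 2 =
        a * ((1 + a⁻¹ * c θ) * ‖expConv (c θ) (regForce F a b) t‖ ^ 2) := fun θ => by
      field_simp
    have h1 := norm_integral_sq_le_weight (b := a) ha h.rate_nonneg (integrable_inv_weight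
      h.measurable_rate h.rate_nonneg h.integrable_rate ha1)
      (Q := fun θ => expConv (c θ) (regForce F a b) t) (by simp only [e]; exact ht.const_mul a)
    rw [hDint t (Ioo_subset_Icc_self htT)] at h1
    simp only [e] at h1
    rw [integral_const_mul] at h1
    rw [inv_mul_le_iff₀ ha]
    linarith
  -- the smoothed pairing in terms of the energy inequality and of the quadratic part `2 κ y` of the
  -- force, where `b K_b y = η + D / a` and `η' = D`
  have hpair : ∫ t, (b • expConv b (convexForce ι E T κ u₀ u) t) (b • expConv b y' t)
        ∂(timeMeasure T) =
      ∫ t, inner ℝ (expConv 0 (regForce F a b) t + a⁻¹ • regForce F a b t)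
        (∫ θ, expConv (c θ) (regForce F a b) t ∂ν) ∂(timeMeasure T) -
        2 * κ * (∫ t, inner ℝ (expConv 0 D t) (D t) ∂(timeMeasure T) +
          a⁻¹ * ∫ t, ‖D t‖ ^ 2 ∂(timeMeasure T)) := by
    have hφ := continuous_expConv hψ.locallyIntegrable 0
    have hη' := continuous_expConv hDc.locallyIntegrable 0
    have j1 : Integrable (fun t => inner ℝ (expConv 0 D t) (D t)) (timeMeasure T) :=
      (by fun_prop : Continuous fun t => inner ℝ (expConv 0 D t) (D t)).locallyIntegrable
        |>.integrable_timeMeasure T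
    have j2 : Integrable (fun t => ‖D t‖ ^ 2) (timeMeasure T) :=
      (hDc.norm.pow 2).locallyIntegrable.integrable_timeMeasure T
    have j3 : Integrable (fun t => inner ℝ (expConv 0 (regForce F a b) t +
        a⁻¹ • regForce F a b t) (D t)) (timeMeasure T) :=
      (by fun_prop : Continuous fun t => inner ℝ (expConv 0 (regForce F a b) t +
        a⁻¹ • regForce F a b t) (D t)).locallyIntegrable.integrable_timeMeasure T
    have e1 : ∫ t, inner ℝ (expConv 0 (regForce F a b) t + a⁻¹ • regForce F a b t)
        (∫ θ, expConv (c θ) (regForce F a b) t ∂ν) ∂(timeMeasure T) =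
        ∫ t, inner ℝ (expConv 0 (regForce F a b) t + a⁻¹ • regForce F a b t) (D t)
          ∂(timeMeasure T) :=
      integral_congr_ae (ae_timeMeasure_iff.2 (Eventually.of_forall fun t ht => by
        simp only [hDint t (Ioo_subset_Icc_self ht)]))
    rw [e1, ← integral_const_mul a⁻¹, ← integral_add j1 (j2.const_mul a⁻¹), ← integral_const_mul]
    refine Eq.trans ?_ (integral_sub j3 (g := fun t => 2 * κ * (inner ℝ (expConv 0 D t) (D t) +
      a⁻¹ * ‖D t‖ ^ 2)) ((j1.add (j2.const_mul _)).const_mul _))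
    refine integral_congr_ae (ae_timeMeasure_iff.2 (Eventually.of_forall fun t ht => ?_))
    have htI := Ioo_subset_Icc_self ht
    have e2 : b • expConv b (fun s => ι (flowIncr T u₀ u s)) t = expConv 0 D t + a⁻¹ • D t := by
      rw [hη t ht.1.le, hD, hk]
      match_scalars <;> field_simp <;> ring
    simp only
    rw [h.smul_expConv_convexForce b htI, toDualXL_apply, hy',
      h.map_smul_expConv_discrepancy hab htI, hDint t htI,
      ← expConv_zero_regForce_add hF ha hab ht.1.le, e2]
    simp only [inner_sub_left, inner_smul_left, inner_add_left, RCLike.conj_to_real,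
      real_inner_self_eq_norm_sq]
  have hen := integral_integral_norm_sq_expConv_le h.measurable_rate h.rate_nonneg h.integrable_rate
    hψ hai h.pos.le
  rw [hpair, integral_inner_primitive hDc h.pos.le] at hb1
  have hS0 : 0 ≤ S := integral_nonneg fun t => integral_nonneg fun θ => by
    have := h.rate_nonneg θ
    positivity
  have hηT2 : ‖expConv 0 D T‖ ^ 2 ≤ 16 * Y ^ 2 := by
    calc _ ≤ (4 * Y) ^ 2 := by gcongr
      _ = _ := by ring
  have hS : S ≤ 2 * (C + 1 + 16 * κ * Y ^ 2) := by
    have m1 := mul_le_mul_of_nonneg_left hDS (by linarith : 0 ≤ 2 * κ)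
    have m2 := mul_le_mul_of_nonneg_right haN hS0
    have m3 := mul_le_mul_of_nonneg_left hηT2 hκ
    change S ≤ _ at hen
    nlinarith
  refine le_trans ?_ hS
  refine integral_mono_ae i0.integral_prod_left i1.integral_prod_left ?_
  filter_upwards [i0.prod_right_ae, i1.prod_right_ae] with t h0 h1
  refine integral_mono h0 h1 fun θ => ?_
  have := h.rate_nonneg θ
  have h2 : 0 ≤ a⁻¹ * c θ := by positivity
  change ‖expConv (c θ) (regForce F a b) t‖ ^ 2 ≤
    (1 + a⁻¹ * c θ) * ‖expConv (c θ) (regForce F a b) t‖ ^ 2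
  nlinarith [sq_nonneg ‖expConv (c θ) (regForce F a b) t‖]

end IsSuperposedFlow

end APriori

/-! ### The extended state as a weak limit -/

/-- A bounded family in a Hilbert space converges weakly along some ultrafilter. -/
lemma exists_weak_limit {V : Type*} [NormedAddCommGroup V] [InnerProductSpace ℝ V]
    [CompleteSpace V] {I : Type*} {l : Filter I} [l.NeBot] {v : I → V} {R : ℝ}
    (hv : ∀ᶠ i in l, ‖v i‖ ≤ R) :
    ∃ (U : Ultrafilter I) (w : V), (U : Filter I) ≤ l ∧
      ∀ x, Tendsto (fun i => inner ℝ (v i) x) U (𝓝 (inner ℝ w x)) := by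
  set U := Ultrafilter.of l
  have hU : (U : Filter I) ≤ l := Ultrafilter.of_le l
  set L : I → WeakDual ℝ V := fun i => StrongDual.toWeakDual (InnerProductSpace.toDual ℝ V (v i))
  have hc := WeakDual.isCompact_closedBall (𝕜 := ℝ) (E := V) 0 R
  have hmem : ∀ᶠ i in (U : Filter I), L i ∈
      WeakDual.toStrongDual ⁻¹' Metric.closedBall (0 : StrongDual ℝ V) R := by
    filter_upwards [hU hv] with i hi
    simpa [L] using hi
  obtain ⟨φ, -, hφ⟩ := hc.ultrafilter_le_nhds (U.map L) (by
    rw [le_principal_iff]; exact hmem)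
  refine ⟨U, (InnerProductSpace.toDual ℝ V).symm (WeakDual.toStrongDual φ), hU, fun x => ?_⟩
  have h1 : Tendsto (fun i => L i x) U (𝓝 (φ x)) :=
    ((WeakDual.eval_continuous x).tendsto φ).comp hφ
  rw [InnerProductSpace.toDual_symm_apply]
  exact h1

section L2

variable {Θ : Type*} [MeasurableSpace Θ] {ν : Measure Θ}
  {H : Type*} [NormedAddCommGroup H] [InnerProductSpace ℝ H]

lemma L2_norm_sq_eq_integral (f : Lp H 2 ν) : ‖f‖ ^ 2 = ∫ θ, ‖f θ‖ ^ 2 ∂ν := by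
  rw [← real_inner_self_eq_norm_sq, L2.inner_def]
  simp only [real_inner_self_eq_norm_sq]

lemma integrable_inner_of_memLp {f g : Θ → H} (hf : MemLp f 2 ν) (hg : MemLp g 2 ν) :
    Integrable (fun θ => inner ℝ (f θ) (g θ)) ν := by
  refine (L2.integrable_inner (𝕜 := ℝ) (hf.toLp f) (hg.toLp g)).congr ?_
  filter_upwards [hf.coeFn_toLp, hg.coeFn_toLp] with θ h1 h2
  rw [h1, h2]

lemma memLp_two_of_norm_le_inv {c : Θ → ℝ} (hc : Measurable c) (hc0 : ∀ θ, 0 ≤ c θ)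
    (hI : Integrable (fun θ => (1 + c θ)⁻¹) ν) {B : Type*} [NormedAddCommGroup B] {f : Θ → B}
    (hf : AEStronglyMeasurable f ν) {C : ℝ} (hC : ∀ᵐ θ ∂ν, ‖f θ‖ ≤ C * (1 + c θ)⁻¹) :
    MemLp f 2 ν := by
  have h1 : MemLp (fun θ => (1 + c θ)⁻¹) 2 ν := by
    refine (memLp_two_iff_integrable_sq (f := fun θ => (1 + c θ)⁻¹)
      (hc.const_add 1).inv.aestronglyMeasurable).2 ?_
    refine hI.mono' ((hc.const_add 1).inv.pow_const 2).aestronglyMeasurable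
      (Eventually.of_forall fun θ => ?_)
    have := hc0 θ
    rw [Real.norm_of_nonneg (by positivity), pow_two]
    exact mul_le_of_le_one_left (by positivity) (inv_le_one_of_one_le₀ (by linarith))
  exact (h1.const_mul C).mono' hf hC

open Classical in
/-- The relaxation `θ ↦ K_{c(θ)} ψ (t)` as an element of `L²(ν;H)`. -/
noncomputable def expState (ν : Measure Θ) (c : Θ → ℝ) (ψ : ℝ → H) (t : ℝ) : Lp H 2 ν :=
  if h : MemLp (fun θ => expConv (c θ) ψ t) 2 ν then h.toLp else 0

variable {c : Θ → ℝ}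

lemma aestronglyMeasurable_expConv_rate {ψ : ℝ → H} (hψ : Continuous ψ) (hc : Measurable c)
    (t : ℝ) : AEStronglyMeasurable (fun θ => expConv (c θ) ψ t) ν :=
  ((stronglyMeasurable_expConv hψ hc).comp_measurable
    (measurable_const.prodMk measurable_id)).aestronglyMeasurable

lemma coeFn_expState (hc : Measurable c) (hc0 : ∀ θ, 0 ≤ c θ)
    (hI : Integrable (fun θ => (1 + c θ)⁻¹) ν) {ψ : ℝ → H} (hψ : Continuous ψ) {t : ℝ}
    (ht : 0 ≤ t) : expState ν c ψ t =ᵐ[ν] fun θ => expConv (c θ) ψ t := by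
  obtain ⟨C, -, hC⟩ := exists_norm_expConv_le hψ ht
  have h : MemLp (fun θ => expConv (c θ) ψ t) 2 ν :=
    memLp_two_of_norm_le_inv hc hc0 hI (aestronglyMeasurable_expConv_rate hψ hc t)
      (Eventually.of_forall fun θ => hC _ (hc0 θ) t ⟨ht, le_rfl⟩)
  rw [expState, dif_pos h]
  exact h.coeFn_toLp

lemma norm_sq_expState (hc : Measurable c) (hc0 : ∀ θ, 0 ≤ c θ)
    (hI : Integrable (fun θ => (1 + c θ)⁻¹) ν) {ψ : ℝ → H} (hψ : Continuous ψ) {t : ℝ}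
    (ht : 0 ≤ t) : ‖expState ν c ψ t‖ ^ 2 = ∫ θ, ‖expConv (c θ) ψ t‖ ^ 2 ∂ν := by
  rw [L2_norm_sq_eq_integral]
  refine integral_congr_ae ?_
  filter_upwards [coeFn_expState hc hc0 hI hψ ht] with θ hθ
  rw [hθ]

lemma continuousOn_expState (hc : Measurable c) (hc0 : ∀ θ, 0 ≤ c θ)
    (hI : Integrable (fun θ => (1 + c θ)⁻¹) ν) {ψ : ℝ → H} (hψ : Continuous ψ) {T : ℝ}
    (hT : 0 ≤ T) : ContinuousOn (expState ν c ψ) (Icc 0 T) := by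
  obtain ⟨C, hC0, hC⟩ := exists_norm_expConv_le hψ hT
  intro s hs
  rw [ContinuousWithinAt, tendsto_iff_norm_sub_tendsto_zero]
  have h1 : Tendsto (fun t => ∫ θ, ‖expConv (c θ) ψ t - expConv (c θ) ψ s‖ ^ 2 ∂ν) (𝓝[Icc 0 T] s)
      (𝓝 (∫ _, 0 ∂ν)) := by
    refine tendsto_integral_filter_of_dominated_convergence (fun θ => (2 * C) ^ 2 * (1 + c θ)⁻¹)
      (Eventually.of_forall fun t => ((aestronglyMeasurable_expConv_rate hψ hc t).sub
        (aestronglyMeasurable_expConv_rate hψ hc s)).norm.pow 2) ?_ (hI.const_mul _) ?_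
    · filter_upwards [self_mem_nhdsWithin] with t ht
      refine Eventually.of_forall fun θ => ?_
      have h0 := hc0 θ
      have h2 : (1 + c θ)⁻¹ ≤ 1 := inv_le_one_of_one_le₀ (by linarith)
      have h3 : 0 ≤ (1 + c θ)⁻¹ := by positivity
      rw [Real.norm_of_nonneg (by positivity)]
      calc ‖expConv (c θ) ψ t - expConv (c θ) ψ s‖ ^ 2
          ≤ (C * (1 + c θ)⁻¹ + C * (1 + c θ)⁻¹) ^ 2 := by
            gcongr
            exact (norm_sub_le _ _).trans (add_le_add (hC _ h0 t ht) (hC _ h0 s hs))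
        _ = (2 * C) ^ 2 * ((1 + c θ)⁻¹ * (1 + c θ)⁻¹) := by ring
        _ ≤ (2 * C) ^ 2 * (1 * (1 + c θ)⁻¹) := by gcongr
        _ = _ := by rw [one_mul]
    · refine Eventually.of_forall fun θ => ?_
      have h2 : Continuous fun t => ‖expConv (c θ) ψ t - expConv (c θ) ψ s‖ ^ 2 :=
        ((continuous_expConv hψ.locallyIntegrable _).sub continuous_const).norm.pow 2
      exact (h2.tendsto' s 0 (by simp)).mono_left nhdsWithin_le_nhds
  rw [integral_zero] at h1
  have h2 : ∀ t ∈ Icc 0 T, ‖expState ν c ψ t - expState ν c ψ s‖ =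
      Real.sqrt (∫ θ, ‖expConv (c θ) ψ t - expConv (c θ) ψ s‖ ^ 2 ∂ν) := by
    intro t ht
    rw [← Real.sqrt_sq (norm_nonneg (expState ν c ψ t - expState ν c ψ s)), L2_norm_sq_eq_integral]
    congr 1
    refine integral_congr_ae ?_
    filter_upwards [coeFn_expState hc hc0 hI hψ ht.1, coeFn_expState hc hc0 hI hψ hs.1,
      Lp.coeFn_sub (expState ν c ψ t) (expState ν c ψ s)] with θ h1 h2 h3
    rw [h3, Pi.sub_apply, h1, h2]
  have h3 : Tendsto (fun t => Real.sqrt (∫ θ, ‖expConv (c θ) ψ t - expConv (c θ) ψ s‖ ^ 2 ∂ν))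
      (𝓝[Icc 0 T] s) (𝓝 0) := by
    exact (Real.continuous_sqrt.tendsto' 0 0 Real.sqrt_zero).comp h1
  refine h3.congr' ?_
  filter_upwards [self_mem_nhdsWithin] with t ht using (h2 t ht).symm

lemma memLp_expState (hc : Measurable c) (hc0 : ∀ θ, 0 ≤ c θ)
    (hI : Integrable (fun θ => (1 + c θ)⁻¹) ν) {ψ : ℝ → H} (hψ : Continuous ψ) {T : ℝ}
    (hT : 0 ≤ T) : MemLp (expState ν c ψ) 2 (timeMeasure T) := by
  have hcont := continuousOn_expState hc hc0 hI hψ hT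
  obtain ⟨M, hM⟩ := isCompact_Icc.exists_bound_of_continuousOn hcont
  exact MemLp.of_bound ((hcont.mono Ioo_subset_Icc_self).aestronglyMeasurable measurableSet_Ioo) M
    (ae_timeMeasure_iff.2 (Eventually.of_forall fun t ht => hM t (Ioo_subset_Icc_self ht)))

lemma memLp_inv_smul (hc : Measurable c) (hc0 : ∀ θ, 0 ≤ c θ) {B : Type*} [NormedAddCommGroup B]
    [NormedSpace ℝ B] {f : Θ → B} (hf : MemLp f 2 ν) :
    MemLp (fun θ => (1 + c θ)⁻¹ • f θ) 2 ν := by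
  refine hf.mono ((hc.const_add 1).inv.aestronglyMeasurable.smul hf.1)
    (Eventually.of_forall fun θ => ?_)
  have := hc0 θ
  rw [norm_smul, Real.norm_of_nonneg (by positivity)]
  exact mul_le_of_le_one_left (norm_nonneg _) (inv_le_one_of_one_le₀ (by linarith))

lemma integrable_inv_mul_norm (hc : Measurable c) (hc0 : ∀ θ, 0 ≤ c θ)
    (hI : Integrable (fun θ => (1 + c θ)⁻¹) ν) {B : Type*} [NormedAddCommGroup B]
    {f : Θ → B} (hf : MemLp f 2 ν) : Integrable (fun θ => (1 + c θ)⁻¹ * ‖f θ‖) ν := by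
  refine MemLp.integrable_mul (p := 2) (q := 2) ?_ hf.norm
  refine memLp_two_of_norm_le_inv hc hc0 hI (hc.const_add 1).inv.aestronglyMeasurable (C := 1)
    (Eventually.of_forall fun θ => ?_)
  have := hc0 θ
  rw [Real.norm_of_nonneg (by positivity), one_mul]

/-- The pairing of the time integral of `K_c ψ` with a weight function. -/
lemma integral_inner_expState [CompleteSpace H] [SFinite ν] (hc : Measurable c)
    (hc0 : ∀ θ, 0 ≤ c θ)
    (hI : Integrable (fun θ => (1 + c θ)⁻¹) ν) {ψ : ℝ → H} (hψ : Continuous ψ) {t : ℝ}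
    (ht : 0 ≤ t) (w : Lp H 2 ν) :
    ∫ s, inner ℝ w (expState ν c ψ s) ∂(timeMeasure t) =
      ∫ θ, inner ℝ (w θ) (expConv (c θ) (expConv 0 ψ) t) ∂ν := by
  have e1 : ∫ s, inner ℝ w (expState ν c ψ s) ∂(timeMeasure t) =
      ∫ s, ∫ θ, inner ℝ (w θ) (expConv (c θ) ψ s) ∂ν ∂(timeMeasure t) := by
    refine integral_congr_ae (ae_timeMeasure_iff.2 (Eventually.of_forall fun s hs => ?_))
    simp only [L2.inner_def]
    refine integral_congr_ae ?_
    filter_upwards [coeFn_expState hc hc0 hI hψ hs.1.le] with θ hθ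
    rw [hθ]
  rw [e1]
  obtain ⟨C, hC0, hC⟩ := exists_norm_expConv_le hψ ht
  have hw : Integrable (fun θ => C * ((1 + c θ)⁻¹ * ‖w θ‖)) ν :=
    (integrable_inv_mul_norm hc hc0 hI (Lp.memLp w)).const_mul C
  have i1 : Integrable (fun q : ℝ × Θ => inner ℝ (w q.2) (expConv (c q.2) ψ q.1))
      ((timeMeasure t).prod ν) := by
    refine integrable_prod_of_norm_le hw ?_ fun s hs θ => ?_
    · exact (((Lp.stronglyMeasurable w).comp_measurable measurable_snd).inner
        (stronglyMeasurable_expConv hψ hc)).aestronglyMeasurable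
    · calc _ ≤ ‖w θ‖ * ‖expConv (c θ) ψ s‖ := norm_inner_le_norm _ _
        _ ≤ ‖w θ‖ * (C * (1 + c θ)⁻¹) := by
          gcongr; exact hC _ (hc0 θ) s (Ioo_subset_Icc_self hs)
        _ = _ := by ring
  refine (integral_integral_swap i1).trans ?_
  refine integral_congr_ae (Eventually.of_forall fun θ => ?_)
  have h1 : Integrable (expConv (c θ) ψ) (timeMeasure t) :=
    (locallyIntegrable_expConv hψ.locallyIntegrable _).integrable_timeMeasure t
  simp only
  rw [integral_inner h1, ← intervalIntegral_eq_timeMeasure ht, ← expConv_zero_left,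
    expConv_comm hψ.locallyIntegrable _ _ ht]

/-- The relaxation of the regularized force at the rate `d`, in terms of averages of the relaxation
of the force itself. -/
lemma expConv_expConv_zero_regForce [CompleteSpace H] {F : ℝ → H} (hF : Continuous F)
    {a b : ℝ} (hab : a < b) (d : ℝ) {t : ℝ} (ht : 0 ≤ t) :
    expConv d (expConv 0 (regForce F a b)) t =
      (b / (b - a)) • (a • expConv a (relax F d) t) -
      (a / (b - a)) • (b • expConv b (relax F d) t) := by
  have hb : b - a ≠ 0 := (sub_pos.2 hab).ne'
  have h1 : expConv d (expConv 0 (regForce F a b)) t = expConv d (fun s => (a * b / (b - a)) •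
      (relax F a s - relax F b s)) t :=
    expConv_congr ht (Eventually.of_forall fun s hs => expConv_zero_regForce hF a b hs.1.le) d
  rw [h1, expConv_smul, expConv_sub (continuous_relax hF a).locallyIntegrable
    (continuous_relax hF b).locallyIntegrable, expConv_relax_comm hF a d ht,
    expConv_relax_comm hF b d ht]
  match_scalars <;> field_simp

/-- The relaxations of the regularized force converge to those of the force. -/
lemma tendsto_expConv_regForce [CompleteSpace H] {F : ℝ → H} (hF : Continuous F) (hF0 : F 0 = 0)
    {β : ℝ → ℝ} (hβ : ∀ᶠ a in atTop, 2 * a ≤ β a) (d : ℝ) {t : ℝ} (ht : 0 ≤ t) :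
    Tendsto (fun a => expConv d (expConv 0 (regForce F a (β a))) t) atTop (𝓝 (relax F d t)) := by
  have hQ := continuous_relax hF d
  have hQ0 : relax F d 0 = 0 := by simp [relax, hF0, expConv_zero_right]
  have hβt : Tendsto β atTop atTop :=
    tendsto_atTop_mono' _ hβ (tendsto_id.const_mul_atTop (by norm_num : (0 : ℝ) < 2))
  have t1 := tendsto_smul_expConv_of_zero hQ hQ0 ht
  have t2 := t1.comp hβt
  rw [tendsto_iff_norm_sub_tendsto_zero] at t1 t2 ⊢
  have t3 := (t1.const_mul 2).add t2
  rw [mul_zero, add_zero] at t3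
  refine tendsto_of_tendsto_of_tendsto_of_le_of_le' tendsto_const_nhds t3
    (Eventually.of_forall fun _ => norm_nonneg _) ?_
  filter_upwards [hβ, eventually_ge_atTop 1] with a hab ha1
  set b := β a
  have ha : 0 < a := by linarith
  have hb : 0 < b - a := by linarith
  have e1 : expConv d (expConv 0 (regForce F a b)) t - relax F d t =
      (b / (b - a)) • (a • expConv a (relax F d) t - relax F d t) -
      (a / (b - a)) • (b • expConv b (relax F d) t - relax F d t) := by
    rw [expConv_expConv_zero_regForce hF (sub_pos.1 hb) d ht]
    match_scalars <;> field_simp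
    ring
  rw [e1]
  have n1 : b / (b - a) ≤ 2 := by rw [div_le_iff₀ hb]; linarith
  have n2 : a / (b - a) ≤ 1 := by rw [div_le_iff₀ hb]; linarith
  refine (norm_sub_le _ _).trans (add_le_add ?_ ?_)
  · rw [norm_smul, Real.norm_of_nonneg (div_nonneg (by linarith) hb.le)]
    gcongr
  · rw [norm_smul, Real.norm_of_nonneg (by positivity)]
    exact mul_le_of_le_one_left (norm_nonneg _) n2

lemma exists_norm_relax_le {F : ℝ → H} (hF : Continuous F) {T : ℝ} (hT : 0 ≤ T) :
    ∃ M, 0 ≤ M ∧ ∀ a, 0 ≤ a → ∀ t ∈ Icc 0 T, ‖relax F a t‖ ≤ M := by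
  obtain ⟨M, hM⟩ := (isCompact_Icc (a := 0) (b := T)).exists_bound_of_continuousOn hF.continuousOn
  have hM0 : 0 ≤ M := (norm_nonneg _).trans (hM 0 ⟨le_rfl, hT⟩)
  refine ⟨M + M, by positivity, fun a ha t ht => (norm_sub_le _ _).trans (add_le_add (hM t ht) ?_)⟩
  rw [norm_smul, Real.norm_of_nonneg ha]
  exact norm_smul_expConv_le hF.locallyIntegrable ha hM0 ht.1
    (Eventually.of_forall fun s hs => hM s ⟨hs.1.le, hs.2.le.trans ht.2⟩)

/-- A crude bound, uniform in the regularization. -/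
lemma norm_expConv_expConv_regForce_le [CompleteSpace H] {F : ℝ → H} (hF : Continuous F)
    {M T : ℝ} (hM0 : 0 ≤ M) (hM : ∀ a, 0 ≤ a → ∀ t ∈ Icc 0 T, ‖relax F a t‖ ≤ M) {a b d t : ℝ}
    (ha : 0 < a) (hab : 2 * a ≤ b) (hd : 0 ≤ d) (ht : t ∈ Icc 0 T) :
    ‖expConv d (expConv 0 (regForce F a b)) t‖ ≤ 3 * M := by
  have hb : 0 < b - a := by linarith
  have hb' : ∀ᵐ s, s ∈ Ioo 0 t → ‖relax F d s‖ ≤ M :=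
    Eventually.of_forall fun s hs => hM d hd s ⟨hs.1.le, hs.2.le.trans ht.2⟩
  have n1 := norm_smul_expConv_le (continuous_relax hF d).locallyIntegrable ha.le hM0 ht.1 hb'
  have n2 := norm_smul_expConv_le (continuous_relax hF d).locallyIntegrable
    (by linarith : 0 ≤ b) hM0 ht.1 hb'
  rw [expConv_expConv_zero_regForce hF (sub_pos.1 hb) d ht.1]
  have m1 : b / (b - a) ≤ 2 := by rw [div_le_iff₀ hb]; linarith
  have m2 : a / (b - a) ≤ 1 := by rw [div_le_iff₀ hb]; linarith
  have k1 : ‖(b / (b - a)) • (a • expConv a (relax F d) t)‖ ≤ 2 * M := by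
    rw [norm_smul, norm_smul, Real.norm_of_nonneg (div_nonneg (by linarith) hb.le),
      Real.norm_of_nonneg ha.le]
    exact mul_le_mul m1 n1 (by positivity) (by norm_num)
  have k2 : ‖(a / (b - a)) • (b • expConv b (relax F d) t)‖ ≤ 1 * M := by
    rw [norm_smul, norm_smul, Real.norm_of_nonneg (by positivity),
      Real.norm_of_nonneg (by linarith)]
    exact mul_le_mul m2 n2 (mul_nonneg (by linarith) (norm_nonneg _)) (by norm_num)
  linarith [norm_sub_le ((b / (b - a)) • (a • expConv a (relax F d) t))
    ((a / (b - a)) • (b • expConv b (relax F d) t))]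

lemma aestronglyMeasurable_relax_rate {F : ℝ → H} (hF : Continuous F) (hc : Measurable c)
    (t : ℝ) : AEStronglyMeasurable (fun θ => relax F (c θ) t) ν :=
  aestronglyMeasurable_const.sub
    (hc.aestronglyMeasurable.smul (aestronglyMeasurable_expConv_rate hF hc t))

/-- Functions `f` of `L²(ν;H)` are determined by their pairings with `ψ / (1 + c)`. -/
lemma ae_eq_of_forall_integral_inner (hc : Measurable c) (hc0 : ∀ θ, 0 ≤ c θ)
    (hI : Integrable (fun θ => (1 + c θ)⁻¹) ν) (f : Lp H 2 ν) {g : Θ → H}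
    (hg : AEStronglyMeasurable g ν) {M : ℝ} (hM : ∀ θ, ‖g θ‖ ≤ M)
    (h : ∀ w : Lp H 2 ν, (∃ x : Lp H 2 ν, w =ᵐ[ν] fun θ => (1 + c θ)⁻¹ • x θ) →
      inner ℝ w f = ∫ θ, inner ℝ (w θ) (g θ) ∂ν) : f =ᵐ[ν] g := by
  have h1 : MemLp (fun θ => (1 + c θ)⁻¹ • f θ) 2 ν := memLp_inv_smul hc hc0 (Lp.memLp f)
  have h2 : MemLp (fun θ => (1 + c θ)⁻¹ • g θ) 2 ν := by
    refine memLp_two_of_norm_le_inv hc hc0 hI ((hc.const_add 1).inv.aestronglyMeasurable.smul hg)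
      (C := M) (Eventually.of_forall fun θ => ?_)
    have := hc0 θ
    rw [norm_smul, Real.norm_of_nonneg (by positivity), mul_comm]
    gcongr
    exact hM θ
  set x : Lp H 2 ν := (h1.sub h2).toLp _
  have hx : x =ᵐ[ν] fun θ => (1 + c θ)⁻¹ • f θ - (1 + c θ)⁻¹ • g θ := (h1.sub h2).coeFn_toLp
  have hw := memLp_inv_smul hc hc0 (Lp.memLp x)
  have h3 := h (hw.toLp _) ⟨x, hw.coeFn_toLp⟩
  rw [L2.inner_def] at h3
  have e1 : ∫ θ, inner ℝ ((hw.toLp _ : Lp H 2 ν) θ) (f θ) ∂ν =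
      ∫ θ, inner ℝ (x θ) ((1 + c θ)⁻¹ • f θ) ∂ν := by
    refine integral_congr_ae ?_
    filter_upwards [hw.coeFn_toLp] with θ hθ
    rw [hθ, inner_smul_left, inner_smul_right, RCLike.conj_to_real]
  have e2 : ∫ θ, inner ℝ ((hw.toLp _ : Lp H 2 ν) θ) (g θ) ∂ν =
      ∫ θ, inner ℝ (x θ) ((1 + c θ)⁻¹ • g θ) ∂ν := by
    refine integral_congr_ae ?_
    filter_upwards [hw.coeFn_toLp] with θ hθ
    rw [hθ, inner_smul_left, inner_smul_right, RCLike.conj_to_real]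
  rw [e1, e2, ← sub_eq_zero, ← integral_sub (integrable_inner_of_memLp (Lp.memLp x) h1)
    (integrable_inner_of_memLp (Lp.memLp x) h2)] at h3
  have h4 : ‖x‖ ^ 2 = 0 := by
    rw [L2_norm_sq_eq_integral, ← h3]
    refine integral_congr_ae ?_
    filter_upwards [hx] with θ hθ
    rw [← inner_sub_right, ← hθ, real_inner_self_eq_norm_sq]
  have h5 : x = 0 := norm_eq_zero.1 (pow_eq_zero_iff two_ne_zero |>.1 h4)
  rw [h5] at hx
  filter_upwards [hx, Lp.coeFn_zero H 2 ν] with θ hθ h0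
  rw [h0, Pi.zero_apply, ← smul_sub, eq_comm, smul_eq_zero] at hθ
  have := hc0 θ
  exact sub_eq_zero.1 (hθ.resolve_left (by positivity))

end L2

section Limit

variable {X H : Type*} [NormedAddCommGroup X] [NormedSpace ℝ X] [CompleteSpace X]
  [NormedAddCommGroup H] [InnerProductSpace ℝ H] [CompleteSpace H]
  {Θ : Type*} [MeasurableSpace Θ] {ν : Measure Θ} {c : Θ → ℝ} [SFinite ν]
  {ι : X →L[ℝ] H} {E : X → ℝ} {p T κ : ℝ} {u₀ : X} {u : ℝ → X} {F : ℝ → H}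

/-- The extended state `K_c F'` has a derivative in `L²(0,T;L²(ν;H))`: the derivatives of the
regularized states are bounded there, and the weak limit is identified through its time integral,
for which the regularized states converge pointwise in `θ`. -/
theorem IsSuperposedFlow.exists_derivative (h : IsSuperposedFlow ν c ι E p T κ u₀ u F) :
    ∃ V : ℝ → Lp H 2 ν, MemLp V 2 (timeMeasure T) ∧
      ∀ t ∈ Icc 0 T, (∫ s in (0 : ℝ)..t, V s : Lp H 2 ν) =ᵐ[ν] fun θ => relax F (c θ) t := by
  obtain ⟨C, hC⟩ := h.exists_bound_regForce
  have hc := h.measurable_rate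
  have hc0 := h.rate_nonneg
  have hI := h.integrable_rate
  have hF := h.continuous_primitive
  classical
  obtain ⟨β, hβ⟩ : ∃ β : ℝ → ℝ, ∀ᶠ a : ℝ in atTop, 2 * a ≤ β a ∧
      ∫ t, ∫ θ, ‖expConv (c θ) (regForce F a (β a)) t‖ ^ 2 ∂ν ∂(timeMeasure T) ≤ C := by
    refine ⟨fun a => if h : ∃ b, 2 * a ≤ b ∧ ∫ t, ∫ θ, ‖expConv (c θ) (regForce F a b) t‖ ^ 2 ∂ν
      ∂(timeMeasure T) ≤ C then h.choose else 0, ?_⟩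
    filter_upwards [hC] with a ha
    rw [dif_pos ha]
    exact ha.choose_spec
  set W : ℝ → Lp (Lp H 2 ν) 2 (timeMeasure T) := fun a =>
    (memLp_expState hc hc0 hI (continuous_regForce hF a (β a)) h.pos.le).toLp _ with hW
  have hWcoe : ∀ a, W a =ᵐ[timeMeasure T] expState ν c (regForce F a (β a)) := fun a =>
    MemLp.coeFn_toLp _
  have hWn : ∀ᶠ a in atTop, ‖W a‖ ≤ Real.sqrt C := by
    filter_upwards [hβ] with a ha
    refine Real.le_sqrt_of_sq_le ?_
    rw [L2_norm_sq_eq_integral]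
    refine le_trans (le_of_eq ?_) ha.2
    refine integral_congr_ae ?_
    filter_upwards [hWcoe a, ae_restrict_mem measurableSet_Ioo] with t ht htT
    rw [ht, norm_sq_expState hc hc0 hI (continuous_regForce hF a (β a)) htT.1.le]
  obtain ⟨U, V, hU, hV⟩ := exists_weak_limit hWn
  obtain ⟨M, hM0, hM⟩ := exists_norm_relax_le hF h.pos.le
  refine ⟨V, Lp.memLp V, fun t ht => ?_⟩
  refine ae_eq_of_forall_integral_inner hc hc0 hI _ (aestronglyMeasurable_relax_rate hF hc t)
    (fun θ => hM _ (hc0 θ) t ht) ?_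
  rintro w ⟨x, hwx⟩
  have hm : (timeMeasure T).restrict (Ioo 0 t) = timeMeasure t := by
    rw [timeMeasure, timeMeasure, Measure.restrict_restrict measurableSet_Ioo,
      inter_eq_left.2 (Ioo_subset_Ioo_right ht.2)]
  -- both limits of the pairing of `W a` with `w` on `(0, t)` are computed
  set S : Lp (Lp H 2 ν) 2 (timeMeasure T) :=
    indicatorConstLp 2 measurableSet_Ioo (measure_ne_top _ (Ioo 0 t)) w
  have h1 := (hV S)
  have hWS : ∀ a, inner ℝ (W a) S =
      ∫ θ, inner ℝ (w θ) (expConv (c θ) (expConv 0 (regForce F a (β a))) t) ∂ν := by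
    intro a
    rw [real_inner_comm, L2.inner_indicatorConstLp_eq_setIntegral_inner, hm,
      ← integral_inner_expState hc hc0 hI (continuous_regForce hF a (β a)) ht.1]
    refine integral_congr_ae ?_
    have : ∀ᵐ s ∂(timeMeasure t), W a s = expState ν c (regForce F a (β a)) s := by
      rw [← hm]; exact ae_restrict_of_ae (hWcoe a)
    filter_upwards [this] with s hs
    rw [hs]
  have hVS : inner ℝ V S = inner ℝ w (∫ s in (0 : ℝ)..t, V s) := by
    rw [real_inner_comm, L2.inner_indicatorConstLp_eq_inner_setIntegral ℝ, hm,
      intervalIntegral_eq_timeMeasure ht.1]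
  have hwI : Integrable (fun θ => ‖w θ‖) ν := by
    refine (integrable_inv_mul_norm hc hc0 hI (Lp.memLp x)).congr ?_
    filter_upwards [hwx] with θ hθ
    have := hc0 θ
    rw [hθ, norm_smul, Real.norm_of_nonneg (by positivity)]
  have h2 : Tendsto (fun a => inner ℝ (W a) S) atTop
      (𝓝 (∫ θ, inner ℝ (w θ) (relax F (c θ) t) ∂ν)) := by
    simp only [hWS]
    refine tendsto_integral_filter_of_dominated_convergence (fun θ => ‖w θ‖ * (3 * M))
      (Eventually.of_forall fun a => ?_) ?_ (hwI.mul_const _) ?_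
    · exact (Lp.aestronglyMeasurable w).inner (aestronglyMeasurable_expConv_rate
        (continuous_expConv (continuous_regForce hF a (β a)).locallyIntegrable 0) hc t)
    · filter_upwards [hβ, eventually_gt_atTop 0] with a ha ha0
      refine Eventually.of_forall fun θ => (norm_inner_le_norm _ _).trans ?_
      gcongr
      exact norm_expConv_expConv_regForce_le hF hM0 hM ha0 ha.1 (hc0 θ) ht
    · refine Eventually.of_forall fun θ => Tendsto.inner tendsto_const_nhds ?_
      exact tendsto_expConv_regForce hF h.primitive_zero (hβ.mono fun _ h => h.1) _ ht.1
  rw [← hVS]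
  exact tendsto_nhds_unique h1 (h2.mono_left hU)

end Limit

/-! ### The chain rule for semiconvex energies -/

lemma intervalIntegrable_of_integrable_timeMeasure {B : Type*} [NormedAddCommGroup B] {z : ℝ → B}
    {T : ℝ} (hz : Integrable z (timeMeasure T)) {s t : ℝ} (hs : s ∈ Icc 0 T) (ht : t ∈ Icc 0 T) :
    IntervalIntegrable z volume s t := by
  have h1 : IntegrableOn z (Icc 0 T) volume := (integrableOn_Icc_iff_integrableOn_Ioo).2 hz
  exact (h1.mono_set (uIcc_subset_Icc hs ht)).intervalIntegrable

lemma MeasureTheory.MemLp.integrable_norm_sq {B : Type*} [NormedAddCommGroup B] {α : Type*}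
    [MeasurableSpace α]
    {m : Measure α} {z : α → B} (hz : MemLp z 2 m) : Integrable (fun t => ‖z t‖ ^ 2) m := by
  simpa using hz.integrable_norm_pow two_ne_zero

lemma integrable_of_memLp_two {B : Type*} [NormedAddCommGroup B] {z : ℝ → B} {T : ℝ}
    (hz : MemLp z 2 (timeMeasure T)) : Integrable z (timeMeasure T) :=
  hz.integrable (by norm_num)

lemma continuousOn_primitive_timeMeasure {B : Type*} [NormedAddCommGroup B] [NormedSpace ℝ B]
    {z : ℝ → B} {T : ℝ} (hT : 0 ≤ T) (hz : Integrable z (timeMeasure T)) :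
    ContinuousOn (fun t => ∫ s in (0 : ℝ)..t, z s) (Icc 0 T) := by
  have h1 := intervalIntegral.continuousOn_primitive_interval' (b₁ := 0) (b₂ := T)
    (intervalIntegrable_of_integrable_timeMeasure hz ⟨le_rfl, hT⟩ ⟨hT, le_rfl⟩) left_mem_uIcc
  rwa [uIcc_of_le hT] at h1

lemma tendsto_primitive_zero {B : Type*} [NormedAddCommGroup B] [NormedSpace ℝ B] {z : ℝ → B}
    {T : ℝ} (hT : 0 < T) (hz : Integrable z (timeMeasure T)) :
    Tendsto (fun t => ∫ s in (0 : ℝ)..t, z s) (𝓝[>] 0) (𝓝 0) := by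
  have h2 := continuousOn_primitive_timeMeasure hT.le hz 0 ⟨le_rfl, hT.le⟩
  rw [ContinuousWithinAt, intervalIntegral.integral_same] at h2
  refine h2.mono_left ?_
  rw [← nhdsWithin_Ioc_eq_nhdsGT hT]
  exact nhdsWithin_mono _ Ioc_subset_Icc_self

lemma memLp_two_primitive {K : Type*} [NormedAddCommGroup K] [NormedSpace ℝ K] {V : ℝ → K} {T : ℝ}
    (hT : 0 < T) (hV : Integrable V (timeMeasure T)) :
    MemLp (fun t => ∫ s in (0 : ℝ)..t, V s) 2 (timeMeasure T) := by
  have h1 := continuousOn_primitive_timeMeasure hT.le hV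
  obtain ⟨M, hM⟩ := isCompact_Icc.exists_bound_of_continuousOn h1
  exact MemLp.of_bound ((h1.mono Ioo_subset_Icc_self).aestronglyMeasurable measurableSet_Ioo) M
    (ae_timeMeasure_iff.2 (Eventually.of_forall fun t ht => hM t (Ioo_subset_Icc_self ht)))

/-- Two integrable functions with the same primitive agree almost everywhere. -/
lemma ae_eq_of_primitive_eq {B : Type*} [NormedAddCommGroup B] [NormedSpace ℝ B] [CompleteSpace B]
    {T : ℝ} (hT : 0 < T) {f g : ℝ → B} (hf : Integrable f (timeMeasure T))
    (hg : Integrable g (timeMeasure T))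
    (h : ∀ t ∈ Icc 0 T, ∫ s in (0 : ℝ)..t, f s = ∫ s in (0 : ℝ)..t, g s) :
    f =ᵐ[timeMeasure T] g := by
  have h0 : (0 : ℝ) ∈ Icc 0 T := ⟨le_rfl, hT.le⟩
  have hTT : T ∈ Icc 0 T := ⟨hT.le, le_rfl⟩
  refine ae_timeMeasure_iff.2 ?_
  filter_upwards [(intervalIntegrable_of_integrable_timeMeasure hf h0 hTT).ae_hasDerivAt_integral,
    (intervalIntegrable_of_integrable_timeMeasure hg h0 hTT).ae_hasDerivAt_integral] with t h1 h2 ht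
  have ht' : t ∈ uIcc 0 T := by rw [uIcc_of_le hT.le]; exact Ioo_subset_Icc_self ht
  refine (h1 ht' 0 left_mem_uIcc).unique ((h2 ht' 0 left_mem_uIcc).congr_of_eventuallyEq ?_)
  filter_upwards [Ioo_mem_nhds ht.1 ht.2] with s hs using h s (Ioo_subset_Icc_self hs)

lemma sq_intervalIntegral_le {g : ℝ → ℝ} {s t : ℝ} (hst : s ≤ t)
    (hg : IntervalIntegrable g volume s t)
    (hg2 : IntervalIntegrable (fun r => g r ^ 2) volume s t) :
    (∫ r in s..t, g r) ^ 2 ≤ (t - s) * ∫ r in s..t, g r ^ 2 := by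
  rcases hst.eq_or_lt with rfl | hst'
  · simp
  set m := (∫ r in s..t, g r) / (t - s)
  have hpos : 0 < t - s := sub_pos.2 hst'
  have h1 : 0 ≤ ∫ r in s..t, (g r - m) ^ 2 :=
    intervalIntegral.integral_nonneg hst fun r _ => sq_nonneg _
  have h2 : ∫ r in s..t, (g r - m) ^ 2 =
      (∫ r in s..t, g r ^ 2) - 2 * m * (∫ r in s..t, g r) + m ^ 2 * (t - s) := by
    have e : ∀ r, (g r - m) ^ 2 = g r ^ 2 - 2 * m * g r + m ^ 2 := fun r => by ring
    simp only [e]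
    rw [intervalIntegral.integral_add (hg2.sub (hg.const_mul _)) (by simp),
      intervalIntegral.integral_sub hg2 (hg.const_mul _), intervalIntegral.integral_const_mul]
    simp; ring
  have h3 : (∫ r in s..t, g r) = m * (t - s) := by
    simp only [m]; field_simp
  rw [h2, h3] at h1
  rw [h3]
  nlinarith

/-- The Hölder estimate for the primitive `U` of a square integrable function `V`. -/
lemma norm_sq_primitive_sub_le {K : Type*} [NormedAddCommGroup K] [NormedSpace ℝ K]
    {V : ℝ → K} {T : ℝ} (hV : MemLp V 2 (timeMeasure T)) {s t : ℝ} (hs : s ∈ Icc 0 T)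
    (ht : t ∈ Icc 0 T) (hst : s ≤ t) :
    ‖(∫ r in (0 : ℝ)..t, V r) - ∫ r in (0 : ℝ)..s, V r‖ ^ 2 ≤
      (t - s) * ((∫ r in (0 : ℝ)..t, ‖V r‖ ^ 2) - ∫ r in (0 : ℝ)..s, ‖V r‖ ^ 2) := by
  have h0 : (0 : ℝ) ∈ Icc 0 T := ⟨le_rfl, hs.1.trans hs.2⟩
  have i1 : ∀ {a b : ℝ}, a ∈ Icc 0 T → b ∈ Icc 0 T → IntervalIntegrable V volume a b :=
    intervalIntegrable_of_integrable_timeMeasure (integrable_of_memLp_two hV)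
  have i2 : ∀ {a b : ℝ}, a ∈ Icc 0 T → b ∈ Icc 0 T →
      IntervalIntegrable (fun r => ‖V r‖ ^ 2) volume a b :=
    intervalIntegrable_of_integrable_timeMeasure (MemLp.integrable_norm_sq hV)
  rw [intervalIntegral.integral_interval_sub_left (i1 h0 ht) (i1 h0 hs),
    intervalIntegral.integral_interval_sub_left (i2 h0 ht) (i2 h0 hs)]
  refine le_trans ?_ (sq_intervalIntegral_le hst (i1 hs ht).norm (i2 hs ht))
  gcongr
  exact intervalIntegral.norm_integral_le_integral_norm hst

/-- The composition of a nonexpansive function with an absolutely continuous one. -/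
lemma AbsolutelyContinuousOnInterval.lipschitz_comp {g W : ℝ → ℝ} {a b : ℝ}
    (hW : AbsolutelyContinuousOnInterval W a b) (hg : LipschitzWith 1 g) :
    AbsolutelyContinuousOnInterval (fun t => g (W t)) a b := by
  refine squeeze_zero (fun _ => Finset.sum_nonneg fun _ _ => dist_nonneg)
    (fun _ => Finset.sum_le_sum fun _ _ => ?_) hW
  simpa using hg.dist_le_mul _ _

/-- If the increments of `ψ` over short intervals are bounded below by those of `-∫ w`, in the
averaged form that the subgradient inequality provides, then the same holds for all increments
between points at which `ψ` is the derivative of its primitive. -/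
lemma neg_integral_le_sub_of_short_increments {w ψ : ℝ → ℝ} {T M e : ℝ} (hw : Integrable w)
    (hψ : Integrable ψ)
    (h : ∀ r : ℝ, 0 < r → ∀ᵐ s, s ∈ Ioo 0 T → s + r ∈ Ioo 0 T →
      -(r / 2 * w (s + e * r)) - (1 / 2 + M * r) * (∫ x in s..(s + r), w x) ≤ ψ (s + r) - ψ s)
    {a b : ℝ} (ha : a ∈ Ioo 0 T) (hb : b ∈ Ioo 0 T) (hab : a < b)
    (hda : HasDerivAt (fun t => ∫ s in (0 : ℝ)..t, ψ s) (ψ a) a)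
    (hdb : HasDerivAt (fun t => ∫ s in (0 : ℝ)..t, ψ s) (ψ b) b) :
    -(∫ x in a..b, w x) ≤ ψ b - ψ a := by
  set W : ℝ → ℝ := fun t => ∫ x in (0 : ℝ)..t, w x with hWdef
  have hWc : Continuous W := intervalIntegral.continuous_primitive
    (fun _ _ => hw.intervalIntegrable) 0
  have hWsub : ∀ s t, ∫ x in s..t, w x = W t - W s := fun s t =>
    (intervalIntegral.integral_interval_sub_left hw.intervalIntegrable hw.intervalIntegrable).symm
  set P : ℝ → ℝ := fun t => ∫ s in (0 : ℝ)..t, ψ s with hPdef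
  set R : ℝ → ℝ := fun t => ∫ s in (0 : ℝ)..t, W s with hRdef
  have hR : ∀ t, HasDerivAt R (W t) t := fun t => hWc.integral_hasStrictDerivAt 0 t |>.hasDerivAt
  -- the integral over `s ∈ (a, b)` of the inequality for a shift `r`, divided by `r`
  have key : ∀ r : ℝ, 0 < r → b + r < T →
      -(1 / 2 * (W (b + e * r) - W (a + e * r))) -
        (1 / 2 + M * r) * (r⁻¹ • (R (b + r) - R b) - r⁻¹ • (R (a + r) - R a)) ≤
        r⁻¹ • (P (b + r) - P b) - r⁻¹ • (P (a + r) - P a) := by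
    intro r hr hbr
    have shift : ∀ (g : ℝ → ℝ) (d : ℝ), ∫ s in a..b, g (s + d) = ∫ s in (a + d)..(b + d), g s :=
      fun g d => intervalIntegral.integral_comp_add_right g d
    have iw : IntervalIntegrable (fun s => w (s + e * r)) volume a b :=
      (hw.comp_add_right _).intervalIntegrable
    have iψ : IntervalIntegrable (fun s => ψ (s + r)) volume a b :=
      (hψ.comp_add_right _).intervalIntegrable
    have iW : IntervalIntegrable (fun s => W (s + r)) volume a b :=
      (hWc.comp (continuous_id.add continuous_const)).intervalIntegrable _ _
    have h1 : ∫ s in a..b, (-(r / 2 * w (s + e * r)) - (1 / 2 + M * r) * (W (s + r) - W s)) ≤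
        ∫ s in a..b, (ψ (s + r) - ψ s) := by
      refine intervalIntegral.integral_mono_ae_restrict hab.le
        (((iw.const_mul _).neg).sub ((iW.sub (hWc.intervalIntegrable _ _)).const_mul _))
        (iψ.sub hψ.intervalIntegrable) ?_
      refine (ae_restrict_iff' measurableSet_Icc).2 ?_
      filter_upwards [h r hr] with s hs hsab
      have := hs ⟨ha.1.trans_le hsab.1, hsab.2.trans_lt hb.2⟩
        ⟨by linarith [ha.1, hsab.1], by linarith [hsab.2]⟩
      rwa [hWsub] at this
    have e1 : ∫ s in a..b, (ψ (s + r) - ψ s) = (P (b + r) - P b) - (P (a + r) - P a) := by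
      rw [intervalIntegral.integral_sub iψ hψ.intervalIntegrable, shift,
        ← intervalIntegral.integral_interval_sub_left (a := 0) hψ.intervalIntegrable
          hψ.intervalIntegrable,
        ← intervalIntegral.integral_interval_sub_left (a := 0) (b := b) hψ.intervalIntegrable
          hψ.intervalIntegrable]
      simp only [hPdef]; ring
    have e2 : ∫ s in a..b, (W (s + r) - W s) = (R (b + r) - R b) - (R (a + r) - R a) := by
      rw [intervalIntegral.integral_sub iW (hWc.intervalIntegrable _ _), shift,
        ← intervalIntegral.integral_interval_sub_left (a := 0) (hWc.intervalIntegrable _ _)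
          (hWc.intervalIntegrable _ _),
        ← intervalIntegral.integral_interval_sub_left (a := 0) (b := b)
          (hWc.intervalIntegrable _ _) (hWc.intervalIntegrable _ _)]
      simp only [hRdef]; ring
    rw [e1, intervalIntegral.integral_sub (f := fun s => -(r / 2 * w (s + e * r)))
      (g := fun s => (1 / 2 + M * r) * (W (s + r) - W s)) (iw.const_mul _).neg
      ((iW.sub (hWc.intervalIntegrable _ _)).const_mul _), intervalIntegral.integral_neg,
      intervalIntegral.integral_const_mul, intervalIntegral.integral_const_mul, e2, shift,
      hWsub] at h1
    have h2 := mul_le_mul_of_nonneg_left h1 (inv_nonneg.2 hr.le)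
    simp only [smul_eq_mul]
    refine le_trans (le_of_eq ?_) (h2.trans (le_of_eq ?_)) <;> field_simp
  have tend : ∀ {g : ℝ → ℝ} {g' x : ℝ}, HasDerivAt g g' x →
      Tendsto (fun r => r⁻¹ • (g (x + r) - g x)) (𝓝[>] 0) (𝓝 g') := fun hg =>
    hg.tendsto_slope_zero.mono_left (nhdsWithin_mono _ fun x hx => ne_of_gt hx)
  have tW : ∀ x, Tendsto (fun r => W (x + e * r)) (𝓝[>] 0) (𝓝 (W x)) := fun x => by
    have : Continuous fun r => W (x + e * r) := by fun_prop
    simpa using (this.tendsto 0).mono_left nhdsWithin_le_nhds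
  have tM : Tendsto (fun r : ℝ => 1 / 2 + M * r) (𝓝[>] 0) (𝓝 (1 / 2)) := by
    have : Continuous fun r : ℝ => 1 / 2 + M * r := by fun_prop
    simpa using (this.tendsto 0).mono_left nhdsWithin_le_nhds
  have lim := le_of_tendsto_of_tendsto
    ((((tW b).sub (tW a)).const_mul (1 / 2)).neg.sub (tM.mul ((tend (hR b)).sub (tend (hR a)))))
    ((tend hdb).sub (tend hda)) (by
      filter_upwards [Ioo_mem_nhdsGT (sub_pos.2 hb.2)] with r hr
      exact key r hr.1 (by linarith [hr.2]))
  rw [hWsub]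
  linarith

lemma intervalIntegral_indicator_Ioo {B : Type*} [NormedAddCommGroup B] [NormedSpace ℝ B]
    (f : ℝ → B) {T s t : ℝ} (hs : s ∈ Icc 0 T) (ht : t ∈ Icc 0 T) :
    ∫ x in s..t, (Ioo 0 T).indicator f x = ∫ x in s..t, f x := by
  refine intervalIntegral.integral_congr_ae ?_
  filter_upwards [compl_mem_ae_iff.2 (measure_singleton (0 : ℝ)),
    compl_mem_ae_iff.2 (measure_singleton T)] with x h0 h1 hx
  have hx' := uIcc_subset_Icc hs ht (uIoc_subset_uIcc hx)
  have hxT : x ∈ Ioo 0 T := ⟨lt_of_le_of_ne hx'.1 (Ne.symm h0), lt_of_le_of_ne hx'.2 h1⟩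
  exact indicator_of_mem hxT _

section ChainRule

variable {K : Type*} [NormedAddCommGroup K] [InnerProductSpace ℝ K]

/-- Along a curve `U` with `U' = V` square integrable, a subgradient inequality with subgradient
`-V` bounds the increments of the energy `ψ` by those of `∫ ‖V‖²`. -/
lemma abs_sub_le_of_subgradient {V : ℝ → K} {ψ : ℝ → ℝ} {T M : ℝ} (hM : 0 ≤ M)
    (hV : MemLp V 2 (timeMeasure T)) (hψ : Integrable ψ (timeMeasure T)) {G : Set ℝ}
    (hG : ∀ᵐ t ∂(timeMeasure T), t ∈ G)
    (hsub : ∀ s ∈ G, ∀ t ∈ G,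
      -inner ℝ (V s) ((∫ r in (0 : ℝ)..t, V r) - ∫ r in (0 : ℝ)..s, V r) -
        M * ‖(∫ r in (0 : ℝ)..t, V r) - ∫ r in (0 : ℝ)..s, V r‖ ^ 2 ≤ ψ t - ψ s)
    {a b : ℝ} (ha : a ∈ Ioo 0 T) (hb : b ∈ Ioo 0 T) (hab : a < b)
    (hda : HasDerivAt (fun t => ∫ s in (0 : ℝ)..t, (Ioo 0 T).indicator ψ s) (ψ a) a)
    (hdb : HasDerivAt (fun t => ∫ s in (0 : ℝ)..t, (Ioo 0 T).indicator ψ s) (ψ b) b) :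
    |ψ b - ψ a| ≤ ∫ x in a..b, ‖V x‖ ^ 2 := by
  have hψ' : Integrable ((Ioo 0 T).indicator ψ) := (integrable_indicator_iff measurableSet_Ioo).2 hψ
  have hw' : Integrable ((Ioo 0 T).indicator fun x => ‖V x‖ ^ 2) :=
    (integrable_indicator_iff measurableSet_Ioo).2 (MemLp.integrable_norm_sq hV)
  have hG' := ae_timeMeasure_iff.1 hG
  have hGr : ∀ r : ℝ, ∀ᵐ s, s + r ∈ Ioo 0 T → s + r ∈ G := fun r =>
    (measurePreserving_add_right volume r).quasiMeasurePreserving.ae hG'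
  -- Cauchy–Schwarz and the Hölder bound for increments of `U`
  have cs : ∀ r : ℝ, 0 < r → ∀ s, s ∈ Ioo 0 T → s + r ∈ Ioo 0 T → ∀ v : K, ∀ d : K,
      ‖d‖ = ‖(∫ x in (0 : ℝ)..(s + r), V x) - ∫ x in (0 : ℝ)..s, V x‖ →
      -(r / 2 * ‖v‖ ^ 2) - (1 / 2 + M * r) *
        (∫ x in s..(s + r), (Ioo 0 T).indicator (fun x => ‖V x‖ ^ 2) x) ≤
      -inner ℝ v d - M * ‖d‖ ^ 2 := by
    intro r hr s hs hsr v d hd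
    have h1 := norm_sq_primitive_sub_le hV (Ioo_subset_Icc_self hs) (Ioo_subset_Icc_self hsr)
      (by linarith)
    have h0 : (0 : ℝ) ∈ Icc 0 T := ⟨le_rfl, (hs.1.trans hs.2).le⟩
    have i2 : ∀ {a b : ℝ}, a ∈ Icc 0 T → b ∈ Icc 0 T →
        IntervalIntegrable (fun r => ‖V r‖ ^ 2) volume a b :=
      intervalIntegrable_of_integrable_timeMeasure (MemLp.integrable_norm_sq hV)
    rw [intervalIntegral.integral_interval_sub_left (i2 h0 (Ioo_subset_Icc_self hsr))
      (i2 h0 (Ioo_subset_Icc_self hs)), ← hd, add_sub_cancel_left] at h1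
    rw [intervalIntegral_indicator_Ioo _ (Ioo_subset_Icc_self hs) (Ioo_subset_Icc_self hsr)]
    set I := ∫ x in s..(s + r), ‖V x‖ ^ 2
    have h2 : inner ℝ v d ≤ r / 2 * ‖v‖ ^ 2 + 1 / 2 * I := by
      have h3 := real_inner_le_norm v d
      have h4 : ‖v‖ * ‖d‖ ≤ r / 2 * ‖v‖ ^ 2 + 1 / (2 * r) * ‖d‖ ^ 2 := by
        have : 0 ≤ (r * ‖v‖ - ‖d‖) ^ 2 / (2 * r) := by positivity
        have e : (r * ‖v‖ - ‖d‖) ^ 2 / (2 * r) =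
          r / 2 * ‖v‖ ^ 2 + 1 / (2 * r) * ‖d‖ ^ 2 - ‖v‖ * ‖d‖ := by field_simp; ring
        linarith
      have h5 : 1 / (2 * r) * ‖d‖ ^ 2 ≤ 1 / (2 * r) * (r * I) := by gcongr
      have h6 : 1 / (2 * r) * (r * I) = 1 / 2 * I := by field_simp
      linarith
    have h7 : M * ‖d‖ ^ 2 ≤ M * (r * I) := by gcongr
    linarith
  have ind : ∀ {f : ℝ → ℝ} {x : ℝ}, x ∈ Ioo 0 T → (Ioo 0 T).indicator f x = f x := fun hx =>
    indicator_of_mem hx _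
  -- the subgradient inequality from `s` to `s + r`, and the one from `s + r` to `s`
  have lower := neg_integral_le_sub_of_short_increments (M := M) (e := 0) hw' hψ' (by
    intro r hr
    filter_upwards [hG', hGr r] with s h1 h2 hs hsr
    have h3 := hsub s (h1 hs) (s + r) (h2 hsr)
    have h4 := cs r hr s hs hsr (V s) _ rfl
    rw [zero_mul, add_zero, ind hs, ind hs, ind hsr]
    exact h4.trans h3) ha hb hab (by rwa [ind ha]) (by rwa [ind hb])
  have upper := neg_integral_le_sub_of_short_increments (M := M) (e := 1) hw' hψ'.neg (by
    intro r hr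
    filter_upwards [hG', hGr r] with s h1 h2 hs hsr
    have h3 := hsub (s + r) (h2 hsr) s (h1 hs)
    have h4 := cs r hr s hs hsr (V (s + r)) _ (norm_sub_rev _ _)
    rw [one_mul, Pi.neg_apply, Pi.neg_apply, ind hs, ind hsr, ind hsr]
    refine (h4.trans h3).trans (le_of_eq (by ring))) ha hb hab
    (by simpa [ind ha, intervalIntegral.integral_neg] using hda.fun_neg)
    (by simpa [ind hb, intervalIntegral.integral_neg] using hdb.fun_neg)
  rw [Pi.neg_apply, Pi.neg_apply] at upper
  rw [intervalIntegral_indicator_Ioo _ (Ioo_subset_Icc_self ha) (Ioo_subset_Icc_self hb), ind ha,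
    ind hb] at lower upper
  rw [abs_le]
  constructor <;> linarith

/-- The chain rule for a semiconvex energy along a curve `U` with `U' = V` square integrable: if
`-V` is a subgradient of the energy `ψ` along the curve, up to a quadratic error, then
`ψ' = -‖V‖²`. -/
lemma exists_ae_eq_const_sub_of_subgradient [CompleteSpace K] {V : ℝ → K} {ψ : ℝ → ℝ} {T M : ℝ}
    (hT : 0 < T) (hM : 0 ≤ M) (hV : MemLp V 2 (timeMeasure T))
    (hψ : Integrable ψ (timeMeasure T)) {G : Set ℝ} (hG : ∀ᵐ t ∂(timeMeasure T), t ∈ G)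
    (hsub : ∀ s ∈ G, ∀ t ∈ G,
      -inner ℝ (V s) ((∫ r in (0 : ℝ)..t, V r) - ∫ r in (0 : ℝ)..s, V r) -
        M * ‖(∫ r in (0 : ℝ)..t, V r) - ∫ r in (0 : ℝ)..s, V r‖ ^ 2 ≤ ψ t - ψ s) :
    ∃ c₀ : ℝ, ∀ᵐ t ∂(timeMeasure T), ψ t = c₀ - ∫ r in (0 : ℝ)..t, ‖V r‖ ^ 2 := by
  have h0 : (0 : ℝ) ∈ Icc 0 T := ⟨le_rfl, hT.le⟩
  have hTT : T ∈ Icc 0 T := ⟨hT.le, le_rfl⟩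
  have hψ' : Integrable ((Ioo 0 T).indicator ψ) := (integrable_indicator_iff measurableSet_Ioo).2 hψ
  have hVi : IntervalIntegrable V volume 0 T :=
    intervalIntegrable_of_integrable_timeMeasure (integrable_of_memLp_two hV) h0 hTT
  have iW : ∀ {a b : ℝ}, a ∈ Icc 0 T → b ∈ Icc 0 T →
      IntervalIntegrable (fun r => ‖V r‖ ^ 2) volume a b :=
    intervalIntegrable_of_integrable_timeMeasure (MemLp.integrable_norm_sq hV)
  set U : ℝ → K := fun t => ∫ r in (0 : ℝ)..t, V r with hU
  set W : ℝ → ℝ := fun t => ∫ r in (0 : ℝ)..t, ‖V r‖ ^ 2 with hW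
  set P : ℝ → ℝ := fun t => ∫ s in (0 : ℝ)..t, (Ioo 0 T).indicator ψ s with hP
  -- the good times, at which moreover all primitives are differentiable
  set G' : Set ℝ := {t | t ∈ Ioo 0 T ∧ t ∈ G ∧ HasDerivAt P (ψ t) t ∧ HasDerivAt U (V t) t ∧
    HasDerivAt W (‖V t‖ ^ 2) t} with hG'
  have hG'ae : ∀ᵐ t, t ∈ Ioo 0 T → t ∈ G' := by
    filter_upwards [ae_timeMeasure_iff.1 hG,
      (hψ'.intervalIntegrable (a := 0) (b := T)).ae_hasDerivAt_integral,
      hVi.ae_hasDerivAt_integral, (iW h0 hTT).ae_hasDerivAt_integral] with t h1 h2 h3 h4 ht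
    have ht' : t ∈ uIcc 0 T := by rw [uIcc_of_le hT.le]; exact Ioo_subset_Icc_self ht
    refine ⟨ht, h1 ht, ?_, h3 ht' 0 left_mem_uIcc, h4 ht' 0 left_mem_uIcc⟩
    have := h2 ht' 0 left_mem_uIcc
    rwa [indicator_of_mem ht] at this
  have hlip : ∀ a ∈ G', ∀ b ∈ G', a < b → |ψ b - ψ a| ≤ W b - W a := by
    intro a ha b hb hab
    have := abs_sub_le_of_subgradient hM hV hψ hG hsub ha.1 hb.1 hab ha.2.2.1 hb.2.2.1
    rwa [← intervalIntegral.integral_interval_sub_left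
      (iW h0 (Ioo_subset_Icc_self hb.1)) (iW h0 (Ioo_subset_Icc_self ha.1))] at this
  have hlip' : ∀ a ∈ G', ∀ b ∈ G', |ψ a - ψ b| ≤ |W a - W b| := by
    intro a ha b hb
    rcases lt_trichotomy a b with h | rfl | h
    · rw [abs_sub_comm, abs_sub_comm (W a)]
      exact (hlip a ha b hb h).trans (le_abs_self _)
    · simp
    · exact (hlip b hb a ha h).trans (le_abs_self _)
  -- `ψ` is a `1`-Lipschitz function of `W` on `G'`
  obtain ⟨g, hg, hgψ⟩ : ∃ g : ℝ → ℝ, LipschitzWith 1 g ∧ ∀ t ∈ G', g (W t) = ψ t := by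
    have hL : LipschitzOnWith 1 (fun x => ψ (Function.invFunOn W G' x)) (W '' G') := by
      refine LipschitzOnWith.of_dist_le_mul ?_
      rintro _ ⟨a, ha, rfl⟩ _ ⟨b, hb, rfl⟩
      have ha' : ∃ x ∈ G', W x = W a := ⟨a, ha, rfl⟩
      have hb' : ∃ x ∈ G', W x = W b := ⟨b, hb, rfl⟩
      have := hlip' _ (Function.invFunOn_mem ha') _ (Function.invFunOn_mem hb')
      rw [Function.invFunOn_eq ha', Function.invFunOn_eq hb'] at this
      simpa [Real.dist_eq] using this
    obtain ⟨g, hg, he⟩ := hL.extend_real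
    refine ⟨g, hg, fun t ht => ?_⟩
    have ht' : ∃ x ∈ G', W x = W t := ⟨t, ht, rfl⟩
    rw [← he ⟨t, ht, rfl⟩]
    have := hlip' _ (Function.invFunOn_mem ht') t ht
    rw [Function.invFunOn_eq ht', sub_self, abs_zero] at this
    exact sub_eq_zero.1 (abs_nonpos_iff.1 this)
  set Q : ℝ → ℝ := fun t => g (W t) with hQ
  have acW : AbsolutelyContinuousOnInterval W 0 T :=
    (iW h0 hTT).absolutelyContinuousOnInterval_intervalIntegral left_mem_uIcc
  have acQ : AbsolutelyContinuousOnInterval Q 0 T :=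
    AbsolutelyContinuousOnInterval.lipschitz_comp acW hg
  have cU : ContinuousOn U (Icc 0 T) :=
    continuousOn_primitive_timeMeasure hT.le (integrable_of_memLp_two hV)
  have cQ : ContinuousOn Q (Icc 0 T) := by
    have := acQ.continuousOn
    rwa [uIcc_of_le hT.le] at this
  have hdense : Dense {t : ℝ | t ∈ Ioo 0 T → t ∈ G'} := Measure.dense_of_ae hG'ae
  -- at a good time `s`, the function `Q + ⟪V s, U - U s⟫ + M ‖U - U s‖²` has a minimum
  have hderiv : ∀ s ∈ G', DifferentiableAt ℝ Q s → HasDerivAt Q (-‖V s‖ ^ 2) s := by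
    intro s hs hds
    set R : ℝ → ℝ := fun t => Q t + inner ℝ (V s) (U t - U s) + M * ‖U t - U s‖ ^ 2 with hR
    have hRs : R s = ψ s := by simp [hR, hQ, hgψ s hs]
    have hRG : ∀ t ∈ G', R s ≤ R t := by
      intro t ht
      have := hsub s hs.2.1 t ht.2.1
      rw [hRs]
      simp only [hR, hQ, hgψ t ht]
      linarith
    have cR : ContinuousOn R (Ioo 0 T) := by
      have c1 := cU.mono Ioo_subset_Icc_self
      have c2 := cQ.mono Ioo_subset_Icc_self
      have c3 : ContinuousOn (fun t => U t - U s) (Ioo 0 T) := c1.sub continuousOn_const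
      exact (c2.add (continuousOn_const.inner c3)).add (continuousOn_const.mul (c3.norm.pow 2))
    have hRall : ∀ t ∈ Ioo 0 T, R s ≤ R t := by
      intro t ht
      by_contra! hlt
      have ho : IsOpen (Ioo 0 T ∩ R ⁻¹' Iio (R s)) := cR.isOpen_inter_preimage isOpen_Ioo isOpen_Iio
      obtain ⟨r, hr, hr'⟩ := hdense.inter_open_nonempty _ ho ⟨t, ht, hlt⟩
      exact absurd (hRG r (hr' hr.1)) (not_le.2 hr.2)
    have hmin : IsLocalMin R s := by
      filter_upwards [Ioo_mem_nhds hs.1.1 hs.1.2] with t ht using hRall t ht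
    have dU : HasDerivAt (fun t => U t - U s) (V s) s := hs.2.2.2.1.sub_const _
    have dR : HasDerivAt R (deriv Q s + inner ℝ (V s) (V s) +
        M * (2 * inner ℝ (U s - U s) (V s))) s := by
      refine (hds.hasDerivAt.fun_add ?_).fun_add (dU.norm_sq.const_mul M)
      exact ((innerSL ℝ (V s)).hasFDerivAt.comp_hasDerivAt s dU)
    have := hmin.hasDerivAt_eq_zero dR
    rw [sub_self, inner_zero_left, real_inner_self_eq_norm_sq] at this
    have e : deriv Q s = -‖V s‖ ^ 2 := by linarith
    rw [← e]; exact hds.hasDerivAt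
  obtain ⟨c₀, hc₀⟩ := (acQ.add acW).const_of_ae_hasDerivAt_zero (by
    filter_upwards [hG'ae, acQ.ae_differentiableAt, compl_mem_ae_iff.2 (measure_singleton (0 : ℝ)),
      compl_mem_ae_iff.2 (measure_singleton T)] with s h1 h2 h3 h4 hs
    have hs' := hs
    rw [uIcc_of_le hT.le] at hs'
    have hsG := h1 ⟨lt_of_le_of_ne hs'.1 (Ne.symm h3), lt_of_le_of_ne hs'.2 h4⟩
    exact ((hderiv s hsG (h2 hs)).add hsG.2.2.2.2).congr_deriv (by ring))
  refine ⟨c₀, ae_timeMeasure_iff.2 ?_⟩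
  filter_upwards [hG'ae] with t ht htT
  have := hc₀ t (by rw [uIcc_of_le hT.le]; exact Ioo_subset_Icc_self htT)
  rw [← hgψ t (ht htT)]
  simp only [Pi.add_apply] at this
  linarith

end ChainRule

/-! ### The pointwise equation for the extended state -/

section Pointwise

variable {X H : Type*} [NormedAddCommGroup X] [NormedSpace ℝ X]
  [NormedAddCommGroup H] [InnerProductSpace ℝ H]
  {Θ : Type*} [MeasurableSpace Θ] {ν : Measure Θ} {c : Θ → ℝ}

/-- If `v + a q = f`, then `√a q` is controlled by `v`, `q` and `f / √(1 + a)`. -/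
lemma weight_mul_norm_sq_le {a : ℝ} (ha : 0 ≤ a) {f v q : H} (h : v + a • q = f) :
    (1 + a) * ‖q‖ ^ 2 ≤ 3 * (‖f‖ ^ 2 * (1 + a)⁻¹ + ‖v‖ ^ 2 + ‖q‖ ^ 2) := by
  have h1 : (1 + a) * ‖q‖ ≤ ‖f‖ + ‖v‖ + ‖q‖ := by
    have : (1 + a) • q = f - v + q := by rw [← h, add_smul, one_smul]; abel
    calc (1 + a) * ‖q‖ = ‖(1 + a) • q‖ := by
          rw [norm_smul, Real.norm_of_nonneg (by linarith)]
      _ ≤ ‖f‖ + ‖v‖ + ‖q‖ := by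
          rw [this]; exact (norm_add_le _ _).trans (by gcongr; exact norm_sub_le _ _)
  have h2 : ((1 + a) * ‖q‖) ^ 2 ≤ 3 * (‖f‖ ^ 2 + ‖v‖ ^ 2 + ‖q‖ ^ 2) := by
    have : ((1 + a) * ‖q‖) ^ 2 ≤ (‖f‖ + ‖v‖ + ‖q‖) ^ 2 := by gcongr
    nlinarith [sq_nonneg (‖f‖ - ‖v‖), sq_nonneg (‖f‖ - ‖q‖), sq_nonneg (‖v‖ - ‖q‖)]
  have hpos : 0 < 1 + a := by linarith
  have h3 : (1 + a) * ‖q‖ ^ 2 ≤ 3 * (‖f‖ ^ 2 + ‖v‖ ^ 2 + ‖q‖ ^ 2) * (1 + a)⁻¹ := by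
    rw [← div_eq_mul_inv, le_div_iff₀ hpos]
    linarith [h2]
  have h4 : (1 + a)⁻¹ ≤ 1 := inv_le_one_of_one_le₀ (by linarith)
  nlinarith [mul_le_mul_of_nonneg_left h4 (sq_nonneg ‖v‖),
    mul_le_mul_of_nonneg_left h4 (sq_nonneg ‖q‖)]

/-- If `v + c q` is constant, then `q` has an additional half order of integrability. -/
lemma integrable_weight_mul_norm_sq (hc : Measurable c) (hc0 : ∀ θ, 0 ≤ c θ)
    (hI : Integrable (fun θ => (1 + c θ)⁻¹) ν) {v q : Lp H 2 ν} {f : H}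
    (h : ∀ᵐ θ ∂ν, v θ + c θ • q θ = f) :
    Integrable (fun θ => (1 + c θ) * ‖q θ‖ ^ 2) ν := by
  have iv := MemLp.integrable_norm_sq (Lp.memLp v)
  have iq := MemLp.integrable_norm_sq (Lp.memLp q)
  refine (((hI.const_mul (‖f‖ ^ 2)).add iv).add iq |>.const_mul 3).mono' ?_ ?_
  · exact (hc.const_add 1).aestronglyMeasurable.mul iq.1
  · filter_upwards [h] with θ hθ
    have := hc0 θ
    rw [Real.norm_of_nonneg (by positivity)]
    exact weight_mul_norm_sq_le this hθ

/-- The quantitative form: the constant `v + c q` itself is controlled by `v` and `q`. -/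
lemma exists_integral_weight_mul_norm_sq_le [NeZero ν] (hc : Measurable c) (hc0 : ∀ θ, 0 ≤ c θ)
    (hI : Integrable (fun θ => (1 + c θ)⁻¹) ν) :
    ∃ C, 0 ≤ C ∧ ∀ (v q : Lp H 2 ν) (f : H), (∀ᵐ θ ∂ν, v θ + c θ • q θ = f) →
      ∫ θ, (1 + c θ) * ‖q θ‖ ^ 2 ∂ν ≤ C * (‖v‖ ^ 2 + ‖q‖ ^ 2) := by
  have hpos : ∀ θ, 0 < 1 + c θ := fun θ => by linarith [hc0 θ]
  have i2 : Integrable (fun θ => (1 + c θ)⁻¹ ^ 2) ν := by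
    refine hI.mono' ((hc.const_add 1).inv.pow_const 2).aestronglyMeasurable
      (Eventually.of_forall fun θ => ?_)
    have h1 := (inv_pos.2 (hpos θ)).le
    have h2 : (1 + c θ)⁻¹ ≤ 1 := inv_le_one_of_one_le₀ (by linarith [hc0 θ])
    rw [Real.norm_of_nonneg (by positivity)]
    nlinarith
  set N₁ := ∫ θ, (1 + c θ)⁻¹ ∂ν
  set N₂ := ∫ θ, (1 + c θ)⁻¹ ^ 2 ∂ν
  have hN₁ : 0 ≤ N₁ := integral_nonneg fun θ => (inv_pos.2 (hpos θ)).le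
  have hN₂ : 0 < N₂ := by
    refine (integral_pos_iff_support_of_nonneg (fun θ => sq_nonneg _) i2).2 ?_
    have : (Function.support fun θ => (1 + c θ)⁻¹ ^ 2) = univ := by
      ext θ; simp [(hpos θ).ne']
    rw [this]
    exact Measure.measure_univ_pos.2 (NeZero.ne ν)
  refine ⟨3 * (2 * N₁ / N₂ + 1), by positivity, fun v q f h => ?_⟩
  have iv := MemLp.integrable_norm_sq (Lp.memLp v)
  have iq := MemLp.integrable_norm_sq (Lp.memLp q)
  have h1 : ‖f‖ ^ 2 * N₂ ≤ 2 * ‖v‖ ^ 2 + 2 * ‖q‖ ^ 2 := by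
    rw [L2_norm_sq_eq_integral v, L2_norm_sq_eq_integral q, ← integral_const_mul,
      ← integral_const_mul, ← integral_const_mul, ← integral_add (iv.const_mul 2) (iq.const_mul 2)]
    refine integral_mono_ae (i2.const_mul _) ((iv.const_mul 2).add (iq.const_mul 2)) ?_
    filter_upwards [h] with θ hθ
    have hp := hpos θ
    have h2 : ‖f‖ * (1 + c θ)⁻¹ ≤ ‖v θ‖ + ‖q θ‖ := by
      rw [← div_eq_mul_inv, div_le_iff₀ hp, ← hθ]
      have h3 : ‖v θ + c θ • q θ‖ ≤ ‖v θ‖ + c θ * ‖q θ‖ := by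
        refine (norm_add_le _ _).trans ?_
        rw [norm_smul, Real.norm_of_nonneg (hc0 θ)]
      nlinarith [mul_nonneg (hc0 θ) (norm_nonneg (v θ)), norm_nonneg (q θ)]
    have h4 : (‖f‖ * (1 + c θ)⁻¹) ^ 2 ≤ (‖v θ‖ + ‖q θ‖) ^ 2 := by
      have := (inv_pos.2 hp).le
      gcongr
    have h5 := sq_nonneg (‖v θ‖ - ‖q θ‖)
    nlinarith
  have ifv : Integrable (fun θ => ‖f‖ ^ 2 * (1 + c θ)⁻¹ + ‖v θ‖ ^ 2) ν := (hI.const_mul _).add iv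
  have h2 : ∫ θ, (1 + c θ) * ‖q θ‖ ^ 2 ∂ν ≤ 3 * (‖f‖ ^ 2 * N₁ + ‖v‖ ^ 2 + ‖q‖ ^ 2) := by
    rw [L2_norm_sq_eq_integral v, L2_norm_sq_eq_integral q, ← integral_const_mul,
      ← integral_add (hI.const_mul _) iv, ← integral_add ifv iq,
      ← integral_const_mul]
    refine integral_mono_ae (integrable_weight_mul_norm_sq hc hc0 hI h)
      ((ifv.add iq).const_mul 3) ?_
    filter_upwards [h] with θ hθ using weight_mul_norm_sq_le (hc0 θ) hθ
  have h3 : ‖f‖ ^ 2 * N₁ ≤ 2 * N₁ / N₂ * (‖v‖ ^ 2 + ‖q‖ ^ 2) := by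
    rw [div_mul_eq_mul_div, le_div_iff₀ hN₂]
    nlinarith
  linarith

lemma hasDerivAt_expConv_of_primitive {B : Type*} [NormedAddCommGroup B] [NormedSpace ℝ B]
    [CompleteSpace B] {z : ℝ → B} (hz : LocallyIntegrable z volume) {t : ℝ} (ht : 0 < t)
    (h : HasDerivAt (expConv 0 z) (z t) t) (a : ℝ) :
    HasDerivAt (expConv a z) (z t - a • expConv a z t) t := by
  have h1 := hasDerivAt_expConv_of_continuous (continuous_expConv hz 0) a t
  have h2 : HasDerivAt (fun τ => expConv 0 z τ - a • expConv a (expConv 0 z) τ)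
      (z t - a • (expConv 0 z t - a • expConv a (expConv 0 z) t)) t :=
    h.fun_sub (h1.fun_const_smul a)
  have h3 : ∀ τ, 0 ≤ τ → expConv a z τ = expConv 0 z τ - a • expConv a (expConv 0 z) τ :=
    fun τ hτ => by rw [expConv_eq_primitive_sub hz a hτ, expConv_zero_left]
  rw [← h3 t ht.le] at h2
  refine h2.congr_of_eventuallyEq ?_
  filter_upwards [Ioi_mem_nhds ht] with τ hτ using h3 τ (le_of_lt hτ)

variable [CompleteSpace H] {ι : X →L[ℝ] H} {E : X → ℝ} {p T κ : ℝ} {u₀ : X}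
  {u : ℝ → X} {F : ℝ → H} {V : ℝ → Lp H 2 ν}

/-- At almost every time the force is an element of `H`, namely `V + c U` for almost every `θ`:
the difference quotients of `U` converge to `V` for a.e. `θ` along a sequence, and the images in
`X'` of the difference quotients of `K_c F'` converge to `force - c K_c force` for every `θ`. -/
lemma IsSuperposedFlow.ae_force_eq [NeZero ν] (h : IsSuperposedFlow ν c ι E p T κ u₀ u F)
    (hV : MemLp V 2 (timeMeasure T))
    (hU : ∀ t ∈ Icc 0 T, (∫ s in (0 : ℝ)..t, V s : Lp H 2 ν) =ᵐ[ν] fun θ => relax F (c θ) t) :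
    ∀ᵐ t ∂(timeMeasure T), ∃ f : H, flowForce E T u t = toDualXL ι f ∧
      ∀ᵐ θ ∂ν, V t θ + c θ • (∫ s in (0 : ℝ)..t, V s : Lp H 2 ν) θ = f := by
  have h0 : (0 : ℝ) ∈ Icc 0 T := ⟨le_rfl, h.pos.le⟩
  have hTT : T ∈ Icc 0 T := ⟨h.pos.le, le_rfl⟩
  refine ae_timeMeasure_iff.2 ?_
  filter_upwards [(intervalIntegrable_of_integrable_timeMeasure
      (integrable_of_memLp_two hV) h0 hTT).ae_hasDerivAt_integral,
    (h.locallyIntegrable_force.intervalIntegrable 0 T).ae_hasDerivAt_integral] with t d1 d2 ht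
  have ht' : t ∈ uIcc 0 T := by rw [uIcc_of_le h.pos.le]; exact Ioo_subset_Icc_self ht
  replace d1 := d1 ht' 0 left_mem_uIcc
  replace d2 : HasDerivAt (expConv 0 (flowForce E T u)) (flowForce E T u t) t := by
    refine (d2 ht' 0 left_mem_uIcc).congr_of_eventuallyEq (Eventually.of_forall fun τ => ?_)
    exact expConv_zero_left _ _
  set U : ℝ → Lp H 2 ν := fun t => ∫ s in (0 : ℝ)..t, V s with hUdef
  obtain ⟨δ, -, hδ, hδ0⟩ := exists_seq_strictAnti_tendsto' (x := (0 : ℝ)) (y := T - t)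
    (sub_pos.2 ht.2)
  have hδn : Tendsto δ atTop (𝓝[≠] 0) := tendsto_nhdsWithin_iff.2
    ⟨hδ0, Eventually.of_forall fun n => (hδ n).1.ne'⟩
  have hmem : ∀ n, t + δ n ∈ Icc 0 T := fun n =>
    ⟨by linarith [ht.1, (hδ n).1], by linarith [(hδ n).2]⟩
  have tU : Tendsto (fun n => (δ n)⁻¹ • (U (t + δ n) - U t)) atTop (𝓝 (V t)) :=
    d1.tendsto_slope_zero.comp hδn
  obtain ⟨k, hk, hae⟩ := (tendstoInMeasure_of_tendsto_Lp tU).exists_seq_tendsto_ae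
  have hslope : ∀ᵐ θ ∂ν, ∀ n, ((δ n)⁻¹ • (U (t + δ n) - U t) : Lp H 2 ν) θ =
      (δ n)⁻¹ • (relax F (c θ) (t + δ n) - relax F (c θ) t) := by
    refine ae_all_iff.2 fun n => ?_
    filter_upwards [Lp.coeFn_smul (δ n)⁻¹ (U (t + δ n) - U t), Lp.coeFn_sub (U (t + δ n)) (U t),
      hU _ (hmem n), hU t (Ioo_subset_Icc_self ht)] with θ e1 e2 e3 e4
    rw [e1, Pi.smul_apply, e2, Pi.sub_apply]
    simp only [hUdef]
    rw [e3, e4]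
  have key : ∀ᵐ θ ∂ν, flowForce E T u t = toDualXL ι (V t θ + c θ • U t θ) := by
    filter_upwards [hae, hslope, hU t (Ioo_subset_Icc_self ht)] with θ e1 e2 e3
    have l1 : Tendsto (fun n => toDualXL ι ((δ (k n))⁻¹ •
        (relax F (c θ) (t + δ (k n)) - relax F (c θ) t))) atTop (𝓝 (toDualXL ι (V t θ))) := by
      simp only [e2] at e1
      exact ((toDualXL ι).continuous.tendsto _).comp e1
    have l2 : Tendsto (fun n => (δ (k n))⁻¹ • (expConv (c θ) (flowForce E T u) (t + δ (k n)) -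
        expConv (c θ) (flowForce E T u) t)) atTop
        (𝓝 (flowForce E T u t - c θ • expConv (c θ) (flowForce E T u) t)) :=
      (hasDerivAt_expConv_of_primitive h.locallyIntegrable_force ht.1 d2
        (c θ)).tendsto_slope_zero.comp (hδn.comp hk.tendsto_atTop)
    have l3 := tendsto_nhds_unique l1 (l2.congr fun n => by
      rw [map_smul, map_sub, h.toDualXL_relax _ (hmem _),
        h.toDualXL_relax _ (Ioo_subset_Icc_self ht)])
    rw [map_add, l3, map_smul, e3, h.toDualXL_relax _ (Ioo_subset_Icc_self ht)]
    abel
  obtain ⟨θ₀, hθ₀⟩ := key.exists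
  refine ⟨V t θ₀ + c θ₀ • U t θ₀, hθ₀, ?_⟩
  filter_upwards [key] with θ hθ using toDualXL_injective h.denseRange (hθ.symm.trans hθ₀)

lemma norm_le_half_inv_add_weight {a : ℝ} (ha : 0 ≤ a) (r : ℝ) :
    |r| ≤ 1 / 2 * ((1 + a)⁻¹ + (1 + a) * r ^ 2) := by
  have hp : 0 < 1 + a := by linarith
  have h1 : 0 ≤ (1 - (1 + a) * |r|) ^ 2 * (1 + a)⁻¹ := by positivity
  have h2 : (1 - (1 + a) * |r|) ^ 2 * (1 + a)⁻¹ = (1 + a)⁻¹ + (1 + a) * |r| ^ 2 - 2 * |r| := by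
    field_simp; ring
  rw [h2, sq_abs] at h1
  linarith

/-- The solution is recovered from its extended state. The time-integrated form of this identity is
part of the definition; the additional integrability of the extended state in `θ` permits
to exchange the integrals and to differentiate. -/
lemma IsSuperposedFlow.ae_incr_eq [NeZero ν] [SFinite ν] (h : IsSuperposedFlow ν c ι E p T κ u₀ u F)
    (hV : MemLp V 2 (timeMeasure T))
    (hU : ∀ t ∈ Icc 0 T, (∫ s in (0 : ℝ)..t, V s : Lp H 2 ν) =ᵐ[ν] fun θ => relax F (c θ) t) :
    ∀ᵐ t ∂(timeMeasure T),
      ι (flowIncr T u₀ u t) = ∫ θ, (∫ s in (0 : ℝ)..t, V s : Lp H 2 ν) θ ∂ν := by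
  have hF := h.continuous_primitive
  have hc := h.measurable_rate
  have hc0 := h.rate_nonneg
  have hI := h.integrable_rate
  obtain ⟨C, hC0, hC⟩ := exists_integral_weight_mul_norm_sq_le (H := H) hc hc0 hI
  set U : ℝ → Lp H 2 ν := fun t => ∫ s in (0 : ℝ)..t, V s with hUdef
  have mU : StronglyMeasurable fun q : ℝ × Θ => relax F (c q.2) q.1 :=
    (hF.stronglyMeasurable.comp_measurable measurable_fst).sub
      ((hc.comp measurable_snd).stronglyMeasurable.smul (stronglyMeasurable_expConv hF hc))
  have good : ∀ᵐ t ∂(timeMeasure T),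
      Integrable (fun θ => (1 + c θ) * ‖relax F (c θ) t‖ ^ 2) ν ∧
      ∫ θ, (1 + c θ) * ‖relax F (c θ) t‖ ^ 2 ∂ν ≤ C * (‖V t‖ ^ 2 + ‖U t‖ ^ 2) := by
    filter_upwards [h.ae_force_eq hV hU, ae_restrict_mem measurableSet_Ioo] with t hf ht
    obtain ⟨f, -, hf⟩ := hf
    have e : (fun θ => (1 + c θ) * ‖U t θ‖ ^ 2) =ᵐ[ν]
        fun θ => (1 + c θ) * ‖relax F (c θ) t‖ ^ 2 := by
      filter_upwards [hU t (Ioo_subset_Icc_self ht)] with θ hθ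
      simp only [hUdef, hθ]
    refine ⟨(integrable_weight_mul_norm_sq hc hc0 hI hf).congr e, ?_⟩
    rw [← integral_congr_ae e]
    exact hC _ _ f hf
  -- the extended state is integrable in time and `θ`
  have iq : Integrable (fun q : ℝ × Θ => relax F (c q.2) q.1) ((timeMeasure T).prod ν) := by
    have bnd : ∀ t θ, ‖relax F (c θ) t‖ ≤
        1 / 2 * ((1 + c θ)⁻¹ + (1 + c θ) * ‖relax F (c θ) t‖ ^ 2) := fun t θ => by
      simpa using norm_le_half_inv_add_weight (hc0 θ) ‖relax F (c θ) t‖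
    refine (integrable_prod_iff mU.aestronglyMeasurable).2 ⟨?_, ?_⟩
    · filter_upwards [good] with t ht
      exact ((hI.add ht.1).const_mul (1 / 2)).mono' (aestronglyMeasurable_relax_rate hF hc t)
        (Eventually.of_forall fun θ => bnd t θ)
    · have i1 : Integrable (fun t => 1 / 2 * ((∫ θ, (1 + c θ)⁻¹ ∂ν) +
          C * (‖V t‖ ^ 2 + ‖U t‖ ^ 2))) (timeMeasure T) := by
        exact (((integrable_const _).add (((MemLp.integrable_norm_sq hV).add
          (MemLp.integrable_norm_sq (memLp_two_primitive h.pos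
            (integrable_of_memLp_two hV)))).const_mul C)).const_mul _)
      refine i1.mono' ?_ ?_
      · exact mU.norm.aestronglyMeasurable.integral_prod_right'
          (μ := timeMeasure T) (ν := ν)
      · filter_upwards [good] with t ht
        rw [Real.norm_of_nonneg (integral_nonneg fun θ => norm_nonneg _)]
        have h1 : ∫ θ, ‖relax F (c θ) t‖ ∂ν ≤ ∫ θ, 1 / 2 * ((1 + c θ)⁻¹ +
            (1 + c θ) * ‖relax F (c θ) t‖ ^ 2) ∂ν :=
          integral_mono_of_nonneg (Eventually.of_forall fun θ => norm_nonneg _)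
            ((hI.add ht.1).const_mul (1 / 2)) (Eventually.of_forall fun θ => bnd t θ)
        rw [integral_const_mul, integral_add hI ht.1] at h1
        linarith [ht.2]
  have hy : Integrable (fun t => ι (flowIncr T u₀ u t)) (timeMeasure T) :=
    h.locallyIntegrable_map_incr.integrable_timeMeasure T
  have hmain := ae_eq_of_primitive_eq h.pos hy iq.integral_prod_left (fun t ht => by
    have mono : timeMeasure t ≤ timeMeasure T :=
      Measure.restrict_mono (Ioo_subset_Ioo_right ht.2) le_rfl
    have iqt : Integrable (fun q : ℝ × Θ => relax F (c q.2) q.1) ((timeMeasure t).prod ν) :=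
      iq.mono_measure (Measure.prod_mono mono le_rfl)
    rw [← expConv_zero_left, h.representation t ht, intervalIntegral_eq_timeMeasure ht.1]
    refine Eq.trans ?_ (integral_integral_swap iqt).symm
    refine integral_congr_ae (Eventually.of_forall fun θ => ?_)
    simp only
    rw [← intervalIntegral_eq_timeMeasure ht.1, ← expConv_zero_left, expConv_zero_relax hF _ ht.1])
  filter_upwards [hmain, ae_restrict_mem measurableSet_Ioo] with t e1 ht
  rw [e1]
  exact integral_congr_ae (hU t (Ioo_subset_Icc_self ht)).symm

end Pointwise

/-! ### The energy balance for a superposed flow -/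

section Balance

variable {X H : Type*} [NormedAddCommGroup X] [NormedSpace ℝ X]
  [NormedAddCommGroup H] [InnerProductSpace ℝ H]

/-- By reflexivity, `H` is dense in `X'`. -/
lemma denseRange_toDualXL (hrefl : Function.Surjective (NormedSpace.inclusionInDoubleDual ℝ X))
    {ι : X →L[ℝ] H} (hinj : Function.Injective ι) : DenseRange (toDualXL ι) := by
  intro L
  by_contra hL
  obtain ⟨g, r, hg, hr⟩ := geometric_hahn_banach_closed_point
    (s := closure (range (toDualXL ι)))
    (by have := (LinearMap.range (toDualXL ι).toLinearMap).convex.closure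
        rwa [LinearMap.coe_range] at this) isClosed_closure hL
  have hg0 : ∀ h, g (toDualXL ι h) = 0 := by
    intro h
    by_contra hne
    have := hg (toDualXL ι ((r / g (toDualXL ι h)) • h)) (subset_closure (mem_range_self _))
    rw [map_smul, map_smul, smul_eq_mul, div_mul_cancel₀ _ hne] at this
    exact lt_irrefl _ this
  obtain ⟨x, hx⟩ := hrefl g
  have hx0 : x = 0 := by
    refine hinj ?_
    have := hg0 (ι x)
    rw [← hx, NormedSpace.dual_def, toDualXL_apply] at this
    rw [inner_self_eq_zero.1 this, map_zero]
  have h0 := hg (toDualXL ι 0) (subset_closure (mem_range_self _))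
  rw [← hx, hx0] at h0 hr
  simp at h0 hr
  linarith

/-- A bounded family in `X` that tends to zero in `H` tends weakly to zero in `X`. -/
lemma tendsto_apply_of_tendsto_zero {ι : X →L[ℝ] H} (hd : DenseRange (toDualXL ι)) {J : Type*}
    {l : Filter J} {y : J → X} {M : ℝ} (hM : ∀ᶠ j in l, ‖y j‖ ≤ M)
    (hy : Tendsto (fun j => ‖ι (y j)‖) l (𝓝 0)) (L : X →L[ℝ] ℝ) :
    Tendsto (fun j => L (y j)) l (𝓝 0) := by
  rw [Metric.tendsto_nhds]
  intro ε hε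
  obtain ⟨h, hh⟩ := hd.exists_dist_lt L (show 0 < ε / (2 * (|M| + 1)) by positivity)
  have h1 : ∀ᶠ j in l, (‖h‖) * ‖ι (y j)‖ < ε / 2 := by
    have := hy.const_mul ‖h‖
    rw [mul_zero] at this
    exact this.eventually (gt_mem_nhds (by positivity))
  filter_upwards [hM, h1] with j h2 h3
  rw [dist_zero_right]
  have e : L (y j) = (L - toDualXL ι h) (y j) + inner ℝ h (ι (y j)) := by
    rw [sub_apply, toDualXL_apply]; ring
  have h4 : ‖(L - toDualXL ι h) (y j)‖ ≤ ε / 2 := by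
    refine ((L - toDualXL ι h).le_opNorm _).trans ?_
    rw [← dist_eq_norm]
    calc dist L (toDualXL ι h) * ‖y j‖ ≤ ε / (2 * (|M| + 1)) * (|M| + 1) := by
          gcongr
          linarith [le_abs_self M]
      _ = ε / 2 := by field_simp
  have h5 := norm_inner_le_norm (𝕜 := ℝ) h (ι (y j))
  rw [e]
  exact (norm_add_le _ _).trans_lt (by linarith)

/-- Upper bound for the initial value of the energy: the subgradient inequality against the
initial state, averaged over `(0, τ)` with `τ → 0`. -/
lemma le_of_ae_subgradient_zero {K : Type*} [NormedAddCommGroup K] [InnerProductSpace ℝ K]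
    {V : ℝ → K} {T M c₀ e₀ : ℝ} (hT : 0 < T) (hM : 0 ≤ M) (hV : MemLp V 2 (timeMeasure T))
    (h : ∀ᵐ s ∂(timeMeasure T), c₀ - (∫ r in (0 : ℝ)..s, ‖V r‖ ^ 2) ≤
      e₀ - inner ℝ (V s) (∫ r in (0 : ℝ)..s, V r) + M * ‖∫ r in (0 : ℝ)..s, V r‖ ^ 2) :
    c₀ ≤ e₀ := by
  have h0 : (0 : ℝ) ∈ Icc 0 T := ⟨le_rfl, hT.le⟩
  have iV2 := MemLp.integrable_norm_sq hV
  set W : ℝ → ℝ := fun t => ∫ r in (0 : ℝ)..t, ‖V r‖ ^ 2 with hW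
  have hWm : ∀ s ∈ Icc 0 T, ∀ t ∈ Icc 0 T, s ≤ t → W s ≤ W t := by
    intro s hs t ht hst
    have : 0 ≤ ∫ r in s..t, ‖V r‖ ^ 2 :=
      intervalIntegral.integral_nonneg hst fun r _ => sq_nonneg _
    rw [← intervalIntegral.integral_interval_sub_left
      (intervalIntegrable_of_integrable_timeMeasure iV2 h0 ht)
      (intervalIntegrable_of_integrable_timeMeasure iV2 h0 hs)] at this
    linarith
  have key : ∀ τ ∈ Ioo 0 T, c₀ ≤ e₀ + W τ * (2 + M * τ) := by
    intro τ hτ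
    have hτ' := Ioo_subset_Icc_self hτ
    have hpt : ∀ᵐ s, s ∈ Ioo 0 τ →
        c₀ - e₀ - W τ * (3 / 2 + M * τ) ≤ τ / 2 * ‖V s‖ ^ 2 := by
      filter_upwards [ae_timeMeasure_iff.1 h] with s hs hsτ
      have hsT : s ∈ Ioo 0 T := ⟨hsτ.1, hsτ.2.trans hτ.2⟩
      have h1 := hs hsT
      have h2 := norm_sq_primitive_sub_le hV h0 (Ioo_subset_Icc_self hsT) hsT.1.le
      simp only [intervalIntegral.integral_same, sub_zero] at h2
      have h3 := hWm s (Ioo_subset_Icc_self hsT) τ hτ' hsτ.2.le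
      have hW0 : 0 ≤ W s := intervalIntegral.integral_nonneg hsT.1.le fun r _ => sq_nonneg _
      set Us := ∫ r in (0 : ℝ)..s, V r
      have h4 : ‖Us‖ ^ 2 ≤ τ * W τ := h2.trans (mul_le_mul hsτ.2.le h3 hW0 hτ.1.le)
      have h5 : -inner ℝ (V s) Us ≤ τ / 2 * ‖V s‖ ^ 2 + 1 / 2 * W τ := by
        have h6 : -inner ℝ (V s) Us ≤ ‖V s‖ * ‖Us‖ := by
          have := abs_real_inner_le_norm (V s) Us
          linarith [neg_abs_le (inner ℝ (V s) Us)]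
        have h7 : 0 ≤ (τ * ‖V s‖ - ‖Us‖) ^ 2 / (2 * τ) := by have := hτ.1; positivity
        have h8 : (τ * ‖V s‖ - ‖Us‖) ^ 2 / (2 * τ) =
            τ / 2 * ‖V s‖ ^ 2 + 1 / (2 * τ) * ‖Us‖ ^ 2 - ‖V s‖ * ‖Us‖ := by
          have := hτ.1.ne'
          field_simp; ring
        have h9 : 1 / (2 * τ) * ‖Us‖ ^ 2 ≤ 1 / (2 * τ) * (τ * W τ) := by
          have := hτ.1
          gcongr
        have h10 : 1 / (2 * τ) * (τ * W τ) = 1 / 2 * W τ := by have := hτ.1.ne'; field_simp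
        linarith
      have h11 : M * ‖Us‖ ^ 2 ≤ M * (τ * W τ) := by gcongr
      have h12 : c₀ - W s ≤ e₀ - inner ℝ (V s) Us + M * ‖Us‖ ^ 2 := h1
      nlinarith
    have hint : ∫ _ in (0 : ℝ)..τ, (c₀ - e₀ - W τ * (3 / 2 + M * τ)) ≤
        ∫ s in (0 : ℝ)..τ, τ / 2 * ‖V s‖ ^ 2 := by
      rw [intervalIntegral_eq_timeMeasure hτ.1.le, intervalIntegral_eq_timeMeasure hτ.1.le]
      refine integral_mono_ae (integrable_const _) (Integrable.const_mul ?_ _)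
        (ae_timeMeasure_iff.2 hpt)
      exact iV2.mono_measure (Measure.restrict_mono (Ioo_subset_Ioo_right hτ'.2) le_rfl)
    rw [intervalIntegral.integral_const, intervalIntegral.integral_const_mul, sub_zero,
      smul_eq_mul] at hint
    have : τ * (c₀ - e₀ - W τ * (3 / 2 + M * τ)) ≤ τ * (1 / 2 * W τ) := by
      refine hint.trans (le_of_eq ?_)
      simp only [hW]; ring
    have := le_of_mul_le_mul_left this hτ.1
    linarith
  have hlim : Tendsto (fun τ => e₀ + W τ * (2 + M * τ)) (𝓝[>] 0) (𝓝 (e₀ + 0 * (2 + M * 0))) := by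
    refine ((tendsto_primitive_zero hT iV2).mul ?_).const_add e₀
    have : Continuous fun τ : ℝ => 2 + M * τ := by fun_prop
    exact (this.tendsto 0).mono_left nhdsWithin_le_nhds
  rw [zero_mul, add_zero] at hlim
  exact ge_of_tendsto hlim (by filter_upwards [Ioo_mem_nhdsGT hT] with τ hτ using key τ hτ)

variable {Θ : Type*} [MeasurableSpace Θ] {ν : Measure Θ} {c : Θ → ℝ}

lemma integrable_of_weight_mul_norm_sq {B : Type*} [NormedAddCommGroup B] (hc0 : ∀ θ, 0 ≤ c θ)
    (hI : Integrable (fun θ => (1 + c θ)⁻¹) ν) {q : Θ → B} (hq : AEStronglyMeasurable q ν)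
    (h : Integrable (fun θ => (1 + c θ) * ‖q θ‖ ^ 2) ν) : Integrable q ν :=
  ((hI.add h).const_mul (1 / 2)).mono' hq (Eventually.of_forall fun θ => by
    simpa using norm_le_half_inv_add_weight (hc0 θ) ‖q θ‖)

lemma integrable_rate_mul_norm_sq (hc : Measurable c) (hc0 : ∀ θ, 0 ≤ c θ)
    {B : Type*} [NormedAddCommGroup B] {q : Θ → B}
    (hq : AEStronglyMeasurable q ν) (h : Integrable (fun θ => (1 + c θ) * ‖q θ‖ ^ 2) ν) :
    Integrable (fun θ => c θ * ‖q θ‖ ^ 2) ν := by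
  refine h.mono' (hc.aestronglyMeasurable.mul (hq.norm.pow 2)) (Eventually.of_forall fun θ => ?_)
  have := hc0 θ
  rw [Real.norm_of_nonneg (by positivity)]
  nlinarith [sq_nonneg ‖q θ‖]

/-- The subgradient inequality for the history energy `½ ∫ c ‖q‖² dν` together with the quadratic
correction of a semiconvex energy at `∫ q dν`, which the history energy absorbs up to a multiple
of the norm of `L²(ν;H)`. -/
lemma history_subgradient [CompleteSpace H] (hc : Measurable c) (hc0 : ∀ θ, 0 ≤ c θ)
    (hI : Integrable (fun θ => (1 + c θ)⁻¹) ν) {κ b : ℝ} (hb : 1 ≤ b) (hκ : 0 ≤ κ)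
    (hN : κ * ∫ θ, (b + c θ)⁻¹ ∂ν ≤ 1 / 2) {v q₁ q₂ : Lp H 2 ν} {f : H}
    (hf : ∀ᵐ θ ∂ν, v θ + c θ • q₁ θ = f)
    (i₁ : Integrable (fun θ => (1 + c θ) * ‖q₁ θ‖ ^ 2) ν)
    (i₂ : Integrable (fun θ => (1 + c θ) * ‖q₂ θ‖ ^ 2) ν) :
    -inner ℝ v (q₂ - q₁) - b / 2 * ‖q₂ - q₁‖ ^ 2 + 1 / 2 * (∫ θ, c θ * ‖q₁ θ‖ ^ 2 ∂ν) -
        1 / 2 * (∫ θ, c θ * ‖q₂ θ‖ ^ 2 ∂ν) ≤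
      -inner ℝ f ((∫ θ, q₂ θ ∂ν) - ∫ θ, q₁ θ ∂ν) -
        κ * ‖(∫ θ, q₂ θ ∂ν) - ∫ θ, q₁ θ ∂ν‖ ^ 2 := by
  have m₁ : AEStronglyMeasurable q₁ ν := (Lp.memLp q₁).1
  have m₂ : AEStronglyMeasurable q₂ ν := (Lp.memLp q₂).1
  have j₁ := integrable_of_weight_mul_norm_sq hc0 hI m₁ i₁
  have j₂ := integrable_of_weight_mul_norm_sq hc0 hI m₂ i₂
  have k₁ := integrable_rate_mul_norm_sq hc hc0 m₁ i₁
  have k₂ := integrable_rate_mul_norm_sq hc hc0 m₂ i₂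
  have md : AEStronglyMeasurable (fun θ => q₂ θ - q₁ θ) ν := m₂.sub m₁
  have hd : (fun θ => (q₂ - q₁ : Lp H 2 ν) θ) =ᵐ[ν] fun θ => q₂ θ - q₁ θ := Lp.coeFn_sub q₂ q₁
  have sqd : ∀ θ, ‖q₂ θ - q₁ θ‖ ^ 2 ≤ 2 * (‖q₂ θ‖ ^ 2 + ‖q₁ θ‖ ^ 2) := fun θ => by
    have h1 := norm_sub_le (q₂ θ) (q₁ θ)
    have h2 : ‖q₂ θ - q₁ θ‖ ^ 2 ≤ (‖q₂ θ‖ + ‖q₁ θ‖) ^ 2 := by gcongr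
    nlinarith [sq_nonneg (‖q₂ θ‖ - ‖q₁ θ‖)]
  have idd : Integrable (fun θ => (1 + c θ) * ‖q₂ θ - q₁ θ‖ ^ 2) ν := by
    refine ((i₂.add i₁).const_mul 2).mono' ((hc.const_add 1).aestronglyMeasurable.mul
      (md.norm.pow 2)) (Eventually.of_forall fun θ => ?_)
    have h0 := hc0 θ
    rw [Real.norm_of_nonneg (by positivity)]
    calc (1 + c θ) * ‖q₂ θ - q₁ θ‖ ^ 2 ≤ (1 + c θ) * (2 * (‖q₂ θ‖ ^ 2 + ‖q₁ θ‖ ^ 2)) := by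
          gcongr; exact sqd θ
      _ = _ := by simp only [Pi.add_apply]; ring
  have kd := integrable_rate_mul_norm_sq hc hc0 md idd
  have nd : Integrable (fun θ => ‖q₂ θ - q₁ θ‖ ^ 2) ν :=
    (MemLp.integrable_norm_sq (Lp.memLp (q₂ - q₁))).congr (hd.mono fun θ h => by
      simp only at h; simp only [h])
  have ibd : Integrable (fun θ => (b + c θ) * ‖q₂ θ - q₁ θ‖ ^ 2) ν := by
    refine ((nd.const_mul b).add kd).congr (Eventually.of_forall fun θ => ?_)
    simp only [Pi.add_apply]; ring
  -- the choice of `b` makes the constant of the Cauchy–Schwarz inequality small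
  have hD : κ * ‖∫ θ, (q₂ θ - q₁ θ) ∂ν‖ ^ 2 ≤
      b / 2 * ‖q₂ - q₁‖ ^ 2 + 1 / 2 * ∫ θ, c θ * ‖q₂ θ - q₁ θ‖ ^ 2 ∂ν := by
    have h1 := norm_integral_sq_le_weight (by linarith : 0 < b) hc0
      (integrable_inv_weight hc hc0 hI hb) ibd
    have h2 : ∫ θ, (b + c θ) * ‖q₂ θ - q₁ θ‖ ^ 2 ∂ν =
        b * ‖q₂ - q₁‖ ^ 2 + ∫ θ, c θ * ‖q₂ θ - q₁ θ‖ ^ 2 ∂ν := by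
      rw [L2_norm_sq_eq_integral, ← integral_const_mul]
      have e : ∀ᵐ θ ∂ν, b * ‖(q₂ - q₁ : Lp H 2 ν) θ‖ ^ 2 = b * ‖q₂ θ - q₁ θ‖ ^ 2 :=
        hd.mono fun θ h => by simp only at h; rw [h]
      rw [integral_congr_ae e, ← integral_add (nd.const_mul b) kd]
      exact integral_congr_ae (Eventually.of_forall fun θ => by simp only; ring)
    have h3 : 0 ≤ ∫ θ, (b + c θ) * ‖q₂ θ - q₁ θ‖ ^ 2 ∂ν := integral_nonneg fun θ => by
      have := hc0 θ; positivity
    calc κ * ‖∫ θ, (q₂ θ - q₁ θ) ∂ν‖ ^ 2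
        ≤ κ * ((∫ θ, (b + c θ)⁻¹ ∂ν) * ∫ θ, (b + c θ) * ‖q₂ θ - q₁ θ‖ ^ 2 ∂ν) := by gcongr
      _ = (κ * ∫ θ, (b + c θ)⁻¹ ∂ν) * ∫ θ, (b + c θ) * ‖q₂ θ - q₁ θ‖ ^ 2 ∂ν := by ring
      _ ≤ 1 / 2 * ∫ θ, (b + c θ) * ‖q₂ θ - q₁ θ‖ ^ 2 ∂ν := by gcongr
      _ = _ := by rw [h2]; ring
  -- the history energy is quadratic, with derivative `c q₁ = f - v`
  have hfD : inner ℝ f (∫ θ, (q₂ θ - q₁ θ) ∂ν) = inner ℝ v (q₂ - q₁) +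
      (1 / 2 * (∫ θ, c θ * ‖q₂ θ‖ ^ 2 ∂ν) - 1 / 2 * (∫ θ, c θ * ‖q₁ θ‖ ^ 2 ∂ν) -
        1 / 2 * ∫ θ, c θ * ‖q₂ θ - q₁ θ‖ ^ 2 ∂ν) := by
    rw [← integral_inner (f := fun θ => q₂ θ - q₁ θ) (j₂.sub j₁) f, L2.inner_def,
      ← integral_const_mul, ← integral_const_mul,
      ← integral_const_mul, ← integral_sub (k₂.const_mul _) (k₁.const_mul _),
      ← integral_sub (f := fun θ => 1 / 2 * (c θ * ‖q₂ θ‖ ^ 2) - 1 / 2 * (c θ * ‖q₁ θ‖ ^ 2))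
        ((k₂.const_mul _).sub (k₁.const_mul _)) (kd.const_mul _),
      ← integral_add (g := fun θ => 1 / 2 * (c θ * ‖q₂ θ‖ ^ 2) - 1 / 2 * (c θ * ‖q₁ θ‖ ^ 2) -
          1 / 2 * (c θ * ‖q₂ θ - q₁ θ‖ ^ 2)) (L2.integrable_inner v (q₂ - q₁))
        (((k₂.const_mul _).sub (k₁.const_mul _)).sub (kd.const_mul _))]
    refine integral_congr_ae ?_
    filter_upwards [hf, hd] with θ h1 h2
    rw [h2, ← h1, inner_add_left, real_inner_smul_left]
    have h3 : ‖q₂ θ‖ ^ 2 = ‖q₁ θ‖ ^ 2 + 2 * inner ℝ (q₁ θ) (q₂ θ - q₁ θ) +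
        ‖q₂ θ - q₁ θ‖ ^ 2 := by
      rw [← norm_add_sq_real]; congr 2; abel
    rw [h3]; ring
  rw [← integral_sub j₂ j₁, hfD]
  linarith

end Balance

section EnergyBalance

variable {X H : Type*} [NormedAddCommGroup X] [NormedSpace ℝ X]
  [NormedAddCommGroup H] [InnerProductSpace ℝ H] [CompleteSpace H]
  {Θ : Type*} [MeasurableSpace Θ] {ν : Measure Θ} {c : Θ → ℝ}
  {ι : X →L[ℝ] H} {E : X → ℝ} {p T κ : ℝ} {u₀ : X} {u : ℝ → X} {F : ℝ → H} {V : ℝ → Lp H 2 ν}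

/-- The regularity of a superposed flow at almost every time. -/
lemma IsSuperposedFlow.ae_regular [NeZero ν] [SFinite ν] (h : IsSuperposedFlow ν c ι E p T κ u₀ u F)
    (hV : MemLp V 2 (timeMeasure T))
    (hU : ∀ t ∈ Icc 0 T, (∫ s in (0 : ℝ)..t, V s : Lp H 2 ν) =ᵐ[ν] fun θ => relax F (c θ) t) :
    ∀ᵐ t ∂(timeMeasure T),
      (∃ f : H, flowForce E T u t = toDualXL ι f ∧
        ∀ᵐ θ ∂ν, V t θ + c θ • (∫ s in (0 : ℝ)..t, V s : Lp H 2 ν) θ = f) ∧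
      Integrable (fun θ => (1 + c θ) * ‖(∫ s in (0 : ℝ)..t, V s : Lp H 2 ν) θ‖ ^ 2) ν ∧
      ι (flowIncr T u₀ u t) = ∫ θ, (∫ s in (0 : ℝ)..t, V s : Lp H 2 ν) θ ∂ν := by
  filter_upwards [h.ae_force_eq hV hU, h.ae_incr_eq hV hU] with t h1 h2
  obtain ⟨f, hf, hf'⟩ := h1
  exact ⟨⟨f, hf, hf'⟩, integrable_weight_mul_norm_sq h.measurable_rate h.rate_nonneg
    h.integrable_rate hf', h2⟩

/-- The history energy along the flow is integrable in time. -/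
lemma IsSuperposedFlow.integrable_history [NeZero ν] [SFinite ν]
    (h : IsSuperposedFlow ν c ι E p T κ u₀ u F) (hV : MemLp V 2 (timeMeasure T))
    (hU : ∀ t ∈ Icc 0 T, (∫ s in (0 : ℝ)..t, V s : Lp H 2 ν) =ᵐ[ν] fun θ => relax F (c θ) t) :
    Integrable (fun t => ∫ θ, c θ * ‖(∫ s in (0 : ℝ)..t, V s : Lp H 2 ν) θ‖ ^ 2 ∂ν)
      (timeMeasure T) := by
  have hF := h.continuous_primitive
  have hc := h.measurable_rate
  have hc0 := h.rate_nonneg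
  obtain ⟨C, hC0, hC⟩ := exists_integral_weight_mul_norm_sq_le (H := H) hc hc0 h.integrable_rate
  have i1 := ((MemLp.integrable_norm_sq hV).add (MemLp.integrable_norm_sq
    (memLp_two_primitive h.pos (integrable_of_memLp_two hV)))).const_mul C
  refine i1.mono' ?_ ?_
  · have mU : StronglyMeasurable fun q : ℝ × Θ => c q.2 * ‖relax F (c q.2) q.1‖ ^ 2 :=
      (hc.comp measurable_snd).stronglyMeasurable.mul
        (((hF.stronglyMeasurable.comp_measurable measurable_fst).sub
          ((hc.comp measurable_snd).stronglyMeasurable.smul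
            (stronglyMeasurable_expConv hF hc))).norm.pow 2)
    have := mU.aestronglyMeasurable.integral_prod_right' (μ := timeMeasure T) (ν := ν)
    refine this.congr ?_
    filter_upwards [ae_restrict_mem measurableSet_Ioo] with t ht
    refine integral_congr_ae ?_
    filter_upwards [hU t (Ioo_subset_Icc_self ht)] with θ hθ
    simp only [hθ]
  · filter_upwards [h.ae_regular hV hU] with t ht
    obtain ⟨⟨f, -, hf⟩, hi, -⟩ := ht
    rw [Real.norm_of_nonneg (integral_nonneg fun θ => by have := hc0 θ; positivity)]
    refine le_trans ?_ (hC _ _ f hf)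
    refine integral_mono_ae (integrable_rate_mul_norm_sq hc hc0 (Lp.memLp _).1 hi) hi
      (Eventually.of_forall fun θ => ?_)
    simp only
    nlinarith [sq_nonneg ‖(∫ s in (0 : ℝ)..t, V s : Lp H 2 ν) θ‖]

/-- The loss of a large rate `b` in the reconstruction is arbitrarily small. -/
lemma exists_rate_bound (hc : Measurable c) (hc0 : ∀ θ, 0 ≤ c θ)
    (hI : Integrable (fun θ => (1 + c θ)⁻¹) ν) (κ : ℝ) {ε : ℝ} (hε : 0 < ε) :
    ∃ b : ℝ, 1 ≤ b ∧ κ * ∫ θ, (b + c θ)⁻¹ ∂ν ≤ ε := by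
  have h1 := (tendsto_integral_inv_weight hc hc0 hI).const_mul κ
  rw [mul_zero] at h1
  obtain ⟨b, hb, hb'⟩ := ((h1.eventually (gt_mem_nhds hε)).and (eventually_ge_atTop 1)).exists
  exact ⟨b, hb', hb.le⟩

/-- The subgradient inequality for the augmented energy along the flow. -/
lemma IsSuperposedFlow.subgradient (h : IsSuperposedFlow ν c ι E p T κ u₀ u F) {b : ℝ} (hb : 1 ≤ b)
    (hN : κ * ∫ θ, (b + c θ)⁻¹ ∂ν ≤ 1 / 2) {s : ℝ} (hs : s ∈ Ioo 0 T) {v q₁ q₂ : Lp H 2 ν} {f : H}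
    (hf : flowForce E T u s = toDualXL ι f) (hf' : ∀ᵐ θ ∂ν, v θ + c θ • q₁ θ = f)
    (i₁ : Integrable (fun θ => (1 + c θ) * ‖q₁ θ‖ ^ 2) ν)
    (i₂ : Integrable (fun θ => (1 + c θ) * ‖q₂ θ‖ ^ 2) ν)
    (e₁ : ι (u s - u₀) = ∫ θ, q₁ θ ∂ν) {x : X} (e₂ : ι (x - u₀) = ∫ θ, q₂ θ ∂ν) :
    -inner ℝ v (q₂ - q₁) - b / 2 * ‖q₂ - q₁‖ ^ 2 ≤
      (E x + 1 / 2 * ∫ θ, c θ * ‖q₂ θ‖ ^ 2 ∂ν) -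
        (E (u s) + 1 / 2 * ∫ θ, c θ * ‖q₁ θ‖ ^ 2 ∂ν) := by
  have h1 := history_subgradient h.measurable_rate h.rate_nonneg h.integrable_rate hb
    h.semiconvex_nonneg hN hf' i₁ i₂
  have h2 := h.semiconvex (u s) x
  have e : ι (x - u s) = (∫ θ, q₂ θ ∂ν) - ∫ θ, q₁ θ ∂ν := by
    rw [← e₁, ← e₂, ← map_sub]; congr 1; abel
  have h3 : gradE E (u s) (x - u s) = -inner ℝ f (ι (x - u s)) := by
    rw [← toDualXL_apply, ← hf, flowForce_of_mem hs, neg_apply, neg_neg]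
  rw [h3, e] at h2
  linarith

/-- The energy balance along a superposed flow, with an upper bound for the initial value. -/
lemma IsSuperposedFlow.exists_energy_eq [NeZero ν] [SFinite ν]
    (h : IsSuperposedFlow ν c ι E p T κ u₀ u F) (hV : MemLp V 2 (timeMeasure T))
    (hU : ∀ t ∈ Icc 0 T, (∫ s in (0 : ℝ)..t, V s : Lp H 2 ν) =ᵐ[ν] fun θ => relax F (c θ) t) :
    ∃ c₀ : ℝ, c₀ ≤ E u₀ ∧ ∀ᵐ t ∂(timeMeasure T),
      E (u t) + 1 / 2 * (∫ θ, c θ * ‖(∫ s in (0 : ℝ)..t, V s : Lp H 2 ν) θ‖ ^ 2 ∂ν) =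
        c₀ - ∫ r in (0 : ℝ)..t, ‖V r‖ ^ 2 := by
  obtain ⟨b, hb, hN⟩ := exists_rate_bound h.measurable_rate h.rate_nonneg h.integrable_rate κ
    one_half_pos
  set U : ℝ → Lp H 2 ν := fun t => ∫ s in (0 : ℝ)..t, V s with hUdef
  set G : Set ℝ := {t | t ∈ Ioo 0 T ∧ (∃ f : H, flowForce E T u t = toDualXL ι f ∧
        ∀ᵐ θ ∂ν, V t θ + c θ • U t θ = f) ∧ Integrable (fun θ => (1 + c θ) * ‖U t θ‖ ^ 2) ν ∧
      ι (u t - u₀) = ∫ θ, U t θ ∂ν}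
  have hG : ∀ᵐ t ∂(timeMeasure T), t ∈ G := by
    filter_upwards [h.ae_regular hV hU, ae_restrict_mem measurableSet_Ioo] with t ht htT
    refine ⟨htT, ht.1, ht.2.1, ?_⟩
    rw [← flowIncr_of_mem htT, ht.2.2]
  obtain ⟨c₀, hc₀⟩ := exists_ae_eq_const_sub_of_subgradient h.pos (by linarith : 0 ≤ b / 2) hV
    (h.integrable_energy.add ((h.integrable_history hV hU).const_mul (1 / 2))) hG (by
      rintro s ⟨hs, ⟨f, hf, hf'⟩, is, es⟩ t ⟨ht, -, it, et⟩
      exact h.subgradient hb hN hs hf hf' is it es et)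
  refine ⟨c₀, ?_, hc₀⟩
  refine le_of_ae_subgradient_zero h.pos (by linarith : 0 ≤ b / 2) hV ?_
  filter_upwards [hc₀, hG] with s h1 h2
  obtain ⟨hs, ⟨f, hf, hf'⟩, is, es⟩ := h2
  have z : ∀ᵐ θ ∂ν, (0 : Lp H 2 ν) θ = 0 := Lp.coeFn_zero H 2 ν
  have z2 : (fun θ => (1 + c θ) * ‖(0 : Lp H 2 ν) θ‖ ^ 2) =ᵐ[ν] fun _ => 0 := by
    filter_upwards with θ; simp
  have z3 : ∫ θ, (0 : Lp H 2 ν) θ ∂ν = 0 := integral_eq_zero_of_ae z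
  have z4 : ∫ θ, c θ * ‖(0 : Lp H 2 ν) θ‖ ^ 2 ∂ν = 0 := integral_eq_zero_of_ae (by
    filter_upwards with θ; simp)
  have h3 := h.subgradient hb hN hs hf hf' is
    ((integrable_zero _ _ _).congr z2.symm) es (x := u₀) (by rw [z3, sub_self, map_zero])
  rw [z4, zero_sub, inner_neg_right, neg_neg, norm_neg] at h3
  have h4 : E (u s) + 1 / 2 * (∫ θ, c θ * ‖U s θ‖ ^ 2 ∂ν) = c₀ - ∫ r in (0 : ℝ)..s, ‖V r‖ ^ 2 := h1
  rw [h4] at h3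
  linarith

/-- The energy balance along a superposed flow. The initial value is at least `E(u₀)` because `u(t)`
converges to `u₀` weakly in `X` as `t → 0` along almost every time, and `E` is semiconvex. -/
theorem IsSuperposedFlow.energy_balance [NeZero ν] [SFinite ν]
    (h : IsSuperposedFlow ν c ι E p T κ u₀ u F) (hd : DenseRange (toDualXL ι))
    (hcoer : ∀ R : ℝ, ∃ M : ℝ, ∀ᵐ t ∂(timeMeasure T), E (u t) ≤ R → ‖u t‖ ≤ M)
    (hV : MemLp V 2 (timeMeasure T))
    (hU : ∀ t ∈ Icc 0 T, (∫ s in (0 : ℝ)..t, V s : Lp H 2 ν) =ᵐ[ν] fun θ => relax F (c θ) t) :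
    ∀ᵐ t ∂(timeMeasure T),
      E (u t) + 1 / 2 * (∫ θ, c θ * ‖(∫ s in (0 : ℝ)..t, V s : Lp H 2 ν) θ‖ ^ 2 ∂ν) =
        E u₀ - ∫ r in (0 : ℝ)..t, ‖V r‖ ^ 2 := by
  have hc := h.measurable_rate
  have hc0 := h.rate_nonneg
  have hI := h.integrable_rate
  obtain ⟨c₀, hc₀le, hc₀⟩ := h.exists_energy_eq hV hU
  suffices hge : E u₀ ≤ c₀ by rwa [le_antisymm hc₀le hge] at hc₀
  set U : ℝ → Lp H 2 ν := fun t => ∫ s in (0 : ℝ)..t, V s with hUdef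
  have h0 : (0 : ℝ) ∈ Icc 0 T := ⟨le_rfl, h.pos.le⟩
  have hWT := tendsto_primitive_zero h.pos (MemLp.integrable_norm_sq hV)
  set W : ℝ → ℝ := fun t => ∫ r in (0 : ℝ)..t, ‖V r‖ ^ 2 with hW
  obtain ⟨M, hM⟩ := hcoer c₀
  obtain ⟨B, hB⟩ := h.energy_bounded_below
  set S : Set ℝ := {t | t ∈ Ioo 0 T ∧ ‖u t‖ ≤ M ∧ E (u t) ≤ c₀ ∧
    ∫ θ, c θ * ‖U t θ‖ ^ 2 ∂ν ≤ 2 * (c₀ + B) ∧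
    Integrable (fun θ => (1 + c θ) * ‖U t θ‖ ^ 2) ν ∧ ι (u t - u₀) = ∫ θ, U t θ ∂ν} with hS
  have hSae : ∀ᵐ t ∂(timeMeasure T), t ∈ S := by
    filter_upwards [h.ae_regular hV hU, ae_restrict_mem measurableSet_Ioo, hM, hB, hc₀]
      with t ht htT h1 h2 h3
    have hW0 : 0 ≤ W t := intervalIntegral.integral_nonneg htT.1.le fun r _ => sq_nonneg _
    have h4 : E (u t) + 1 / 2 * (∫ θ, c θ * ‖U t θ‖ ^ 2 ∂ν) = c₀ - W t := h3
    have h5 : 0 ≤ ∫ θ, c θ * ‖U t θ‖ ^ 2 ∂ν := integral_nonneg fun θ => by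
      have := hc0 θ; positivity
    have h6 : E (u t) ≤ c₀ := by linarith
    refine ⟨htT, h1 h6, h6, by linarith, ht.2.1, ?_⟩
    rw [← flowIncr_of_mem htT, ht.2.2]
  -- `t → 0` within the set of good times
  set l : Filter ℝ := 𝓝[>] 0 ⊓ 𝓟 S with hl
  have hlS : ∀ᶠ t in l, t ∈ S := mem_inf_of_right (mem_principal_self S)
  have hl0 : l ≤ 𝓝[>] 0 := inf_le_left
  have : l.NeBot := by
    refine inf_principal_neBot_iff.2 fun A hA => ?_
    obtain ⟨ε, hε, hεA⟩ := mem_nhdsGT_iff_exists_Ioo_subset.1 (inter_mem hA (Ioo_mem_nhdsGT h.pos))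
    have hε' : (0 : ℝ) < ε := hε
    by_contra hne
    rw [not_nonempty_iff_eq_empty] at hne
    have hz : volume (Ioo (0 : ℝ) ε) = 0 := by
      refine measure_mono_null (t := {t | ¬(t ∈ Ioo 0 T → t ∈ S)}) ?_ (ae_timeMeasure_iff.1 hSae)
      intro t ht hcon
      have h1 := hεA ht
      exact (eq_empty_iff_forall_notMem.1 hne t) ⟨h1.1, hcon h1.2⟩
    rw [Real.volume_Ioo, sub_zero, ENNReal.ofReal_eq_zero] at hz
    linarith
  have hUb : ∀ t ∈ S, ‖U t‖ ^ 2 ≤ t * W t := fun t ht => by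
    have := norm_sq_primitive_sub_le hV h0 (Ioo_subset_Icc_self ht.1) ht.1.1.le
    simpa only [intervalIntegral.integral_same, sub_zero] using this
  have htW : Tendsto (fun t => t * W t) l (𝓝 0) := by
    have h1 : Tendsto (fun t : ℝ => t) l (𝓝 0) :=
      (tendsto_id.mono_left (nhdsWithin_le_nhds (s := Ioi 0))).mono_left hl0
    simpa using h1.mul (hWT.mono_left hl0)
  -- convergence in `H`, by the estimate of the reconstruction with a large parameter `b`
  have hyH2 : Tendsto (fun t => ‖ι (u t - u₀)‖ ^ 2) l (𝓝 0) := by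
    rw [Metric.tendsto_nhds]
    intro ε hε
    obtain ⟨b, hb, hN⟩ := exists_rate_bound hc hc0 hI (|2 * (c₀ + B)|) (half_pos hε)
    set N := ∫ θ, (b + c θ)⁻¹ ∂ν
    have hN0 : 0 ≤ N := integral_nonneg fun θ => by have := hc0 θ; positivity
    have h1 : ∀ᶠ t in l, N * b * (t * W t) < ε / 2 := by
      have := htW.const_mul (N * b)
      rw [mul_zero] at this
      exact this.eventually (gt_mem_nhds (half_pos hε))
    filter_upwards [h1, hlS] with t h2 ht
    have hUt := hUb t ht
    obtain ⟨-, -, -, h3, h4, h5⟩ := ht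
    have k := integrable_rate_mul_norm_sq hc hc0 (Lp.memLp (U t)).1 h4
    have n := MemLp.integrable_norm_sq (Lp.memLp (U t))
    have e : ∀ θ, (b + c θ) * ‖U t θ‖ ^ 2 = b * ‖U t θ‖ ^ 2 + c θ * ‖U t θ‖ ^ 2 :=
      fun θ => by ring
    have h6 := norm_integral_sq_le_weight (by linarith : 0 < b) hc0
      (integrable_inv_weight hc hc0 hI hb)
      (((n.const_mul b).add k).congr (Eventually.of_forall fun θ => (e θ).symm))
    rw [integral_congr_ae (Eventually.of_forall e), integral_add (n.const_mul b) k,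
      integral_const_mul, ← L2_norm_sq_eq_integral, ← h5] at h6
    rw [dist_zero_right, Real.norm_of_nonneg (sq_nonneg _)]
    have h7 : N * (b * ‖U t‖ ^ 2) ≤ N * b * (t * W t) := by
      rw [mul_assoc]; gcongr
    have h8 : N * (∫ θ, c θ * ‖U t θ‖ ^ 2 ∂ν) ≤ |2 * (c₀ + B)| * N := by
      rw [mul_comm]; gcongr; exact h3.trans (le_abs_self _)
    have h9 : ‖ι (u t - u₀)‖ ^ 2 ≤
        N * (b * ‖U t‖ ^ 2) + N * (∫ θ, c θ * ‖U t θ‖ ^ 2 ∂ν) := by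
      rw [← mul_add]; exact h6
    linarith
  have hyH : Tendsto (fun t => ‖ι (u t - u₀)‖) l (𝓝 0) := by
    have := hyH2.sqrt
    simpa [Real.sqrt_sq] using this
  have hw := tendsto_apply_of_tendsto_zero hd (M := M + ‖u₀‖)
    (hlS.mono fun t ht => (norm_sub_le _ _).trans (by gcongr; exact ht.2.1)) hyH (gradE E u₀)
  have hlim := (hw.const_add (E u₀)).sub (hyH2.const_mul κ)
  rw [add_zero, mul_zero, sub_zero] at hlim
  exact le_of_tendsto hlim (hlS.mono fun t ht => (h.semiconvex u₀ (u t)).trans ht.2.2.1)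

end EnergyBalance

/-! ### The kernel `g_α` as a superposition of exponentials -/

section Kernel

variable {α : ℝ}

@[fun_prop]
lemma measurable_gKer (β : ℝ) : Measurable (gKer β) := by unfold gKer; fun_prop

@[fun_prop]
lemma measurable_wgt (α : ℝ) : Measurable (wgt α) := by unfold wgt; fun_prop

lemma gKer_pos {β t : ℝ} (hβ : 0 < β) (ht : 0 < t) : 0 < gKer β t :=
  div_pos (Real.rpow_pos_of_pos ht _) (Real.Gamma_pos_of_pos hβ)

lemma wgt_pos (hα : α ∈ Ioo (0 : ℝ) 1) {θ : ℝ} (hθ : θ ∈ Ioo (0 : ℝ) 1) : 0 < wgt α θ :=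
  mul_pos (gKer_pos (by linarith [hα.2]) hθ.1) (gKer_pos hα.1 (by linarith [hθ.2]))

/-- `w_α` is the density of the beta distribution with parameters `1 - α` and `α`. -/
lemma wgt_eq_betaPDFReal {θ : ℝ} (hθ : θ ∈ Ioo (0 : ℝ) 1) :
    wgt α θ = ProbabilityTheory.betaPDFReal (1 - α) α θ := by
  rw [ProbabilityTheory.betaPDFReal, if_pos ⟨hθ.1, hθ.2⟩, ProbabilityTheory.beta, wgt, gKer, gKer,
    sub_add_cancel, Real.Gamma_one, one_div_div]
  ring

lemma lintegral_wgt (hα : α ∈ Ioo (0 : ℝ) 1) :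
    ∫⁻ θ in Ioo (0 : ℝ) 1, ENNReal.ofReal (wgt α θ) = 1 := by
  rw [← ProbabilityTheory.lintegral_betaPDF_eq_one (α := 1 - α) (β := α) (by linarith [hα.2]) hα.1,
    ProbabilityTheory.lintegral_betaPDF]
  refine setLIntegral_congr_fun measurableSet_Ioo fun θ hθ => ?_
  rw [wgt_eq_betaPDFReal hθ, ProbabilityTheory.betaPDFReal, if_pos ⟨hθ.1, hθ.2⟩]

lemma integrableOn_wgt (hα : α ∈ Ioo (0 : ℝ) 1) : IntegrableOn (wgt α) (Ioo 0 1) := by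
  refine ⟨(measurable_wgt α).aestronglyMeasurable, ?_⟩
  rw [hasFiniteIntegral_iff_ofReal ((ae_restrict_iff' measurableSet_Ioo).2
    (Eventually.of_forall fun θ hθ => (wgt_pos hα hθ).le)), lintegral_wgt hα]
  exact ENNReal.one_lt_top

lemma integral_wgt (hα : α ∈ Ioo (0 : ℝ) 1) : ∫ θ in Ioo (0 : ℝ) 1, wgt α θ = 1 := by
  rw [integral_eq_lintegral_of_nonneg_ae ((ae_restrict_iff' measurableSet_Ioo).2
    (Eventually.of_forall fun θ hθ => (wgt_pos hα hθ).le))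
    (measurable_wgt α).aestronglyMeasurable, lintegral_wgt hα, ENNReal.toReal_one]

/-- The semigroup law `g_α * g_{1-α} = 1`. -/
lemma intervalIntegral_gKer_mul_gKer (hα : α ∈ Ioo (0 : ℝ) 1) {r t : ℝ} (h : r < t) :
    ∫ s in r..t, gKer α (t - s) * gKer (1 - α) (s - r) = 1 := by
  have hpos : 0 < t - r := sub_pos.2 h
  have h1 := intervalIntegral.integral_comp_mul_add (a := 0) (b := 1)
    (fun s => gKer α (t - s) * gKer (1 - α) (s - r)) hpos.ne' r
  rw [mul_zero, zero_add, mul_one, sub_add_cancel] at h1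
  have h2 : ∫ θ in (0 : ℝ)..1, gKer α (t - ((t - r) * θ + r)) *
      gKer (1 - α) ((t - r) * θ + r - r) = (t - r)⁻¹ := by
    have h3 : (t - r)⁻¹ = ∫ θ in Ioo (0 : ℝ) 1, (t - r)⁻¹ * wgt α θ := by
      rw [integral_const_mul, integral_wgt hα, mul_one]
    rw [intervalIntegral.integral_of_le zero_le_one, integral_Ioc_eq_integral_Ioo, h3]
    refine setIntegral_congr_fun measurableSet_Ioo fun θ hθ => ?_
    have e1 : t - ((t - r) * θ + r) = (t - r) * (1 - θ) := by ring
    have e2 : (t - r) * θ + r - r = (t - r) * θ := by ring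
    have h3 : 0 ≤ 1 - θ := by linarith [hθ.2]
    have e3 : (t - r) ^ (α - 1) * (t - r) ^ (1 - α - 1) = (t - r)⁻¹ := by
      rw [← Real.rpow_add hpos, ← Real.rpow_neg_one]; congr 1; ring
    simp only [wgt, gKer]
    rw [e1, e2, Real.mul_rpow hpos.le h3, Real.mul_rpow hpos.le hθ.1.le, ← e3]
    ring
  rw [h2, smul_eq_mul] at h1
  have := hpos.ne'
  field_simp at h1
  exact h1.symm

/-- `g_α` is the Laplace transform of the measure `w_α c₀ dθ` in the variable `c₁`. -/
lemma integral_exp_cOne (hα : α ∈ Ioo (0 : ℝ) 1) {r : ℝ} (hr : 0 < r) :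
    ∫ θ in Ioo (0 : ℝ) 1, wgt α θ * cZero θ * Real.exp (-(cOne θ * r)) = gKer α r := by
  have hα' : 0 < 1 - α := by linarith [hα.2]
  -- the substitution `x = c₁(θ)` leads to the integral of the Gamma function
  have himg : cOne '' Ioo 0 1 = Ioi 0 := by
    ext x
    constructor
    · rintro ⟨θ, hθ, rfl⟩
      exact div_pos hθ.1 (by linarith [hθ.2])
    · intro hx
      have hx' : (0 : ℝ) < x := hx
      refine ⟨x / (1 + x), ⟨by positivity, ?_⟩, ?_⟩
      · rw [div_lt_one (by positivity)]; linarith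
      · simp only [cOne]
        field_simp
        ring
  have hder : ∀ θ ∈ Ioo (0 : ℝ) 1, HasDerivWithinAt cOne (cZero θ ^ 2) (Ioo 0 1) θ := by
    intro θ hθ
    have h1 : (1 - θ) ≠ 0 := by linarith [hθ.2]
    have := (hasDerivAt_id' θ).fun_div ((hasDerivAt_id' θ).const_sub 1) h1
    refine (this.congr_deriv ?_).hasDerivWithinAt
    simp only [cZero]
    field_simp
    ring
  have hinj : InjOn cOne (Ioo 0 1) := by
    intro a ha b hb hab
    have h1 : (1 - a) ≠ 0 := by linarith [ha.2]
    have h2 : (1 - b) ≠ 0 := by linarith [hb.2]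
    simp only [cOne] at hab
    rw [div_eq_div_iff h1 h2] at hab
    linarith
  have h1 := integral_image_eq_integral_abs_deriv_smul measurableSet_Ioo hder hinj
    (fun x => x ^ (1 - α - 1) * Real.exp (-(r * x)))
  rw [himg, Real.integral_rpow_mul_exp_neg_mul_Ioi hα' hr] at h1
  have h2 : ∫ θ in Ioo (0 : ℝ) 1, wgt α θ * cZero θ * Real.exp (-(cOne θ * r)) =
      (Real.Gamma (1 - α) * Real.Gamma α)⁻¹ * ((1 / r) ^ (1 - α) * Real.Gamma (1 - α)) := by
    rw [h1, ← integral_const_mul]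
    refine setIntegral_congr_fun measurableSet_Ioo fun θ hθ => ?_
    have hθ' : 0 < 1 - θ := by linarith [hθ.2]
    simp only [wgt, gKer, cZero, cOne, smul_eq_mul]
    rw [abs_of_nonneg (by positivity), Real.div_rpow hθ.1.le hθ'.le, mul_comm r]
    have e : (1 - θ) ^ (α - 1) = (1 / (1 - θ)) * ((1 - θ) ^ (1 - α - 1))⁻¹ := by
      rw [← Real.rpow_neg hθ'.le, one_div, ← Real.rpow_neg_one, ← Real.rpow_add hθ']
      congr 1; ring
    rw [e, mul_inv]
    ring
  rw [h2, gKer, one_div, Real.inv_rpow hr.le, ← Real.rpow_neg hr.le]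
  have := (Real.Gamma_pos_of_pos hα').ne'
  have h3 : -(1 - α) = α - 1 := by ring
  rw [h3, mul_inv]
  field_simp

end Kernel

/-! ### Weighted spaces on `(0,1)` -/

section Weights

variable {w w' : ℝ → ℝ}

lemma ae_wgtMeasure_iff (hw : Measurable w) (hpos : ∀ θ ∈ Ioo (0 : ℝ) 1, 0 < w θ) {P : ℝ → Prop} :
    (∀ᵐ θ ∂(wgtMeasure w), P θ) ↔ ∀ᵐ θ ∂(volume.restrict (Ioo (0 : ℝ) 1)), P θ := by
  rw [wgtMeasure, ae_withDensity_iff hw.ennreal_ofReal, ae_restrict_iff' measurableSet_Ioo,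
    ae_restrict_iff' measurableSet_Ioo]
  refine eventually_congr (Eventually.of_forall fun θ => ?_)
  refine forall_congr' fun hθ => ?_
  simp [hpos θ hθ]

lemma MeasureTheory.AEStronglyMeasurable.of_wgtMeasure {B : Type*} [TopologicalSpace B] {f : ℝ → B}
    (hw : Measurable w) (hpos : ∀ θ ∈ Ioo (0 : ℝ) 1, 0 < w θ)
    (hf : AEStronglyMeasurable f (wgtMeasure w)) (w' : ℝ → ℝ) :
    AEStronglyMeasurable f (wgtMeasure w') := by
  refine hf.mono_ac ((withDensity_absolutelyContinuous _ _).trans ?_)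
  exact withDensity_absolutelyContinuous' hw.ennreal_ofReal.aemeasurable
    ((ae_restrict_iff' measurableSet_Ioo).2 (Eventually.of_forall fun θ hθ => by
      simp [hpos θ hθ]))

lemma integral_wgtMeasure {B : Type*} [NormedAddCommGroup B] [NormedSpace ℝ B]
    (hw : Measurable w) (hpos : ∀ θ ∈ Ioo (0 : ℝ) 1, 0 < w θ) (f : ℝ → B) :
    ∫ θ, f θ ∂(wgtMeasure w) = ∫ θ in Ioo (0 : ℝ) 1, w θ • f θ := by
  rw [wgtMeasure, integral_withDensity_eq_integral_toReal_smul hw.ennreal_ofReal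
    (Eventually.of_forall fun _ => ENNReal.ofReal_lt_top)]
  refine setIntegral_congr_fun measurableSet_Ioo fun θ hθ => ?_
  simp only [ENNReal.toReal_ofReal (hpos θ hθ).le]

lemma integrable_wgtMeasure_iff {B : Type*} [NormedAddCommGroup B] [NormedSpace ℝ B]
    (hw : Measurable w) (hpos : ∀ θ ∈ Ioo (0 : ℝ) 1, 0 < w θ) {f : ℝ → B} :
    Integrable f (wgtMeasure w) ↔ IntegrableOn (fun θ => w θ • f θ) (Ioo (0 : ℝ) 1) := by
  rw [wgtMeasure, integrable_withDensity_iff_integrable_smul' hw.ennreal_ofReal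
    (Eventually.of_forall fun _ => ENNReal.ofReal_lt_top), IntegrableOn]
  refine integrable_congr ((ae_restrict_iff' measurableSet_Ioo).2
    (Eventually.of_forall fun θ hθ => ?_))
  simp only [ENNReal.toReal_ofReal (hpos θ hθ).le]

/-- Comparison of square integrability for two weights. -/
lemma memLp_two_wgtMeasure {B : Type*} [NormedAddCommGroup B] {f g : ℝ → B}
    (hw : Measurable w) (hpos : ∀ θ ∈ Ioo (0 : ℝ) 1, 0 < w θ) {h : ℝ → ℝ}
    (hw' : Measurable w') (hpos' : ∀ θ ∈ Ioo (0 : ℝ) 1, 0 < w' θ)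
    (hf : Integrable (fun θ => h θ * ‖f θ‖ ^ 2) (wgtMeasure w))
    (hg : AEStronglyMeasurable g (wgtMeasure w'))
    (heq : ∀ θ ∈ Ioo (0 : ℝ) 1, w' θ * ‖g θ‖ ^ 2 = w θ * (h θ * ‖f θ‖ ^ 2)) :
    MemLp g 2 (wgtMeasure w') := by
  refine (memLp_two_iff_integrable_sq_norm hg).2 ?_
  rw [integrable_wgtMeasure_iff hw' hpos']
  refine (((integrable_wgtMeasure_iff hw hpos).1 hf).congr
    ((ae_restrict_iff' measurableSet_Ioo).2 (Eventually.of_forall fun θ hθ => ?_)))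
  exact (heq θ hθ).symm

end Weights

/-! ### The representing measure of `g_α` and the space `H̃` -/

section FracMeasure

variable {α : ℝ}

/-- The measure `w_α c₀ dθ` on `(0,1)`, which represents `g_α` in the variable `c₁`. -/
noncomputable def fracMeasure (α : ℝ) : Measure ℝ := wgtMeasure fun θ => wgt α θ * cZero θ

/-- The relaxation rate: `c₁` on `(0,1)`, made nonnegative on all of `ℝ`. -/
noncomputable def fracRate (θ : ℝ) : ℝ := |cOne θ|

lemma fracRate_of_mem {θ : ℝ} (hθ : θ ∈ Ioo (0 : ℝ) 1) : fracRate θ = cOne θ :=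
  abs_of_pos (div_pos hθ.1 (by linarith [hθ.2]))

lemma one_add_fracRate {θ : ℝ} (hθ : θ ∈ Ioo (0 : ℝ) 1) : 1 + fracRate θ = cZero θ := by
  have : 1 - θ ≠ 0 := by linarith [hθ.2]
  rw [fracRate_of_mem hθ, cOne, cZero]
  field_simp
  ring

lemma cZero_pos {θ : ℝ} (hθ : θ ∈ Ioo (0 : ℝ) 1) : 0 < cZero θ :=
  one_div_pos.2 (by linarith [hθ.2])

@[fun_prop]
lemma measurable_cZero : Measurable cZero := by unfold cZero; fun_prop

@[fun_prop]
lemma measurable_fracRate : Measurable fracRate := by unfold fracRate cOne; fun_prop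

lemma measurable_fracDensity (α : ℝ) : Measurable fun θ => wgt α θ * cZero θ := by fun_prop

lemma measurable_wgt0 (α : ℝ) : Measurable (wgt0 α) := by unfold wgt0; fun_prop

lemma fracDensity_pos (hα : α ∈ Ioo (0 : ℝ) 1) : ∀ θ ∈ Ioo (0 : ℝ) 1, 0 < wgt α θ * cZero θ :=
  fun _ hθ => mul_pos (wgt_pos hα hθ) (cZero_pos hθ)

lemma wgt0_pos (hα : α ∈ Ioo (0 : ℝ) 1) : ∀ θ ∈ Ioo (0 : ℝ) 1, 0 < wgt0 α θ :=
  fun _ hθ => mul_pos (wgt_pos hα hθ) (by linarith [hθ.2])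

instance sFinite_fracMeasure : SFinite (fracMeasure α) := by
  unfold fracMeasure wgtMeasure; infer_instance

lemma ae_fracMeasure_iff (hα : α ∈ Ioo (0 : ℝ) 1) {P : ℝ → Prop} :
    (∀ᵐ θ ∂(fracMeasure α), P θ) ↔ ∀ᵐ θ ∂(volume.restrict (Ioo (0 : ℝ) 1)), P θ :=
  ae_wgtMeasure_iff (measurable_fracDensity α) (fracDensity_pos hα)

lemma integral_fracMeasure {B : Type*} [NormedAddCommGroup B] [NormedSpace ℝ B]
    (hα : α ∈ Ioo (0 : ℝ) 1) (f : ℝ → B) :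
    ∫ θ, f θ ∂(fracMeasure α) = ∫ θ in Ioo (0 : ℝ) 1, (wgt α θ * cZero θ) • f θ :=
  integral_wgtMeasure (measurable_fracDensity α) (fracDensity_pos hα) f

lemma neZero_fracMeasure (hα : α ∈ Ioo (0 : ℝ) 1) : NeZero (fracMeasure α) := by
  refine ⟨fun h => ?_⟩
  have h1 : ∀ᵐ _ ∂(fracMeasure α), False := by rw [h]; simp
  rw [ae_fracMeasure_iff hα, ae_restrict_iff' measurableSet_Ioo] at h1
  have h2 : volume (Ioo (0 : ℝ) 1) = 0 :=
    measure_mono_null (t := {θ | ¬(θ ∈ Ioo (0 : ℝ) 1 → False)}) (fun θ hθ hcon => hcon hθ) h1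
  simp at h2

lemma integrable_fracRate (hα : α ∈ Ioo (0 : ℝ) 1) :
    Integrable (fun θ => (1 + fracRate θ)⁻¹) (fracMeasure α) := by
  rw [fracMeasure, integrable_wgtMeasure_iff (measurable_fracDensity α) (fracDensity_pos hα)]
  refine (integrableOn_wgt hα).congr_fun (fun θ hθ => ?_) measurableSet_Ioo
  simp only [smul_eq_mul]
  rw [one_add_fracRate hθ, mul_inv_cancel_right₀ (cZero_pos hθ).ne']

lemma integral_exp_fracRate (hα : α ∈ Ioo (0 : ℝ) 1) {r : ℝ} (hr : 0 < r) :
    ∫ θ, Real.exp (-(fracRate θ * r)) ∂(fracMeasure α) = gKer α r := by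
  rw [integral_fracMeasure hα, ← integral_exp_cOne hα hr]
  refine setIntegral_congr_fun measurableSet_Ioo fun θ hθ => ?_
  simp only [smul_eq_mul, fracRate_of_mem hθ]

lemma integrable_exp_fracRate (hα : α ∈ Ioo (0 : ℝ) 1) {r : ℝ} (hr : 0 < r) :
    Integrable (fun θ => Real.exp (-(fracRate θ * r))) (fracMeasure α) :=
  .of_integral_ne_zero (by rw [integral_exp_fracRate hα hr]; exact (gKer_pos hα.1 hr).ne')

variable {H : Type*} [NormedAddCommGroup H] [InnerProductSpace ℝ H]

lemma memLp_cZero_smul (hα : α ∈ Ioo (0 : ℝ) 1) (g : Lp H 2 (fracMeasure α)) :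
    MemLp (fun θ => cZero θ • g θ) 2 (wgtMeasure (wgt0 α)) := by
  refine memLp_two_wgtMeasure (measurable_fracDensity α) (fracDensity_pos hα) (f := g)
    (h := fun _ => 1) (measurable_wgt0 α) (wgt0_pos hα) ?_ ?_ fun θ hθ => ?_
  · have := MemLp.integrable_norm_sq (Lp.memLp g)
    simp only [one_mul]
    exact this
  · exact measurable_cZero.aestronglyMeasurable.smul (AEStronglyMeasurable.of_wgtMeasure
      (measurable_fracDensity α) (fracDensity_pos hα) (Lp.memLp g).1 _)
  · have : 1 - θ ≠ 0 := by linarith [hθ.2]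
    rw [norm_smul, Real.norm_of_nonneg (cZero_pos hθ).le, wgt0, cZero]
    field_simp

/-- Multiplication by `c₀` as an isometry of `L²(0,1; H; w_α c₀)` into `H̃`. -/
noncomputable def extIso (hα : α ∈ Ioo (0 : ℝ) 1) :
    Lp H 2 (fracMeasure α) →ₗᵢ[ℝ] HTilde H α where
  toFun g := (memLp_cZero_smul hα g).toLp _
  map_add' f g := by
    rw [← MemLp.toLp_add]
    refine MemLp.toLp_congr _ _ ?_
    have h1 : ∀ᵐ θ ∂(fracMeasure α), (f + g : Lp H 2 (fracMeasure α)) θ = f θ + g θ :=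
      Lp.coeFn_add f g
    rw [ae_fracMeasure_iff hα,
      ← ae_wgtMeasure_iff (measurable_wgt0 α) (wgt0_pos hα)] at h1
    filter_upwards [h1] with θ hθ
    rw [hθ, smul_add, Pi.add_apply]
  map_smul' a g := by
    rw [RingHom.id_apply, ← MemLp.toLp_const_smul]
    refine MemLp.toLp_congr _ _ ?_
    have h1 : ∀ᵐ θ ∂(fracMeasure α), (a • g : Lp H 2 (fracMeasure α)) θ = a • g θ :=
      Lp.coeFn_smul a g
    rw [ae_fracMeasure_iff hα,
      ← ae_wgtMeasure_iff (measurable_wgt0 α) (wgt0_pos hα)] at h1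
    filter_upwards [h1] with θ hθ
    rw [hθ, Pi.smul_apply, smul_comm]
  norm_map' g := by
    rw [← sq_eq_sq₀ (norm_nonneg _) (norm_nonneg _), L2_norm_sq_eq_integral,
      L2_norm_sq_eq_integral, integral_wgtMeasure (measurable_wgt0 α) (wgt0_pos hα),
      integral_fracMeasure hα]
    refine integral_congr_ae ?_
    have h1 := MemLp.coeFn_toLp (memLp_cZero_smul hα g)
    rw [EventuallyEq, ae_wgtMeasure_iff (measurable_wgt0 α) (wgt0_pos hα)] at h1
    filter_upwards [h1, ae_restrict_mem measurableSet_Ioo] with θ e hθ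
    have : 1 - θ ≠ 0 := by linarith [hθ.2]
    have e' : ‖(MemLp.toLp _ (memLp_cZero_smul hα g) : HTilde H α) θ‖ = cZero θ * ‖g θ‖ := by
      rw [e, norm_smul, Real.norm_of_nonneg (cZero_pos hθ).le]
    simp only [LinearMap.coe_mk, AddHom.coe_mk, smul_eq_mul]
    rw [e', wgt0, cZero]
    field_simp

lemma coeFn_extIso (hα : α ∈ Ioo (0 : ℝ) 1) (g : Lp H 2 (fracMeasure α)) :
    ∀ᵐ θ ∂(volume.restrict (Ioo (0 : ℝ) 1)), extIso hα g θ = cZero θ • g θ := by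
  have h1 := MemLp.coeFn_toLp (memLp_cZero_smul hα g)
  rwa [EventuallyEq, ae_wgtMeasure_iff (measurable_wgt0 α) (wgt0_pos hα)] at h1

/-- The additional half order of integrability in `θ` places the extended state in `L²(w_α dθ)`. -/
lemma memLp_extIso (hα : α ∈ Ioo (0 : ℝ) 1) {g : Lp H 2 (fracMeasure α)}
    (hg : Integrable (fun θ => (1 + fracRate θ) * ‖g θ‖ ^ 2) (fracMeasure α)) :
    MemLp (extIso hα g) 2 (wgtMeasure (wgt α)) := by
  have hm : AEStronglyMeasurable (fun θ => cZero θ • g θ) (wgtMeasure (wgt α)) :=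
    measurable_cZero.aestronglyMeasurable.smul (AEStronglyMeasurable.of_wgtMeasure
      (measurable_fracDensity α) (fracDensity_pos hα) (Lp.memLp g).1 _)
  have h1 : MemLp (fun θ => cZero θ • g θ) 2 (wgtMeasure (wgt α)) := by
    refine memLp_two_wgtMeasure (measurable_fracDensity α) (fracDensity_pos hα)
      (measurable_wgt α) (fun θ hθ => wgt_pos hα hθ) hg hm fun θ hθ => ?_
    rw [norm_smul, Real.norm_of_nonneg (cZero_pos hθ).le, one_add_fracRate hθ]
    ring
  refine h1.ae_eq ?_
  rw [EventuallyEq, ae_wgtMeasure_iff (measurable_wgt α) (fun θ hθ => wgt_pos hα hθ)]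
  filter_upwards [coeFn_extIso hα g] with θ hθ using hθ.symm

lemma reconstruct_extIso (hα : α ∈ Ioo (0 : ℝ) 1) (u₀ : H) (g : Lp H 2 (fracMeasure α)) :
    reconstruct α u₀ (extIso hα g) = u₀ + ∫ θ, g θ ∂(fracMeasure α) := by
  rw [reconstruct, integral_fracMeasure hα]
  congr 1
  refine integral_congr_ae ?_
  filter_upwards [coeFn_extIso hα g] with θ hθ
  rw [hθ, smul_smul]

lemma historyEnergy_extIso (hα : α ∈ Ioo (0 : ℝ) 1) (g : Lp H 2 (fracMeasure α)) :
    historyEnergy α (extIso hα g) =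
      1 / 2 * ∫ θ, fracRate θ * ‖g θ‖ ^ 2 ∂(fracMeasure α) := by
  rw [historyEnergy, integral_fracMeasure hα]
  congr 1
  refine integral_congr_ae ?_
  filter_upwards [coeFn_extIso hα g, ae_restrict_mem measurableSet_Ioo] with θ h1 hθ
  have : 1 - θ ≠ 0 := by linarith [hθ.2]
  rw [h1, norm_smul, Real.norm_of_nonneg (cZero_pos hθ).le, wgt1, smul_eq_mul, fracRate_of_mem hθ,
    cZero, cOne]
  ring

end FracMeasure

/-! ### Fractional integrals and superpositions of exponentials -/

section Representation

variable {α : ℝ} {B : Type*} [NormedAddCommGroup B] [NormedSpace ℝ B]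

lemma integrable_gKer_sub {β : ℝ} (hβ : 0 < β) {t : ℝ} (ht : 0 ≤ t) :
    Integrable (fun s => gKer β (t - s)) (timeMeasure t) := by
  have h1 : IntervalIntegrable (gKer β) volume 0 t := by
    unfold gKer
    exact (intervalIntegral.intervalIntegrable_rpow' (by linarith)).div_const _
  have h2 := h1.comp_sub_left t
  rw [sub_zero, sub_self] at h2
  exact ((intervalIntegrable_iff_integrableOn_Ioo_of_le ht).1 h2.symm)

/-- The superposition of the exponential convolutions is the convolution with `g_α`. -/
lemma integral_expConv_fracRate [CompleteSpace B] (hα : α ∈ Ioo (0 : ℝ) 1) {F : ℝ → B}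
    (hF : Continuous F) {t : ℝ} (ht : 0 ≤ t) :
    ∫ θ, expConv (fracRate θ) F t ∂(fracMeasure α) = ∫ s in (0 : ℝ)..t, gKer α (t - s) • F s := by
  have hm : StronglyMeasurable fun q : ℝ × ℝ =>
      Real.exp (-(fracRate q.2 * (t - q.1))) • F q.1 := by
    refine StronglyMeasurable.smul ?_ (hF.stronglyMeasurable.comp_measurable measurable_fst)
    exact Measurable.stronglyMeasurable (by fun_prop)
  have hi : Integrable (fun q : ℝ × ℝ => Real.exp (-(fracRate q.2 * (t - q.1))) • F q.1)
      ((timeMeasure t).prod (fracMeasure α)) := by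
    refine (integrable_prod_iff hm.aestronglyMeasurable).2 ⟨?_, ?_⟩
    · filter_upwards [ae_restrict_mem measurableSet_Ioo] with s hs
      exact (integrable_exp_fracRate hα (sub_pos.2 hs.2)).smul_const _
    · obtain ⟨M, hM⟩ := (isCompact_Icc (a := 0) (b := t)).exists_bound_of_continuousOn
        hF.continuousOn
      have h1 : Integrable (fun s => gKer α (t - s) * ‖F s‖) (timeMeasure t) :=
        (integrable_gKer_sub hα.1 ht).mul_bdd (c := M) hF.norm.aestronglyMeasurable
          (ae_timeMeasure_iff.2 (Eventually.of_forall fun s hs => by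
            rw [norm_norm]; exact hM s (Ioo_subset_Icc_self hs)))
      refine h1.congr ?_
      filter_upwards [ae_restrict_mem measurableSet_Ioo] with s hs
      simp only [norm_smul, Real.norm_of_nonneg (Real.exp_pos _).le]
      rw [integral_mul_const, integral_exp_fracRate hα (sub_pos.2 hs.2)]
  simp only [expConv_eq_timeMeasure ht]
  refine (integral_integral_swap hi).symm.trans ?_
  rw [intervalIntegral_eq_timeMeasure ht]
  refine integral_congr_ae ?_
  filter_upwards [ae_restrict_mem measurableSet_Ioo] with s hs
  rw [integral_smul_const, integral_exp_fracRate hα (sub_pos.2 hs.2)]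

/-- Integrability for the exchange of integrals in `g_α * (g_{1-α} * y)`, by Tonelli's theorem and
the semigroup law for the nonnegative kernels. -/
lemma integrableOn_triangle_gKer (hα : α ∈ Ioo (0 : ℝ) 1) {t : ℝ} {y : ℝ → B}
    (hy : AEStronglyMeasurable y volume) {Y : ℝ} (hY : ∀ᵐ r, ‖y r‖ ≤ Y) :
    IntegrableOn (fun q : ℝ × ℝ => gKer α (t - q.1) • gKer (1 - α) (q.1 - q.2) • y q.2)
      {q | 0 < q.2 ∧ q.2 ≤ q.1 ∧ q.1 ≤ t} := by
  have hα' : 0 < 1 - α := by linarith [hα.2]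
  set S : Set (ℝ × ℝ) := {q | 0 < q.2 ∧ q.2 ≤ q.1 ∧ q.1 ≤ t}
  have hS : MeasurableSet S :=
    (measurableSet_lt measurable_const measurable_snd).inter
      ((measurableSet_le measurable_snd measurable_fst).inter
        (measurableSet_le measurable_fst measurable_const))
  -- the scalar kernel is nonnegative and has integral one in the first variable
  set k : ℝ × ℝ → ℝ := S.indicator fun q => gKer α (t - q.1) * gKer (1 - α) (q.1 - q.2)
  have hkm : Measurable k := Measurable.indicator (by fun_prop) hS
  have hsec : ∀ r, 0 < r → r < t → (fun s => k (s, r)) =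
      (Icc r t).indicator fun s => gKer α (t - s) * gKer (1 - α) (s - r) := by
    intro r h0 h1
    ext s
    by_cases hs : s ∈ Icc r t
    · rw [indicator_of_mem hs]
      exact indicator_of_mem (show (s, r) ∈ S from ⟨h0, hs.1, hs.2⟩) _
    · rw [indicator_of_notMem hs]
      exact indicator_of_notMem (fun h : (s, r) ∈ S => hs ⟨h.2.1, h.2.2⟩) _
  have hsec0 : ∀ r, ¬(0 < r ∧ r < t) → r ≠ t → (fun s => k (s, r)) = fun _ => 0 := by
    intro r h0 h1
    ext s
    exact indicator_of_notMem (fun h : (s, r) ∈ S =>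
      h0 ⟨h.1, lt_of_le_of_ne (h.2.1.trans h.2.2) h1⟩) _
  have hint : ∀ r, 0 < r → r < t → ∫ s, k (s, r) = 1 := by
    intro r h0 h1
    rw [hsec r h0 h1, integral_indicator measurableSet_Icc, integral_Icc_eq_integral_Ioc,
      ← intervalIntegral.integral_of_le h1.le, intervalIntegral_gKer_mul_gKer hα h1]
  have hk0 : ∀ q, 0 ≤ k q := by
    refine fun q => indicator_nonneg (fun q hq => ?_) q
    unfold gKer
    have h1 : 0 ≤ t - q.1 := sub_nonneg.2 hq.2.2
    have h2 : 0 ≤ q.1 - q.2 := sub_nonneg.2 hq.2.1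
    have h3 := Real.Gamma_pos_of_pos hα.1
    have h4 := Real.Gamma_pos_of_pos hα'
    positivity
  have hne : ∀ᵐ r : ℝ, r ≠ t := compl_mem_ae_iff.2 (measure_singleton t)
  have hk : Integrable k (volume.prod volume) := by
    refine (integrable_prod_iff' hkm.aestronglyMeasurable).2 ⟨?_, ?_⟩
    · filter_upwards [hne] with r hr
      by_cases h : 0 < r ∧ r < t
      · exact .of_integral_ne_zero (by rw [hint r h.1 h.2]; exact one_ne_zero)
      · rw [hsec0 r h hr]; exact integrable_zero _ _ _
    · have h1 : Integrable ((Ioo 0 t).indicator fun _ : ℝ => (1 : ℝ)) :=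
        (integrable_indicator_iff measurableSet_Ioo).2 (by simp)
      refine h1.congr ?_
      filter_upwards [hne] with r hr
      simp only [Real.norm_of_nonneg (hk0 _)]
      by_cases h : 0 < r ∧ r < t
      · rw [indicator_of_mem (show r ∈ Ioo 0 t from h), hint r h.1 h.2]
      · rw [indicator_of_notMem (show r ∉ Ioo 0 t from h)]
        have := hsec0 r h hr
        simp only [this, integral_zero]
  rw [← integrable_indicator_iff hS, Measure.volume_eq_prod]
  refine (hk.mul_const Y).mono' ?_ ?_
  · refine AEStronglyMeasurable.indicator ?_ hS
    refine AEStronglyMeasurable.smul (Measurable.aestronglyMeasurable (by fun_prop)) ?_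
    exact AEStronglyMeasurable.smul (Measurable.aestronglyMeasurable (by fun_prop)) hy.comp_snd
  · have hY' : ∀ᵐ q : ℝ × ℝ ∂(volume.prod volume), ‖y q.2‖ ≤ Y :=
      Measure.quasiMeasurePreserving_snd.ae hY
    filter_upwards [hY'] with q hq
    by_cases hqS : q ∈ S
    · have := hk0 q
      simp only [k, indicator_of_mem hqS] at this ⊢
      rw [smul_smul, norm_smul, Real.norm_of_nonneg this]
      gcongr
    · simp only [k, indicator_of_notMem hqS]
      simp

/-- The time-integrated form of the inversion `y = g_α * d/dt (g_{1-α} * y)`. -/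
lemma integral_expConv_rlIntegral [CompleteSpace B] (hα : α ∈ Ioo (0 : ℝ) 1) {y : ℝ → B}
    (hy : AEStronglyMeasurable y volume) {Y : ℝ} (hY : ∀ᵐ r, ‖y r‖ ≤ Y) {F : ℝ → B}
    (hF : Continuous F) {t : ℝ} (ht : 0 ≤ t)
    (hFy : ∀ s ∈ Icc 0 t, F s = rlIntegral (1 - α) y s) :
    ∫ θ, expConv (fracRate θ) F t ∂(fracMeasure α) = expConv 0 y t := by
  rw [integral_expConv_fracRate hα hF ht, expConv_zero_left]
  have h1 : ∫ s in (0 : ℝ)..t, gKer α (t - s) • F s =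
      ∫ s in (0 : ℝ)..t, ∫ r in (0 : ℝ)..s, gKer α (t - s) • gKer (1 - α) (s - r) • y r := by
    refine intervalIntegral.integral_congr fun s hs => ?_
    rw [uIcc_of_le ht] at hs
    rw [hFy s hs, rlIntegral, intervalIntegral.integral_smul]
  rw [h1, intervalIntegral_triangle_swap (h := fun s r => gKer α (t - s) • gKer (1 - α) (s - r) •
    y r) ht (integrableOn_triangle_gKer hα hy hY)]
  refine intervalIntegral.integral_congr_ae ?_
  have hne : ∀ᵐ r : ℝ, r ≠ t := compl_mem_ae_iff.2 (measure_singleton t)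
  filter_upwards [hne] with r hr hr'
  rw [uIoc_of_le ht] at hr'
  simp only [smul_smul]
  rw [intervalIntegral.integral_smul_const,
    intervalIntegral_gKer_mul_gKer hα (lt_of_le_of_ne hr'.2 hr), one_smul]

end Representation

/-! ### The equation in time-integrated form -/

section DuBoisReymond

lemma exists_Icc_of_tsupport_subset {ζ : ℝ → ℝ} {T : ℝ} (hT : 0 < T) (hc : HasCompactSupport ζ)
    (hs : tsupport ζ ⊆ Ioo 0 T) :
    ∃ a b, 0 < a ∧ a ≤ b ∧ b < T ∧ ∀ t, t ∉ Icc a b → ζ t = 0 := by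
  rcases (tsupport ζ).eq_empty_or_nonempty with h | h
  · refine ⟨T / 2, T / 2, by linarith, le_rfl, by linarith, fun t _ => ?_⟩
    exact image_eq_zero_of_notMem_tsupport (by rw [h]; exact notMem_empty t)
  · have hcp : IsCompact (tsupport ζ) := hc
    have h1 := hs (hcp.sInf_mem h)
    have h2 := hs (hcp.sSup_mem h)
    refine ⟨_, _, h1.1, csInf_le hcp.bddBelow (hcp.sSup_mem h), h2.2, fun t ht => ?_⟩
    exact image_eq_zero_of_notMem_tsupport fun htm =>
      ht ⟨csInf_le hcp.bddBelow htm, le_csSup hcp.bddAbove htm⟩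

/-- A test function on `(0,T)` with integral zero is the derivative of a test function. -/
lemma exists_testFunction_deriv_eq {ψ : ℝ → ℝ} {T : ℝ} (hT : 0 < T) (hψ : ContDiff ℝ ∞ ψ)
    (hc : HasCompactSupport ψ) (hs : tsupport ψ ⊆ Ioo 0 T)
    (h0 : ∫ t in (0 : ℝ)..T, ψ t = 0) :
    ∃ η : ℝ → ℝ, ContDiff ℝ ∞ η ∧ HasCompactSupport η ∧ tsupport η ⊆ Ioo 0 T ∧ deriv η = ψ := by
  obtain ⟨a, b, ha, hab, hb, hz⟩ := exists_Icc_of_tsupport_subset hT hc hs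
  have hd : ∀ t, HasDerivAt (fun t => ∫ s in (0 : ℝ)..t, ψ s) (ψ t) t := fun t =>
    (hψ.continuous.integral_hasStrictDerivAt 0 t).hasDerivAt
  have hder : deriv (fun t => ∫ s in (0 : ℝ)..t, ψ s) = ψ := funext fun t => (hd t).deriv
  have hz2 : ∀ t, t ∉ Icc a b → ∫ s in (0 : ℝ)..t, ψ s = 0 := by
    intro t ht
    rw [mem_Icc, not_and_or, not_le, not_le] at ht
    rcases ht with ht | ht
    · refine intervalIntegral.integral_zero_ae (Eventually.of_forall fun s hs => hz s fun hs' => ?_)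
      have h1 := (uIoc_subset_uIcc hs).2
      have h2 : max 0 t < a := max_lt ha ht
      linarith [hs'.1]
    · have h1 : ∫ s in t..T, ψ s = 0 :=
        intervalIntegral.integral_zero_ae (Eventually.of_forall fun s hs => hz s fun hs' => by
          have h2 := (uIoc_subset_uIcc hs).1
          have h3 : b < min t T := lt_min ht hb
          linarith [hs'.2])
      rw [← intervalIntegral.integral_add_adjacent_intervals
        (hψ.continuous.intervalIntegrable 0 t) (hψ.continuous.intervalIntegrable t T), h1,
        add_zero] at h0
      exact h0
  have hsub : tsupport (fun t => ∫ s in (0 : ℝ)..t, ψ s) ⊆ Icc a b :=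
    closure_minimal (fun t ht => by_contra fun h => ht (hz2 t h)) isClosed_Icc
  refine ⟨_, ?_, isCompact_Icc.of_isClosed_subset (isClosed_tsupport _) hsub, ?_, hder⟩
  · rw [contDiff_infty_iff_deriv, hder]
    exact ⟨fun t => (hd t).differentiableAt, hψ⟩
  · exact hsub.trans fun t ht => ⟨ha.trans_le ht.1, ht.2.trans_lt hb⟩

/-- The lemma of du Bois-Reymond: a continuous function with an integrable weak derivative is its
primitive. -/
lemma eq_primitive_of_weak_deriv {φ w : ℝ → ℝ} {T : ℝ} (hT : 0 < T) (hφ : ContinuousOn φ (Icc 0 T))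
    (hφ0 : φ 0 = 0) (hw : Integrable w (timeMeasure T))
    (h : ∀ η : ℝ → ℝ, ContDiff ℝ ∞ η → HasCompactSupport η → tsupport η ⊆ Ioo 0 T →
      ∫ t, φ t * deriv η t ∂(timeMeasure T) = -∫ t, w t * η t ∂(timeMeasure T)) :
    ∀ t ∈ Icc 0 T, φ t = ∫ s in (0 : ℝ)..t, w s := by
  have h0 : (0 : ℝ) ∈ Icc 0 T := ⟨le_rfl, hT.le⟩
  have hTT : T ∈ Icc 0 T := ⟨hT.le, le_rfl⟩
  have iw : IntervalIntegrable w volume 0 T :=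
    intervalIntegrable_of_integrable_timeMeasure hw h0 hTT
  set D : ℝ → ℝ := fun t => φ t - ∫ s in (0 : ℝ)..t, w s with hD
  have acw : AbsolutelyContinuousOnInterval (fun t => ∫ s in (0 : ℝ)..t, w s) 0 T :=
    iw.absolutelyContinuousOnInterval_intervalIntegral left_mem_uIcc
  have cw : ContinuousOn (fun t => ∫ s in (0 : ℝ)..t, w s) (Icc 0 T) :=
    continuousOn_primitive_timeMeasure hT.le hw
  have cD : ContinuousOn D (Icc 0 T) := hφ.sub cw
  have iC : ∀ {g : ℝ → ℝ}, ContinuousOn g (Icc 0 T) → Integrable g (timeMeasure T) := fun hg =>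
    (hg.integrableOn_Icc).mono_set Ioo_subset_Icc_self
  -- `D` is orthogonal to derivatives of test functions
  have h1 : ∀ η : ℝ → ℝ, ContDiff ℝ ∞ η → HasCompactSupport η → tsupport η ⊆ Ioo 0 T →
      ∫ t, D t * deriv η t ∂(timeMeasure T) = 0 := by
    intro η hη hηc hηs
    have e0 : η 0 = 0 := image_eq_zero_of_notMem_tsupport fun hm => lt_irrefl _ (hηs hm).1
    have eT : η T = 0 := image_eq_zero_of_notMem_tsupport fun hm => lt_irrefl _ (hηs hm).2
    have cη' : Continuous (deriv η) := hη.continuous_deriv (by simp)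
    have acη : AbsolutelyContinuousOnInterval η 0 T :=
      (hη.of_le (by simp)).contDiffOn.absolutelyContinuousOnInterval
    have parts := acw.integral_mul_deriv_eq_deriv_mul acη
    rw [e0, eT, mul_zero, mul_zero, sub_zero, zero_sub] at parts
    have e1 : ∫ t in (0 : ℝ)..T, deriv (fun t => ∫ s in (0 : ℝ)..t, w s) t * η t =
        ∫ t in (0 : ℝ)..T, w t * η t := by
      refine intervalIntegral.integral_congr_ae ?_
      filter_upwards [iw.ae_hasDerivAt_integral] with t ht htm
      rw [(ht (uIoc_subset_uIcc htm) 0 left_mem_uIcc).deriv]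
    rw [e1, intervalIntegral_eq_timeMeasure hT.le, intervalIntegral_eq_timeMeasure hT.le] at parts
    simp only [hD, sub_mul]
    rw [integral_sub (f := fun t => φ t * deriv η t)
      (g := fun t => (∫ s in (0 : ℝ)..t, w s) * deriv η t)
      (iC (hφ.mul cη'.continuousOn)) (iC (cw.mul cη'.continuousOn)), parts,
      h η hη hηc hηs, sub_self]
  -- hence it is constant
  -- a fixed test function of integral one, by which test functions are corrected to have integral
  -- zero
  let χ : ContDiffBump (T / 2) := ⟨T / 8, T / 4, by linarith, by linarith⟩
  have hχd : ContDiff ℝ ∞ (χ.normed volume) := χ.contDiff_normed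
  have hχc : HasCompactSupport (χ.normed volume) := χ.hasCompactSupport_normed
  have hχs : tsupport (χ.normed volume) ⊆ Ioo 0 T := by
    rw [χ.tsupport_normed_eq, Real.closedBall_eq_Icc]
    intro t ht
    have h1 : T / 2 - T / 4 ≤ t := ht.1
    have h2 : t ≤ T / 2 + T / 4 := ht.2
    exact ⟨by linarith, by linarith⟩
  have tot : ∀ {g : ℝ → ℝ}, tsupport g ⊆ Ioo 0 T → ∀ k : ℝ → ℝ,
      ∫ t, g t * k t ∂(timeMeasure T) = ∫ t, g t * k t := by
    intro g hg k
    refine setIntegral_eq_integral_of_forall_compl_eq_zero fun t ht => ?_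
    rw [image_eq_zero_of_notMem_tsupport fun hm => ht (hg hm), zero_mul]
  have tot1 : ∀ {g : ℝ → ℝ}, tsupport g ⊆ Ioo 0 T → ∫ t, g t ∂(timeMeasure T) = ∫ t, g t := by
    intro g hg
    simpa using tot hg fun _ => 1
  set C := ∫ t, D t * χ.normed volume t ∂(timeMeasure T)
  have h2 : ∀ᵐ t, t ∈ Ioo 0 T → D t - C = 0 := by
    refine isOpen_Ioo.ae_eq_zero_of_integral_contDiff_smul_eq_zero
      (((cD.mono Ioo_subset_Icc_self).sub continuousOn_const).locallyIntegrableOn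
        measurableSet_Ioo) fun ζ hζ hζc hζs => ?_
    set A := ∫ t, ζ t
    have hψd : ContDiff ℝ ∞ fun t => ζ t - A * χ.normed volume t :=
      hζ.sub (contDiff_const.mul hχd)
    have hψc : HasCompactSupport fun t => ζ t - A * χ.normed volume t :=
      hζc.sub (hχc.mul_left (f := fun _ => A))
    have hψs : tsupport (fun t => ζ t - A * χ.normed volume t) ⊆ Ioo 0 T := by
      refine (tsupport_sub ζ (fun t => A * χ.normed volume t)).trans (union_subset hζs ?_)
      exact (tsupport_mul_subset_right (f := fun _ => A)).trans hχs
    have iζ := iC hζ.continuous.continuousOn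
    have iχ := iC hχd.continuous.continuousOn
    have hψ0 : ∫ t in (0 : ℝ)..T, (ζ t - A * χ.normed volume t) = 0 := by
      rw [intervalIntegral_eq_timeMeasure hT.le, integral_sub iζ (iχ.const_mul A),
        integral_const_mul, tot1 hζs, tot1 hχs, χ.integral_normed, mul_one, sub_self]
    obtain ⟨η, hη, hηc, hηs, hηd⟩ := exists_testFunction_deriv_eq hT hψd hψc hψs hψ0
    have h3 := h1 η hη hηc hηs
    rw [hηd] at h3
    have j1 : Integrable (fun t => D t * ζ t) (timeMeasure T) :=
      iC (cD.mul hζ.continuous.continuousOn)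
    have j2 : Integrable (fun t => D t * χ.normed volume t) (timeMeasure T) :=
      iC (cD.mul hχd.continuous.continuousOn)
    have e2 : ∫ t, D t * (ζ t - A * χ.normed volume t) ∂(timeMeasure T) =
        (∫ t, D t * ζ t ∂(timeMeasure T)) - A * C := by
      rw [← integral_const_mul, ← integral_sub j1 (j2.const_mul A)]
      refine integral_congr_ae (Eventually.of_forall fun t => ?_)
      simp only; ring
    rw [e2] at h3
    have e3 : ∫ t, ζ t • (D t - C) = (∫ t, D t * ζ t ∂(timeMeasure T)) - A * C := by
      simp only [smul_eq_mul]
      have eA : A = ∫ t, ζ t ∂(timeMeasure T) := (tot1 hζs).symm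
      rw [← tot hζs, mul_comm A, eA, ← integral_const_mul,
        ← integral_sub j1 (iζ.const_mul C)]
      refine integral_congr_ae (Eventually.of_forall fun t => ?_)
      simp only; ring
    rw [e3, h3]
  have hdense : Dense {t : ℝ | t ∈ Ioo 0 T → D t - C = 0} := Measure.dense_of_ae h2
  have h3 : ∀ t ∈ Icc 0 T, D t = C := by
    have hset : EqOn D (fun _ => C) (Ioo 0 T) := by
      intro t ht
      by_contra hne
      have ho : IsOpen (Ioo 0 T ∩ D ⁻¹' {C}ᶜ) :=
        (cD.mono Ioo_subset_Icc_self).isOpen_inter_preimage isOpen_Ioo isOpen_compl_singleton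
      obtain ⟨r, hr, hr'⟩ := hdense.inter_open_nonempty _ ho ⟨t, ht, hne⟩
      exact hr.2 (sub_eq_zero.1 (hr' hr.1))
    have := hset.of_subset_closure cD continuousOn_const Ioo_subset_Icc_self
      (by rw [closure_Ioo hT.ne])
    exact this
  have hD0 : D 0 = 0 := by simp [hD, hφ0]
  intro t ht
  have h4 := h3 t ht
  rw [← h3 0 h0, hD0] at h4
  exact sub_eq_zero.1 h4

end DuBoisReymond

/-! ### Growth and coercivity of the energy -/

section Growth

variable {X H : Type*} [NormedAddCommGroup X] [NormedSpace ℝ X]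
  [NormedAddCommGroup H] [InnerProductSpace ℝ H] {E : X → ℝ} {p : ℝ}

lemma le_one_add_rpow {x : ℝ} (hx : 0 ≤ x) (hp : 1 < p) : x ≤ 1 + x ^ p := by
  rcases le_total x 1 with h | h
  · have := Real.rpow_nonneg hx p
    linarith
  · have := Real.self_le_rpow_of_one_le h hp.le
    linarith

/-- The growth of the gradient bounds the growth of the energy. -/
lemma abs_energy_le (hp : 1 < p) (hE : ContDiff ℝ 1 E) {C₀ : ℝ}
    (hbound : ∀ x : X, ‖gradE E x‖ ≤ C₀ * ‖x‖ ^ (p - 1) + C₀) (x : X) :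
    |E x| ≤ |E 0| + |C₀| * (1 + 2 * ‖x‖ ^ p) := by
  have h1 : ‖E x - E 0‖ ≤ (|C₀| * ‖x‖ ^ (p - 1) + |C₀|) * ‖x - 0‖ := by
    refine (convex_closedBall (0 : X) ‖x‖).norm_image_sub_le_of_norm_fderiv_le (𝕜 := ℝ)
      (fun y _ => (hE.differentiable (by simp)) y) (fun y hy => ?_) (by simp) (by simp)
    refine (hbound y).trans ?_
    have hy' : ‖y‖ ≤ ‖x‖ := by simpa using hy
    have h2 := Real.rpow_nonneg (norm_nonneg y) (p - 1)
    have h3 : ‖y‖ ^ (p - 1) ≤ ‖x‖ ^ (p - 1) :=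
      Real.rpow_le_rpow (norm_nonneg y) hy' (by linarith)
    have h4 : C₀ * ‖y‖ ^ (p - 1) ≤ |C₀| * ‖x‖ ^ (p - 1) :=
      mul_le_mul (le_abs_self _) h3 h2 (abs_nonneg _)
    linarith [le_abs_self C₀]
  have h5 : ‖x‖ ^ (p - 1) * ‖x‖ = ‖x‖ ^ p := by
    rw [← Real.rpow_add_one' (norm_nonneg x) (by linarith)]; congr 1; ring
  have h6 := le_one_add_rpow (norm_nonneg x) hp
  rw [sub_zero, add_mul, mul_assoc, h5, Real.norm_eq_abs] at h1
  have h7 : |E x| ≤ |E 0| + |E x - E 0| := by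
    have := abs_add_le (E 0) (E x - E 0)
    rwa [add_sub_cancel] at this
  have h8 : |C₀| * ‖x‖ ≤ |C₀| * (1 + ‖x‖ ^ p) := by gcongr
  linarith

/-- Coercivity of the energy, by integration of the coercivity of its gradient along rays. -/
lemma coercive_energy (hp : 1 < p) (hE : ContDiff ℝ 1 E) (ι : X →L[ℝ] H) {C₁ C₂ : ℝ}
    (hcoer : ∀ x : X, C₁ * ‖x‖ ^ p - C₂ * ‖ι x‖ ^ 2 ≤ gradE E x x) (x : X) :
    E 0 + C₁ / p * ‖x‖ ^ p - C₂ / 2 * ‖ι x‖ ^ 2 ≤ E x := by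
  set k : ℝ → ℝ := fun s => E (s • x) - C₁ / p * ‖x‖ ^ p * s ^ p + C₂ / 2 * ‖ι x‖ ^ 2 * s ^ 2
  have hk : ∀ s, HasDerivAt k (gradE E (s • x) x - C₁ / p * ‖x‖ ^ p * (p * s ^ (p - 1)) +
      C₂ / 2 * ‖ι x‖ ^ 2 * (2 * s)) s := by
    intro s
    have h1 : HasDerivAt (fun s : ℝ => s • x) x s := by
      simpa using (hasDerivAt_id' s).smul_const x
    have h2 : HasDerivAt (fun s : ℝ => E (s • x)) (gradE E (s • x) x) s :=
      ((hE.differentiable (by simp)) (s • x)).hasFDerivAt.comp_hasDerivAt s h1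
    have h3 : HasDerivAt (fun s : ℝ => s ^ p) (p * s ^ (p - 1)) s :=
      Real.hasDerivAt_rpow_const (Or.inr hp.le)
    have h4 : HasDerivAt (fun s : ℝ => s ^ 2) (2 * s) s := by simpa using hasDerivAt_pow 2 s
    exact (h2.fun_sub (h3.const_mul _)).fun_add (h4.const_mul _)
  have hmono : MonotoneOn k (Icc 0 1) := by
    refine monotoneOn_of_deriv_nonneg (convex_Icc 0 1)
      (fun s _ => (hk s).continuousAt.continuousWithinAt)
      (fun s _ => (hk s).differentiableAt.differentiableWithinAt) fun s hs => ?_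
    rw [interior_Icc] at hs
    rw [(hk s).deriv]
    have h1 := hcoer (s • x)
    have hs0 := hs.1
    rw [norm_smul, map_smul, norm_smul, map_smul, Real.norm_of_nonneg hs0.le,
      Real.mul_rpow hs0.le (norm_nonneg x), smul_eq_mul] at h1
    have h2 : s ^ (p - 1) * s = s ^ p := by
      rw [← Real.rpow_add_one' hs0.le (by linarith)]; congr 1; ring
    have hp0 : p ≠ 0 := by linarith
    have h3 : 0 ≤ s * (gradE E (s • x) x - C₁ / p * ‖x‖ ^ p * (p * s ^ (p - 1)) +
        C₂ / 2 * ‖ι x‖ ^ 2 * (2 * s)) := by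
      have e : s * (gradE E (s • x) x - C₁ / p * ‖x‖ ^ p * (p * s ^ (p - 1)) +
          C₂ / 2 * ‖ι x‖ ^ 2 * (2 * s)) = s * gradE E (s • x) x -
          (C₁ * (s ^ p * ‖x‖ ^ p) - C₂ * (s * ‖ι x‖) ^ 2) := by
        rw [← h2]; field_simp; ring
      rw [e]; linarith
    exact nonneg_of_mul_nonneg_right h3 hs0
  have h1 := hmono (left_mem_Icc.2 zero_le_one) (right_mem_Icc.2 zero_le_one) zero_le_one
  simp only [k] at h1
  rw [zero_smul, one_smul, Real.zero_rpow (by linarith), Real.one_rpow] at h1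
  linarith

end Growth

/-! ### Variational solutions as superposed flows -/

section Variational

variable {X H : Type*} [NormedAddCommGroup X] [NormedSpace ℝ X]
  [NormedAddCommGroup H] [InnerProductSpace ℝ H]
  {ι : X →L[ℝ] H} {E : X → ℝ} {p α T : ℝ} {u₀ : X} {u : ℝ → X}

lemma IsVariationalSolution.exists_bound (hu : IsVariationalSolution ι E p α T (ι u₀) u) :
    ∃ Y, 0 ≤ Y ∧ ∀ᵐ t ∂(timeMeasure T), ‖ι (u t)‖ ≤ Y := by
  have h1 := hu.memLp_H.2
  rw [eLpNorm_exponent_top] at h1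
  refine ⟨(eLpNormEssSup (fun t => ι (u t)) (timeMeasure T)).toReal, ENNReal.toReal_nonneg, ?_⟩
  filter_upwards [ae_le_eLpNormEssSup (f := fun t => ι (u t)) (μ := timeMeasure T)] with t ht
  have := ENNReal.toReal_mono h1.ne ht
  simpa using this

/-- By separability of `X` the equation holds in `X'` at almost every time. -/
lemma IsVariationalSolution.exists_ae_eq [TopologicalSpace.SeparableSpace X]
    (hu : IsVariationalSolution ι E p α T (ι u₀) u) :
    ∃ w : ℝ → X →L[ℝ] ℝ, MemLp w (ENNReal.ofReal p.conjExponent) (timeMeasure T) ∧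
      IsWeakCaputoDeriv ι α T (fun t => ι (u t)) (ι u₀) w ∧
      ∀ᵐ t ∂(timeMeasure T), flowForce E T u t = w t := by
  obtain ⟨w, hw, hwd, heq⟩ := hu.equation
  refine ⟨w, hw, hwd, ?_⟩
  have h1 : ∀ᵐ t ∂(timeMeasure T), ∀ n : ℕ,
      w t (TopologicalSpace.denseSeq X n) + gradE E (u t) (TopologicalSpace.denseSeq X n) = 0 :=
    ae_all_iff.2 fun n => heq _
  filter_upwards [h1, ae_restrict_mem measurableSet_Ioo] with t ht htT
  rw [flowForce_of_mem htT]
  have h2 : (fun v => (-gradE E (u t)) v) = fun v => w t v := by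
    refine (TopologicalSpace.denseRange_denseSeq X).equalizer
      (-gradE E (u t)).continuous (w t).continuous (funext fun n => ?_)
    have := ht n
    simp only [Function.comp, neg_apply]
    linarith
  exact ContinuousLinearMap.ext fun v => congrFun h2 v

/-- A variational solution is a flow with the kernel `g_α`, written as a superposition of
exponentials. -/
lemma IsVariationalSolution.exists_isSuperposedFlow [CompleteSpace H]
    [TopologicalSpace.SeparableSpace X] (hdense : DenseRange ι) (hp : 1 < p)
    (hα : α ∈ Ioo (0 : ℝ) 1) (hT : 0 < T) (hE : ContDiff ℝ 1 E) {C₀ C₁ C₂ : ℝ} (hC₁ : 0 < C₁)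
    (hbound : ∀ x : X, ‖gradE E x‖ ≤ C₀ * ‖x‖ ^ (p - 1) + C₀)
    (hcoer : ∀ x : X, C₁ * ‖x‖ ^ p - C₂ * ‖ι x‖ ^ 2 ≤ gradE E x x) {κ : ℝ} (hκ : 0 ≤ κ)
    (hsemi : ∀ x₁ x₂ : X, E x₁ + gradE E x₁ (x₂ - x₁) - κ * ‖ι (x₂ - x₁)‖ ^ 2 ≤ E x₂)
    (hu : IsVariationalSolution ι E p α T (ι u₀) u) :
    ∃ F : ℝ → H, IsSuperposedFlow (fracMeasure α) fracRate ι E p T κ u₀ u F := by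
  obtain ⟨Y, hY0, hY⟩ := hu.exists_bound
  obtain ⟨w, hw, hwd, hwf⟩ := hu.exists_ae_eq
  have h0 : (0 : ℝ) ∈ Icc 0 T := ⟨le_rfl, hT.le⟩
  set G : ℝ → H := rlIntegral (1 - α) (fun s => ι (u s) - ι u₀)
  -- a continuous extension to the line; only its values on `[0, T]` matter
  set F : ℝ → H := fun t => G (projIcc 0 T hT.le t)
  have hFG : ∀ t ∈ Icc 0 T, F t = G t := fun t ht => by
    simp only [F]; rw [projIcc_of_mem hT.le ht]
  have hF : Continuous F := (continuousOn_iff_continuous_domRestrict.1 hu.continuousOn).comp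
    continuous_projIcc
  have hincr : MemLp (flowIncr T u₀ u) (ENNReal.ofReal p) volume :=
    memLp_indicator_timeMeasure (hu.memLp_X.sub (memLp_const u₀))
  have hforce : MemLp (flowForce E T u) (ENNReal.ofReal p.conjExponent) volume := by
    have h1 := memLp_indicator_timeMeasure hw
    refine h1.ae_eq ?_
    filter_upwards [ae_timeMeasure_iff.1 hwf] with t ht
    by_cases htT : t ∈ Ioo 0 T
    · rw [indicator_of_mem htT, ht htT]
    · rw [indicator_of_notMem htT, flowForce, indicator_of_notMem htT]
  have hbd : ∀ᵐ t, ‖ι (flowIncr T u₀ u t)‖ ≤ Y + ‖ι u₀‖ := by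
    filter_upwards [ae_timeMeasure_iff.1 hY] with t ht
    by_cases htT : t ∈ Ioo 0 T
    · rw [flowIncr_of_mem htT, map_sub]
      exact (norm_sub_le _ _).trans (by gcongr; exact ht htT)
    · rw [flowIncr, indicator_of_notMem htT, map_zero, norm_zero]
      positivity
  have hp1 : (1 : ℝ≥0∞) ≤ ENNReal.ofReal p.conjExponent := by
    rw [← ENNReal.ofReal_one]
    exact ENNReal.ofReal_le_ofReal (Real.HolderConjugate.conjExponent hp).symm.lt.le
  have hwi : Integrable w (timeMeasure T) := hw.integrable hp1
  refine ⟨F, ?_⟩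
  refine ⟨measurable_fracRate, fun θ => abs_nonneg _, integrable_fracRate hα, hp, hT, hdense, hκ,
    hsemi, hincr, ⟨Y + ‖ι u₀‖, by positivity, hbd⟩, hforce, ?_, ⟨-(E 0 - |C₂| / 2 * Y ^ 2), ?_⟩, hF,
    ?_, ?_⟩
  · have h1 : Integrable (fun t => ‖u t‖ ^ p) (timeMeasure T) := by
      have := hu.memLp_X.integrable_norm_rpow (by simpa using by linarith) ENNReal.ofReal_ne_top
      rwa [ENNReal.toReal_ofReal (by linarith)] at this
    refine ((integrable_const |E 0|).add
      (((integrable_const 1).add (h1.const_mul 2)).const_mul |C₀|)).mono'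
      (hE.continuous.comp_aestronglyMeasurable hu.memLp_X.1) (Eventually.of_forall fun t => ?_)
    exact abs_energy_le hp hE hbound (u t)
  · filter_upwards [hY] with t ht
    have h1 := coercive_energy hp hE ι hcoer (u t)
    have h2 : 0 ≤ C₁ / p * ‖u t‖ ^ p := by positivity
    have h3 : C₂ / 2 * ‖ι (u t)‖ ^ 2 ≤ |C₂| / 2 * Y ^ 2 := by
      gcongr; exact le_abs_self _
    linarith
  · intro t ht
    refine ContinuousLinearMap.ext fun v => ?_
    have iv : Integrable (fun s => w s v) (timeMeasure T) :=
      (ContinuousLinearMap.apply ℝ ℝ v).integrable_comp hwi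
    have h1 := eq_primitive_of_weak_deriv (φ := fun t => toDualX ι (G t) v) hT
      (((toDualXL ι).continuous.comp_continuousOn hu.continuousOn).clm_apply continuousOn_const)
      (by simp [G, rlIntegral, toDualX]) iv (fun η h1 h2 h3 => hwd v η h1 h2 h3) t ht
    rw [hFG t ht, toDualXL_eq, h1, ContinuousLinearMap.intervalIntegral_apply]
    · refine intervalIntegral.integral_congr_ae ?_
      have hne : ∀ᵐ s : ℝ, s ≠ T := compl_mem_ae_iff.2 (measure_singleton T)
      filter_upwards [ae_timeMeasure_iff.1 hwf, hne] with s hs hsT hst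
      rw [uIoc_of_le ht.1] at hst
      rw [hs ⟨hst.1, lt_of_le_of_ne (hst.2.trans ht.2) hsT⟩]
    · exact intervalIntegrable_of_integrable_timeMeasure
        ((hwi.congr (hwf.mono fun s hs => hs.symm))) h0 ht
  · intro t ht
    refine (integral_expConv_rlIntegral hα
      (ι.continuous.comp_aestronglyMeasurable hincr.1) hbd hF ht.1 fun s hs => ?_).symm
    have hsT : s ∈ Icc 0 T := ⟨hs.1, hs.2.trans ht.2⟩
    rw [hFG s hsT]
    simp only [G, rlIntegral]
    refine intervalIntegral.integral_congr_ae ?_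
    have hne : ∀ᵐ r : ℝ, r ≠ T := compl_mem_ae_iff.2 (measure_singleton T)
    filter_upwards [hne] with r hr hrs
    rw [uIoc_of_le hs.1] at hrs
    rw [flowIncr_of_mem ⟨hrs.1, lt_of_le_of_ne (hrs.2.trans hsT.2) hr⟩, map_sub]

end Variational

/-! ### Semiconvexity of the energy -/

section Semiconvex

variable {X H : Type*} [NormedAddCommGroup X] [NormedSpace ℝ X]
  [NormedAddCommGroup H] [InnerProductSpace ℝ H] {E : X → ℝ} {p T : ℝ}

lemma hasDerivAt_energy_line (hE : ContDiff ℝ 1 E) (x d : X) (s : ℝ) :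
    HasDerivAt (fun s : ℝ => E (x + s • d)) (gradE E (x + s • d) d) s := by
  have h1 : HasDerivAt (fun s : ℝ => x + s • d) d s := by
    simpa using ((hasDerivAt_id' s).smul_const d).const_add x
  exact ((hE.differentiable (by simp)) (x + s • d)).hasFDerivAt.comp_hasDerivAt s h1

/-- The gradient inequality for a semiconvex energy. -/
lemma IsSemiconvex.gradient_inequality {ι : X →L[ℝ] H} (hE : ContDiff ℝ 1 E) {lam : ℝ}
    (h : IsSemiconvex ι E lam) (x₁ x₂ : X) :
    E x₁ + gradE E x₁ (x₂ - x₁) - |lam| / 2 * ‖ι (x₂ - x₁)‖ ^ 2 ≤ E x₂ := by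
  set d := x₂ - x₁
  set g : ℝ → ℝ := fun s => E (x₁ + s • d) - lam / 2 * ‖ι (x₁ + s • d)‖ ^ 2
  have hg : ConvexOn ℝ univ g := by
    have := h.comp_affineMap (AffineMap.lineMap (k := ℝ) x₁ x₂)
    rw [preimage_univ] at this
    refine this.congr fun s _ => ?_
    simp only [g, Function.comp, AffineMap.lineMap_apply, vsub_eq_sub, vadd_eq_add, d]
    rw [add_comm]
  have hd : HasDerivAt g (gradE E x₁ d - lam * inner ℝ (ι x₁) (ι d)) 0 := by
    have h1 : HasDerivAt (fun s : ℝ => ι (x₁ + s • d)) (ι d) 0 := by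
      have : HasDerivAt (fun s : ℝ => x₁ + s • d) d 0 := by
        simpa using ((hasDerivAt_id' (0 : ℝ)).smul_const d).const_add x₁
      exact ι.hasFDerivAt.comp_hasDerivAt 0 this
    have h2 := (hasDerivAt_energy_line hE x₁ d 0).fun_sub (h1.norm_sq.const_mul (lam / 2))
    refine h2.congr_deriv ?_
    rw [zero_smul, add_zero]; ring
  have h1 := hg.le_slope_of_hasDerivAt (mem_univ 0) (mem_univ 1) one_pos hd
  rw [slope_def_field] at h1
  simp only [g, zero_smul, one_smul, add_zero, sub_zero, div_one] at h1
  have e : x₁ + d = x₂ := by simp [d]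
  have h2 : ‖ι x₂‖ ^ 2 = ‖ι x₁‖ ^ 2 + 2 * inner ℝ (ι x₁) (ι d) + ‖ι d‖ ^ 2 := by
    rw [← norm_add_sq_real, ← map_add, e]
  rw [e, h2] at h1
  have h3 : -(|lam| / 2 * ‖ι d‖ ^ 2) ≤ lam / 2 * ‖ι d‖ ^ 2 := by
    rw [← neg_mul]; gcongr
    linarith [neg_abs_le lam]
  linarith

/-- The square wave of period two. -/
noncomputable def squareWave (t : ℝ) : ℝ := if Even ⌊t⌋ then 1 else -1

lemma squareWave_add_one (t : ℝ) : squareWave (t + 1) = -squareWave t := by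
  have h1 : Even ⌊t + 1⌋ ↔ ¬ Even ⌊t⌋ := by rw [Int.floor_add_one, Int.even_add_one]
  unfold squareWave
  by_cases h : Even ⌊t⌋
  · rw [if_pos h, if_neg (by rwa [h1, not_not])]
  · rw [if_neg h, if_pos (h1.2 h), neg_neg]

lemma measurable_squareWave : Measurable squareWave :=
  Measurable.ite (Int.measurable_floor (MeasurableSet.of_discrete (s := {n : ℤ | Even n})))
    measurable_const measurable_const

lemma norm_squareWave (t : ℝ) : ‖squareWave t‖ = 1 := by
  unfold squareWave; split_ifs <;> simp

/-- Rapidly oscillating square waves tend weakly to zero: a shift by half a period changes the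
sign of the wave, but hardly changes the test function. -/
lemma tendsto_integral_squareWave {ψ : ℝ → ℝ} (hψ : Integrable ψ) :
    Tendsto (fun n : ℕ => ∫ t, squareWave ((n + 1 : ℝ) * t) * ψ t) atTop (𝓝 0) := by
  have hm : ∀ n : ℕ, Measurable fun t : ℝ => squareWave ((n + 1 : ℝ) * t) := fun n =>
    measurable_squareWave.comp (by fun_prop)
  have hint : ∀ (n : ℕ) {g : ℝ → ℝ}, Integrable g →
      Integrable (fun t => squareWave ((n + 1 : ℝ) * t) * g t) := fun n g hg =>
    hg.bdd_mul (c := 1) (hm n).aestronglyMeasurable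
      (Eventually.of_forall fun t => (norm_squareWave _).le)
  rw [Metric.tendsto_nhds]
  intro ε hε
  obtain ⟨g, hgc, hgψ, hg, hgi⟩ := hψ.exists_hasCompactSupport_integral_sub_le
    (show 0 < ε / 2 by positivity)
  -- the effect of the shift on a continuous function of compact support
  have hshift : Tendsto (fun n : ℕ => ∫ t, ‖g t - g (t + (n + 1 : ℝ)⁻¹)‖) atTop
      (𝓝 (∫ _ : ℝ, 0)) := by
    obtain ⟨M, hM⟩ := hg.bounded_above_of_compact_support hgc
    obtain ⟨R, hR⟩ := hgc.isBounded.subset_closedBall (0 : ℝ)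
    have hM0 : 0 ≤ M := (norm_nonneg _).trans (hM 0)
    have hgz : ∀ t, R < |t| → g t = 0 := fun t ht =>
      image_eq_zero_of_notMem_tsupport fun hm => by
        have := hR hm
        rw [mem_closedBall_zero_iff, Real.norm_eq_abs] at this
        linarith
    have hδ : ∀ n : ℕ, 0 ≤ (n + 1 : ℝ)⁻¹ ∧ (n + 1 : ℝ)⁻¹ ≤ 1 := fun n =>
      ⟨by positivity, inv_le_one_of_one_le₀ (by linarith [n.cast_nonneg (α := ℝ)])⟩
    refine tendsto_integral_of_dominated_convergence
      ((Icc (-(R + 1)) (R + 1)).indicator fun _ => 2 * M) (fun n => ?_) ?_ (fun n => ?_) ?_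
    · exact (by fun_prop : Continuous fun t => ‖g t - g (t + (n + 1 : ℝ)⁻¹)‖).aestronglyMeasurable
    · exact (integrable_indicator_iff measurableSet_Icc).2 continuous_const.integrableOn_Icc
    · refine Eventually.of_forall fun t => ?_
      rw [norm_norm]
      by_cases ht : t ∈ Icc (-(R + 1)) (R + 1)
      · rw [indicator_of_mem ht]
        refine (norm_sub_le _ _).trans ?_
        linarith [hM t, hM (t + (n + 1 : ℝ)⁻¹)]
      · rw [indicator_of_notMem ht]
        have h1 : R + 1 < |t| := by
          rw [← not_le, abs_le]; exact ht
        have h2 : R < |t + (n + 1 : ℝ)⁻¹| := by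
          have := abs_sub_abs_le_abs_sub t (-(n + 1 : ℝ)⁻¹)
          rw [abs_neg, abs_of_nonneg (hδ n).1, sub_neg_eq_add] at this
          linarith [(hδ n).2]
        rw [hgz t (by linarith), hgz _ h2, sub_zero, norm_zero]
    · refine Eventually.of_forall fun t => ?_
      have h1 : Tendsto (fun n : ℕ => t + (n + 1 : ℝ)⁻¹) atTop (𝓝 (t + 0)) :=
        (tendsto_inv_atTop_zero.comp (tendsto_natCast_atTop_atTop.atTop_add
          tendsto_const_nhds)).const_add t
      rw [add_zero] at h1
      have h2 := ((hg.tendsto t).comp h1).const_sub (g t)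
      rw [sub_self] at h2
      simpa using h2.norm
  rw [integral_zero] at hshift
  filter_upwards [hshift.eventually (gt_mem_nhds hε)] with n hn
  set δ : ℝ := (n + 1 : ℝ)⁻¹
  set r : ℝ → ℝ := fun t => squareWave ((n + 1 : ℝ) * t)
  have hr : ∀ t, r (t + δ) = -r t := fun t => by
    have : (n + 1 : ℝ) * (t + δ) = (n + 1) * t + 1 := by
      have : (n + 1 : ℝ) ≠ 0 := by positivity
      simp only [δ]; field_simp
    simp only [r]
    rw [this, squareWave_add_one]
  have hgshift : Integrable fun t => g (t + δ) := hgi.comp_add_right δ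
  have h1 : 2 * ∫ t, r t * g t = ∫ t, r t * (g t - g (t + δ)) := by
    have h2 : ∫ t, r t * g (t + δ) = -∫ t, r t * g t := by
      rw [← integral_add_right_eq_self (fun t => r t * g t) δ, ← integral_neg]
      refine integral_congr_ae (Eventually.of_forall fun t => ?_)
      simp only [hr]; ring
    have h3 : ∫ t, r t * (g t - g (t + δ)) = (∫ t, r t * g t) - ∫ t, r t * g (t + δ) := by
      rw [← integral_sub (hint n hgi) (hint n hgshift)]
      exact integral_congr_ae (Eventually.of_forall fun t => by simp only [r]; ring)
    rw [h3, h2]; ring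
  have hle : ∀ f : ℝ → ℝ, ‖∫ t, r t * f t‖ ≤ ∫ t, ‖f t‖ := fun f => by
    refine (norm_integral_le_integral_norm _).trans (le_of_eq ?_)
    refine integral_congr_ae (Eventually.of_forall fun t => ?_)
    simp only [r, norm_mul, norm_squareWave, one_mul]
  have h4 : ‖2 * ∫ t, r t * g t‖ ≤ ∫ t, ‖g t - g (t + δ)‖ := by rw [h1]; exact hle _
  rw [norm_mul, Real.norm_two] at h4
  have h5 : ∫ t, r t * ψ t = (∫ t, r t * (ψ t - g t)) + ∫ t, r t * g t := by
    rw [← integral_add (hint n (g := fun t => ψ t - g t) (hψ.sub hgi)) (hint n hgi)]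
    exact integral_congr_ae (Eventually.of_forall fun t => by simp only [r]; ring)
  have h6 := hle fun t => ψ t - g t
  rw [dist_zero_right]
  have h7 : ‖∫ t, r t * ψ t‖ < ε := by
    rw [h5]
    refine (norm_add_le _ _).trans_lt ?_
    linarith
  exact h7

/-- A weakly continuous realization forces the gradient to be affine: test the continuity with
functions that oscillate rapidly between two values. -/
lemma GradWeakToWeak.map_midpoint (hp : 1 < p) (hT : 0 < T) (h : GradWeakToWeak E p T) (a b : X) :
    gradE E (midpoint ℝ a b) = midpoint ℝ (gradE E a) (gradE E b) := by
  set r : ℕ → ℝ → ℝ := fun n t => squareWave ((n + 1 : ℝ) * t)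
  have hrm : ∀ n, Measurable (r n) := fun n => measurable_squareWave.comp (by fun_prop)
  -- `U n` takes the values `a` and `b` only
  set U : ℕ → ℝ → X := fun n t => midpoint ℝ a b + r n t • ((1 / 2 : ℝ) • (a - b))
  have hUab : ∀ n t, (r n t = 1 ∧ U n t = a) ∨ (r n t = -1 ∧ U n t = b) := by
    intro n t
    have hmid : midpoint ℝ a b = (1 / 2 : ℝ) • (a + b) := by
      rw [midpoint_eq_smul_add]; norm_num
    by_cases hev : Even ⌊(n + 1 : ℝ) * t⌋
    · have h1 : r n t = 1 := if_pos hev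
      refine Or.inl ⟨h1, ?_⟩
      simp only [U, h1, hmid]
      module
    · have h1 : r n t = -1 := if_neg hev
      refine Or.inr ⟨h1, ?_⟩
      simp only [U, h1, hmid]
      module
  have hlim : ∀ ψ : ℝ → ℝ, Integrable ψ (timeMeasure T) →
      Tendsto (fun n => ∫ t, r n t * ψ t ∂(timeMeasure T)) atTop (𝓝 0) := by
    intro ψ hψ
    have h1 := tendsto_integral_squareWave ((integrable_indicator_iff measurableSet_Ioo).2 hψ)
    refine h1.congr fun n => ?_
    rw [timeMeasure, ← integral_indicator measurableSet_Ioo]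
    refine integral_congr_ae (Eventually.of_forall fun t => ?_)
    exact (indicator_mul_right (i := t) (Ioo 0 T) (r n) ψ).symm
  have hri : ∀ n {ψ : ℝ → ℝ}, Integrable ψ (timeMeasure T) →
      Integrable (fun t => r n t * ψ t) (timeMeasure T) := fun n ψ hψ =>
    hψ.bdd_mul (c := 1) (hrm n).aestronglyMeasurable
      (Eventually.of_forall fun t => (norm_squareWave _).le)
  have hUm : ∀ n, MemLp (U n) (ENNReal.ofReal p) (timeMeasure T) := by
    intro n
    refine MemLp.of_bound (aestronglyMeasurable_const.add
      ((hrm n).aestronglyMeasurable.smul aestronglyMeasurable_const)) (max ‖a‖ ‖b‖)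
      (Eventually.of_forall fun t => ?_)
    rcases hUab n t with h1 | h1
    · rw [h1.2]; exact le_max_left _ _
    · rw [h1.2]; exact le_max_right _ _
  have hp1 : (1 : ℝ≥0∞) ≤ ENNReal.ofReal p.conjExponent := by
    rw [← ENNReal.ofReal_one]
    exact ENNReal.ofReal_le_ofReal (Real.HolderConjugate.conjExponent hp).symm.lt.le
  refine ContinuousLinearMap.ext fun z => ?_
  have h1 := h U (fun _ => midpoint ℝ a b) hUm (memLp_const _) (by
    intro φ hφ
    have iφ := hφ.integrable hp1
    have iφv : ∀ v : X, Integrable (fun t => φ t v) (timeMeasure T) := fun v =>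
      (ContinuousLinearMap.apply ℝ ℝ v).integrable_comp iφ
    have h2 := (hlim _ (iφv ((1 / 2 : ℝ) • (a - b)))).const_add
      (∫ t, φ t (midpoint ℝ a b) ∂(timeMeasure T))
    rw [add_zero] at h2
    refine h2.congr fun n => ?_
    rw [← integral_add (iφv _) (hri n (iφv _))]
    refine integral_congr_ae (Eventually.of_forall fun t => ?_)
    simp only [U, map_add, map_smul, smul_eq_mul]) (fun _ => z) (memLp_const z)
  have h2 : Tendsto (fun n => ∫ t, gradE E (U n t) z ∂(timeMeasure T)) atTop
      (𝓝 (∫ _, (midpoint ℝ (gradE E a) (gradE E b)) z ∂(timeMeasure T))) := by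
    have h3 := (hlim (fun _ => 1 / 2 * (gradE E a z - gradE E b z)) (integrable_const _)).const_add
      (∫ _, (midpoint ℝ (gradE E a) (gradE E b)) z ∂(timeMeasure T))
    rw [add_zero] at h3
    refine h3.congr fun n => ?_
    rw [← integral_add (integrable_const _) (hri n (integrable_const _))]
    refine integral_congr_ae (Eventually.of_forall fun t => ?_)
    have hmid : (midpoint ℝ (gradE E a) (gradE E b)) z = 1 / 2 * (gradE E a z + gradE E b z) := by
      rw [midpoint_eq_smul_add, smul_apply, add_apply, smul_eq_mul]; norm_num
    simp only [hmid]
    rcases hUab n t with h4 | h4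
    · rw [h4.1, h4.2]; ring
    · rw [h4.1, h4.2]; ring
  have h3 := tendsto_nhds_unique h1 h2
  rw [integral_const, integral_const] at h3
  have hvol : (timeMeasure T).real univ ≠ 0 := by
    rw [timeMeasure, measureReal_restrict_apply_univ, Real.volume_real_Ioo_of_le hT.le]
    linarith
  exact smul_right_injective ℝ hvol h3

/-- An energy with affine gradient is quadratic, so that the coercivity of the gradient makes it
semiconvex. -/
lemma gradient_inequality_of_map_midpoint {ι : X →L[ℝ] H} (hE : ContDiff ℝ 1 E)
    (hmid : ∀ a b, gradE E (midpoint ℝ a b) = midpoint ℝ (gradE E a) (gradE E b)) {C₁ C₂ : ℝ}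
    (hC₁ : 0 < C₁) (hcoer : ∀ x : X, C₁ * ‖x‖ ^ p - C₂ * ‖ι x‖ ^ 2 ≤ gradE E x x) (x₁ x₂ : X) :
    E x₁ + gradE E x₁ (x₂ - x₁) - |C₂| / 2 * ‖ι (x₂ - x₁)‖ ^ 2 ≤ E x₂ := by
  -- a continuous midpoint-preserving map is affine
  set A : X →ᵃ[ℝ] (X →L[ℝ] ℝ) := AffineMap.ofMapMidpoint (gradE E) hmid
    (hE.continuous_fderiv (by simp))
  have hA : ∀ x d : X, gradE E (x + d) = gradE E x + A.linear d := fun x d => by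
    have := A.map_vadd x d
    rw [vadd_eq_add, vadd_eq_add, add_comm d, add_comm (A.linear d)] at this
    exact this
  -- the quadratic part is bounded below, by scaling in the coercivity condition
  have hquad : ∀ d : X, -C₂ * ‖ι d‖ ^ 2 ≤ A.linear d d := by
    intro d
    have h1 : ∀ s : ℝ, 0 < s → -C₂ * ‖ι d‖ ^ 2 ≤ A.linear d d + s⁻¹ * gradE E 0 d := by
      intro s hs
      have h2 := hcoer (s • d)
      have h3 := hA 0 (s • d)
      rw [zero_add] at h3
      simp only [h3, map_smul, norm_smul, add_apply, smul_apply, smul_eq_mul,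
        Real.norm_of_nonneg hs.le] at h2
      have h4 : 0 ≤ C₁ * (s * ‖d‖) ^ p := by positivity
      have h5 : s ^ 2 * (-C₂ * ‖ι d‖ ^ 2) ≤ s ^ 2 * (A.linear d d + s⁻¹ * gradE E 0 d) := by
        have : s ^ 2 * (A.linear d d + s⁻¹ * gradE E 0 d) =
            s * (s * A.linear d d) + s * gradE E 0 d := by field_simp
        rw [this]
        nlinarith
      exact le_of_mul_le_mul_left h5 (by positivity)
    have h2 : Tendsto (fun s : ℝ => A.linear d d + s⁻¹ * gradE E 0 d) atTop
        (𝓝 (A.linear d d + 0 * gradE E 0 d)) :=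
      (tendsto_inv_atTop_zero.mul_const _).const_add _
    rw [zero_mul, add_zero] at h2
    exact ge_of_tendsto h2 ((eventually_gt_atTop 0).mono h1)
  set d := x₂ - x₁
  have hd : ∀ s : ℝ, HasDerivAt (fun s : ℝ => E (x₁ + s • d) - s * gradE E x₁ d -
      s ^ 2 * (1 / 2 * A.linear d d)) 0 s := by
    intro s
    have h1 := hasDerivAt_energy_line hE x₁ d s
    have h2 := (hasDerivAt_id' s).mul_const (gradE E x₁ d)
    have h3 : HasDerivAt (fun s : ℝ => s ^ 2) (2 * s) s := by simpa using hasDerivAt_pow 2 s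
    refine ((h1.fun_sub h2).fun_sub (h3.mul_const (1 / 2 * A.linear d d))).congr_deriv ?_
    rw [hA x₁ (s • d), map_smul, add_apply, smul_apply, smul_eq_mul]
    ring
  have hconst := is_const_of_deriv_eq_zero (fun s => (hd s).differentiableAt)
    (fun s => (hd s).deriv) 1 0
  simp only [one_smul, zero_smul, add_zero] at hconst
  have e : x₁ + d = x₂ := by simp [d]
  rw [e] at hconst
  have h4 := hquad d
  have h5 : -(|C₂| / 2 * ‖ι d‖ ^ 2) ≤ 1 / 2 * (-C₂ * ‖ι d‖ ^ 2) := by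
    have : C₂ * ‖ι d‖ ^ 2 ≤ |C₂| * ‖ι d‖ ^ 2 := by gcongr; exact le_abs_self _
    linarith
  linarith

end Semiconvex

/-! ### The energy identity in the extended space -/

section Conclusion

variable {X H : Type*} [NormedAddCommGroup X] [NormedSpace ℝ X]
  [NormedAddCommGroup H] [InnerProductSpace ℝ H] {ι : X →L[ℝ] H} {E : X → ℝ} {p α T : ℝ}
  {u₀ : X} {u : ℝ → X}

/-- Along a solution, which is bounded in `H`, a bound on the energy bounds the norm of `X`. -/
lemma IsVariationalSolution.norm_le_of_energy_le (hp : 1 < p) (hE : ContDiff ℝ 1 E) {C₁ C₂ : ℝ}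
    (hC₁ : 0 < C₁) (hcoer : ∀ x : X, C₁ * ‖x‖ ^ p - C₂ * ‖ι x‖ ^ 2 ≤ gradE E x x)
    (hu : IsVariationalSolution ι E p α T (ι u₀) u) (R : ℝ) :
    ∃ M : ℝ, ∀ᵐ t ∂(timeMeasure T), E (u t) ≤ R → ‖u t‖ ≤ M := by
  obtain ⟨Y, hY0, hY⟩ := hu.exists_bound
  have hp0 : 0 < p := one_pos.trans hp
  refine ⟨1 + (R - E 0 + |C₂| / 2 * Y ^ 2) / (C₁ / p), ?_⟩
  filter_upwards [hY] with t ht hR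
  refine (le_one_add_rpow (norm_nonneg _) hp).trans (add_le_add_right ?_ _)
  rw [le_div_iff₀ (by positivity)]
  have h1 := coercive_energy hp hE ι hcoer (u t)
  have h2 : C₂ / 2 * ‖ι (u t)‖ ^ 2 ≤ |C₂| / 2 * Y ^ 2 := by
    gcongr
    exact le_abs_self _
  linarith

/-- The extended state `-c₀(θ) ∫₀ᵗ exp(-c₁(θ)(t-s)) grad E(u(s)) ds` is the rescaled relaxation of
the force at the rate `c₁(θ)`. -/
lemma extState_eq {t θ : ℝ} (ht : t ∈ Icc 0 T) :
    extState E u t θ = cZero θ • expConv (cOne θ) (flowForce E T u) t := by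
  have h1 : expConv (cOne θ) (flowForce E T u) t =
      expConv (cOne θ) (fun s => -gradE E (u s)) t := by
    refine expConv_congr ht.1 ?_ _
    filter_upwards [compl_mem_ae_iff.2 (measure_singleton T)] with s hs hst
    exact flowForce_of_mem ⟨hst.1, lt_of_le_of_ne (hst.2.le.trans ht.2) hs⟩
  have h2 : expConv (cOne θ) (fun s => -gradE E (u s)) t =
      -∫ s in (0 : ℝ)..t, Real.exp (-(cOne θ * (t - s))) • gradE E (u s) := by
    rw [← intervalIntegral.integral_neg]
    exact intervalIntegral.integral_congr fun s _ => smul_neg _ _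
  rw [h1, h2]
  exact (smul_neg _ _).symm

end Conclusion

theorem mainTheorem4
    {X H : Type*} [NormedAddCommGroup X] [NormedSpace ℝ X] [CompleteSpace X]
    [TopologicalSpace.SeparableSpace X]
    [NormedAddCommGroup H] [InnerProductSpace ℝ H] [CompleteSpace H]
    [TopologicalSpace.SeparableSpace H]
    (hrefl : Function.Surjective (NormedSpace.inclusionInDoubleDual ℝ X))
    (ι : X →L[ℝ] H) (hinj : Function.Injective ι) (hdense : DenseRange ι)
    (hcomp : IsCompactOperator ι)
    (p α T : ℝ) (hp : 1 < p) (hα : α ∈ Ioo (0 : ℝ) 1) (hT : 0 < T)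
    (E : X → ℝ) (hE : ContDiff ℝ 1 E)
    (C₀ C₁ C₂ : ℝ) (hC₁ : 0 < C₁)
    (hbound : ∀ x : X, ‖gradE E x‖ ≤ C₀ * ‖x‖ ^ (p - 1) + C₀)
    (hcoer : ∀ x : X, C₁ * ‖x‖ ^ p - C₂ * ‖ι x‖ ^ 2 ≤ gradE E x x)
    (hgrad : GradWeakToWeak E p T ∨ ∃ lam : ℝ, IsSemiconvex ι E lam)
    (u₀ : X) (u : ℝ → X) (hu : IsVariationalSolution ι E p α T (ι u₀) u) :
    ∃ (U V : ℝ → HTilde H α) (Φ : ℝ → ℝ),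
      -- `U = G u` takes values in `H`, and belongs to `H¹(0,T; H̃)` with derivative `V = ∂_t U`
      (∀ t ∈ Icc 0 T, ∀ᵐ θ ∂(volume.restrict (Ioo (0 : ℝ) 1)),
        toDualX ι (U t θ) = extState E u t θ) ∧
      MemLp V 2 (timeMeasure T) ∧
      (∀ t ∈ Icc 0 T, U t = ∫ s in (0 : ℝ)..t, V s) ∧
      (∀ᵐ t ∂(timeMeasure T), HasDerivAt U (V t) t) ∧
      -- `Φ` is the augmented energy along the solution
      (∀ᵐ t ∂(timeMeasure T),
        MemLp (U t) 2 (wgtMeasure (wgt α)) ∧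
        reconstruct α (ι u₀) (U t) = ι (u t) ∧
        Φ t = E (u t) + historyEnergy α (U t) ∧
        Φ t = extEnergy ι E α (ι u₀) (U t)) ∧
      Φ 0 = E u₀ ∧
      -- it is non-increasing, absolutely continuous, and has the stated derivative
      AntitoneOn Φ (Icc 0 T) ∧
      (∀ s ∈ Icc 0 T, ∀ t ∈ Icc 0 T, s ≤ t →
        Φ t = Φ s - ∫ r in s..t, ‖V r‖ ^ 2) ∧
      (∀ᵐ t ∂(timeMeasure T), HasDerivAt Φ (-‖V t‖ ^ 2) t) := by
  -- under both alternatives the energy is semiconvex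
  obtain ⟨κ, hκ, hsemi⟩ : ∃ κ : ℝ, 0 ≤ κ ∧ ∀ x₁ x₂ : X,
      E x₁ + gradE E x₁ (x₂ - x₁) - κ * ‖ι (x₂ - x₁)‖ ^ 2 ≤ E x₂ := by
    rcases hgrad with h | ⟨lam, h⟩
    · exact ⟨|C₂| / 2, by positivity,
        gradient_inequality_of_map_midpoint hE (h.map_midpoint hp hT) hC₁ hcoer⟩
    · exact ⟨|lam| / 2, by positivity, h.gradient_inequality hE⟩
  obtain ⟨F, h⟩ := hu.exists_isSuperposedFlow hdense hp hα hT hE hC₁ hbound hcoer hκ hsemi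
  have := neZero_fracMeasure hα
  obtain ⟨V₀, hV₀, hU₀⟩ := h.exists_derivative
  have hbal := h.energy_balance (denseRange_toDualXL hrefl hinj)
    (hu.norm_le_of_energy_le hp hE hC₁ hcoer) hV₀ hU₀
  have hreg := h.ae_regular hV₀ hU₀
  have h0 : (0 : ℝ) ∈ Icc 0 T := ⟨le_rfl, hT.le⟩
  have hTT : T ∈ Icc 0 T := ⟨hT.le, le_rfl⟩
  set J : Lp H 2 (fracMeasure α) →L[ℝ] HTilde H α := (extIso hα).toContinuousLinearMap
  set V : ℝ → HTilde H α := fun t => J (V₀ t)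
  have hV : MemLp V 2 (timeMeasure T) := J.comp_memLp' hV₀
  have hVn : ∀ t, ‖V t‖ = ‖V₀ t‖ := fun t => (extIso hα).norm_map (V₀ t)
  have hVi : ∀ {s t : ℝ}, s ∈ Icc 0 T → t ∈ Icc 0 T → IntervalIntegrable V volume s t :=
    intervalIntegrable_of_integrable_timeMeasure (integrable_of_memLp_two hV)
  have hVi₀ : ∀ {s t : ℝ}, s ∈ Icc 0 T → t ∈ Icc 0 T → IntervalIntegrable V₀ volume s t :=
    intervalIntegrable_of_integrable_timeMeasure (integrable_of_memLp_two hV₀)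
  have hV2 : ∀ {s t : ℝ}, s ∈ Icc 0 T → t ∈ Icc 0 T →
      IntervalIntegrable (fun r => ‖V r‖ ^ 2) volume s t :=
    intervalIntegrable_of_integrable_timeMeasure (MemLp.integrable_norm_sq hV)
  set U : ℝ → HTilde H α := fun t => ∫ s in (0 : ℝ)..t, V s
  set Φ : ℝ → ℝ := fun t => E u₀ - ∫ r in (0 : ℝ)..t, ‖V r‖ ^ 2
  have hUJ : ∀ t ∈ Icc 0 T, U t = extIso hα (∫ s in (0 : ℝ)..t, V₀ s) := fun t ht =>
    J.intervalIntegral_comp_comm (hVi₀ h0 ht)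
  have hΦ : ∀ s ∈ Icc 0 T, ∀ t ∈ Icc 0 T, Φ t = Φ s - ∫ r in s..t, ‖V r‖ ^ 2 := by
    intro s hs t ht
    have := intervalIntegral.integral_add_adjacent_intervals (hV2 h0 hs) (hV2 hs ht)
    simp only [Φ]
    linarith
  refine ⟨U, V, Φ, fun t ht => ?_, hV, fun t _ => rfl, ?_, ?_, by simp [Φ], ?_,
    fun s hs t ht _ => hΦ s hs t ht, ?_⟩
  · have h1 := (ae_fracMeasure_iff hα).1 (hU₀ t ht)
    rw [hUJ t ht]
    filter_upwards [h1, coeFn_extIso hα (∫ s in (0 : ℝ)..t, V₀ s),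
      ae_restrict_mem measurableSet_Ioo] with θ e1 e2 hθ
    rw [e2, e1, fracRate_of_mem hθ, extState_eq ht, ← h.toDualXL_relax _ ht]
    exact map_smul (toDualXL ι) _ _
  · refine ae_timeMeasure_iff.2 ?_
    filter_upwards [(hVi h0 hTT).ae_hasDerivAt_integral] with t h1 ht
    exact h1 (by rw [uIcc_of_le hT.le]; exact Ioo_subset_Icc_self ht) 0 left_mem_uIcc
  · filter_upwards [hbal, hreg, ae_restrict_mem measurableSet_Ioo] with t h1 h2 ht
    obtain ⟨-, hi, hrec⟩ := h2
    rw [hUJ t (Ioo_subset_Icc_self ht)]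
    have hR : reconstruct α (ι u₀) (extIso hα (∫ s in (0 : ℝ)..t, V₀ s)) = ι (u t) := by
      rw [reconstruct_extIso, ← hrec, flowIncr_of_mem ht, map_sub, add_sub_cancel]
    have hen : Φ t = E (u t) + historyEnergy α (extIso hα (∫ s in (0 : ℝ)..t, V₀ s)) := by
      rw [historyEnergy_extIso, h1]
      simp only [Φ, hVn]
    refine ⟨memLp_extIso hα hi, hR, hen, ?_⟩
    rw [extEnergy, hR, hinj.extend_apply, hen]
  · intro s hs t ht hst
    rw [hΦ s hs t ht]
    have := intervalIntegral.integral_nonneg (μ := volume) hst fun r _ => sq_nonneg ‖V r‖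
    linarith
  · refine ae_timeMeasure_iff.2 ?_
    filter_upwards [(hV2 h0 hTT).ae_hasDerivAt_integral] with t h1 ht
    exact (h1 (by rw [uIcc_of_le hT.le]; exact Ioo_subset_Icc_self ht) 0
      left_mem_uIcc).const_sub (E u₀)
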